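/- Let $\alpha\in(1,2]$ and $\beta=1-1/\alpha\in(0,1/2]$. Marchal's algorithm with parameter $\alpha$ grows random leaf-labelled trees $\mathbf T(1),\mathbf T(2),\dots$ as follows. $\mathbf T(1)$ is a single edge joining the root $A_0$ and the leaf $A_1$. Given $\mathbf T(1),\dots,\mathbf T(n)$, give weight $\alpha-1$ to each edge of $\mathbf T(n)$ and weight $d-1-\alpha$ to each branch point of degree $d\ge 3$, and select an edge or a branch point with probability proportional to its weight. If an edge is selected, split it by a new vertex $V_{n+1}$ and join a new leaf $A_{n+1}$ to $V_{n+1}$ by a new edge; if a branch point is selected, join $A_{n+1}$ to it by a new edge. The result is $\mathbf T(n+1)$. Write $W$ for the total weight of a sub-structure. For $n\ge 0$, cut $\mathbf T(n+2)$ at $V_2$. Let $\tau^{(n)}_0,\tau^{(n)}_1,\tau^{(n)}_2$ be the resulting subtrees containing $A_0,A_1,A_2$ (each including its edge at $V_2$, and with $V_2$ itself weightless in it). Let $K_n$ be the number of further subtrees, denote these by $\tau^{(n)}_3,\dots,\tau^{(n)}_{K_n+2}$ in the order of their least leaf labels, and let $\sigma^{(n)}$ be their union. Let $N_j(n)$ and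 $N_\sigma(n)$ be the numbers of leaves, excluding $V_2$, of $\tau^{(n)}_j$ and $\sigma^{(n)}$. A P\'olya urn with initialisation $\gamma$ and step-size $s$ draws, at each step, a colour with probability proportional to its current content, and then increases the content of that colour by $s$. (i) Let $\alpha=2$. Then almost surely $K_n=0$ for all $n\ge0$. The vector $\big(W(\tau^{(n)}_0),W(\tau^{(n)}_1),W(\tau^{(n)}_2)\big)_{n\ge0}$ evolves almost surely as the content of a P\'olya urn with initialisation $(1,1,1)$ and step-size $2$, and $$\frac{1}{2n+3}\big(W(\tau^{(n)}_0),W(\tau^{(n)}_1),W(\tau^{(n)}_2)\big)\to (X_0,X_1,X_2)\sim\mathrm{Dir}(1/2,1/2,1/2)\quad\text{a.s.}$$ (ii) Let $\alpha\in(1,2)$. Then $K_n\to\infty$ almost surely. The vector $\big(W(\tau^{(n)}_0),W(\tau^{(n)}_1),W(\tau^{(n)}_2),W(\sigma^{(n)})+W(\{V_2\})\big)_{n\ge0}$ evolves almost surely as the content of a P\'olya urn with initialisation $(\alpha-1,\alpha-1,\alpha-1,2-\alpha)$ and step-size $\alpha$, and $$\frac{1}{(n+2)\alpha-1}\big(W(\tau^{(n)}_0),W(\tau^{(n)}_1),W(\tau^{(n)}_2),W(\sigma^{(n)})+W(\{V_2\})\big)\to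 (X_0,X_1,X_2,X_3)\sim\mathrm{Dir}(\beta,\beta,\beta,1-2\beta)\quad\text{a.s.}$$ Moreover, with the leaves of $\sigma^{(n)}$ as customers and the subtrees $\tau_3,\tau_4,\dots$ as tables, the extra subtrees follow a Chinese restaurant process $\mathrm{CRP}(1-\beta,1-2\beta)$: there is such a process for which, almost surely, for all $n\ge0$, $K_n$ is its number of tables after $N_\sigma(n)$ customers, and for $1\le i\le K_n$ its $i$-th table then has $N_{i+2}(n)$ customers and $W(\tau^{(n)}_{i+2})=\alpha N_{i+2}(n)-1$. (In $\mathrm{CRP}(a,\theta)$, the first customer opens the first table; given $m\ge 1$ seated customers at $k$ tables of sizes $n_1,\dots,n_k$, the next one joins table $i$ with probability $(n_i-a)/(m+\theta)$ and opens table $k+1$ with probability $(\theta+ka)/(m+\theta)$.) Finally, almost surely, for all $i\ge1$ the limits $$P_i=\lim_{n\to\infty}\frac{W(\tau^{(n)}_{i+2})}{W(\sigma^{(n)})+W(\{V_2\})}$$ exist (the ratio being read as $0$ when $i>K_n$), and $(P_i)_{i\ge1}\sim\mathrm{GEM}(1-\beta,1-2\beta)$; that is, $(P_i)_{i\ge 1}$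 has the law of $\big(B_i\prod_{j<i}(1-B_j)\big)_{i\ge1}$ for independent $B_j\sim\mathrm{Beta}(\beta,(1-2\beta)+j(1-\beta))$. Its decreasing rearrangement has the Poisson--Dirichlet law $\mathrm{PD}(1-\beta,1-2\beta)$, the law of a $\mathrm{GEM}(1-\beta,1-2\beta)$ sequence ranked in decreasing order. -/

import Mathlib

open MeasureTheory ProbabilityTheory Filter Topology

namespace MarchalTree

/-! ### Leaf-labelled discrete trees and Marchal's algorithm -/

/-- Vertices: `Sum.inl k` is the leaf `A k`, `Sum.inr k` is the branch point `V k`. -/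
abbrev Vertex := ℕ ⊕ ℕ

/-- The leaf (for `k = 0`: the root) `A k`. -/
abbrev A (k : ℕ) : Vertex := Sum.inl k

/-- The branch point `V k`, created (if at all) together with the leaf `A k`. -/
abbrev V (k : ℕ) : Vertex := Sum.inr k

/-- A finite discrete tree, given by its set of edges. -/
abbrev DTree := Finset (Sym2 Vertex)

/-- The objects carrying weight: edges (`Sum.inl e`) and branch points (`Sum.inr v`). -/
abbrev Site := Sym2 Vertex ⊕ Vertex

/-- The vertices of a tree. -/
def vertices (t : DTree) : Finset Vertex := t.biUnion Sym2.toFinset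

/-- The degree of a vertex in a tree. -/
def degree (t : DTree) (v : Vertex) : ℕ := (t.filter (fun e => v ∈ e)).card

/-- The branch points of a tree: the vertices of degree at least three. -/
def branchPoints (t : DTree) : Finset Vertex := (vertices t).filter (fun v => 3 ≤ degree t v)

/-- All the edges and branch points of a tree. -/
def sites (t : DTree) : Finset Site := t.disjSum (branchPoints t)

/-- Weight `α - 1` for an edge, `d - 1 - α` for a branch point of degree `d`. -/
def siteWeight (α : ℝ) (t : DTree) : Site → ℝ
  | Sum.inl _ => α - 1
  | Sum.inr v => (degree t v : ℝ) - 1 - α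

/-- Total weight `W(S)` of a sub-structure `S` of the tree `t`, where `S` is given by its weighted
edges and branch points. -/
noncomputable def weight (α : ℝ) (t : DTree) (S : Finset Site) : ℝ := ∑ c ∈ S, siteWeight α t c

/-- The tree with the single edge joining the root `A 0` and the leaf `A 1`. -/
def initialTree : DTree := {s(A 0, A 1)}

/-- One growth step, from `n` to `n + 1` leaves. If an edge is selected, it is split in two by the new
vertex `V (n + 1)`, to which the new leaf `A (n + 1)` is joined by a new edge. If a branch point is
selected, the new leaf is joined to it by a new edge. -/
def grow (n : ℕ) (t : DTree) : Site → DTree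
  | Sum.inl e =>
      t.erase e ∪ e.toFinset.image (fun v => s(v, V (n + 1))) ∪ {s(V (n + 1), A (n + 1))}
  | Sum.inr v => insert s(v, A (n + 1)) t

/-- `T n`, `n ≥ 1`, is a realisation of Marchal's algorithm with parameter `α` (the value `T 0` plays
no role): `T 1` is the one-edge tree and, given the trees up to time `n`, the tree `T (n + 1)` is
obtained by growing `T n` at an edge or branch point selected with probability proportional to its
weight. As the set of trees is countable, conditional laws are elementary ones. -/
structure IsMarchal {Ω : Type*} [MeasurableSpace Ω] (P : Measure Ω) (α : ℝ)
    (T : ℕ → Ω → DTree) : Prop where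
  measurable : ∀ n, 1 ≤ n → ∀ t : DTree, MeasurableSet {ω | T n ω = t}
  init : ∀ᵐ ω ∂P, T 1 ω = initialTree
  step : ∀ n, 1 ≤ n → ∀ (h : ℕ → DTree), ∀ c ∈ sites (h n),
    P {ω | (∀ k, 1 ≤ k → k ≤ n → T k ω = h k) ∧ T (n + 1) ω = grow n (h n) c} =
      P {ω | ∀ k, 1 ≤ k → k ≤ n → T k ω = h k} *
        ENNReal.ofReal (siteWeight α (h n) c / weight α (h n) (sites (h n)))

/-! ### The subtrees obtained by cutting at `V 2` -/

/-- The graph obtained from the tree by removing all edges at `V 2`. -/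
def cutGraph (t : DTree) : SimpleGraph Vertex :=
  SimpleGraph.fromEdgeSet {e | e ∈ t ∧ V 2 ∉ e}

/-- `v` and `w` are joined by a path in the tree that avoids `V 2`
(for `w ≠ V 2` this fails when `v = V 2`). -/
def Joined (t : DTree) (v w : Vertex) : Prop := (cutGraph t).Reachable v w

open Classical in
/-- The subtree at `V 2` that contains the vertex `w ≠ V 2`, given by its edges (including the edge
incident to `V 2`) and its branch points (excluding `V 2`, which is weightless in the subtree). -/
noncomputable def subtreeAt (t : DTree) (w : Vertex) : Finset Site :=
  (t.filter (fun e => ∃ v ∈ e, Joined t v w)).disjSum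
    ((branchPoints t).filter (fun v => Joined t v w))

open Classical in
/-- The labels of the leaves of the subtree at `V 2` that contains the vertex `w ≠ V 2`. -/
noncomputable def leafLabelsAt (t : DTree) (w : Vertex) : Finset ℕ :=
  (vertices t).toLeft.filter (fun k => Joined t (A k) w)

open Classical in
/-- The edges incident to `V 2` other than the three edges pointing towards `A 0`, `A 1`, `A 2`. -/
noncomputable def extraEdges (t : DTree) : Finset (Sym2 Vertex) :=
  t.filter (fun e => V 2 ∈ e ∧ ∀ v ∈ e, ∀ i < 3, ¬ Joined t v (A i))

/-- The number `K` of extra subtrees at `V 2`. -/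
noncomputable def numExtra (t : DTree) : ℕ := (extraEdges t).card

/-- The least leaf label in the subtree growing along the edge `e` incident to `V 2`. -/
noncomputable def leastLabel (t : DTree) (e : Sym2 Vertex) : ℕ :=
  sInf {k | A k ∈ vertices t ∧ ∃ v ∈ e, Joined t v (A k)}

/-- The least leaf label of the `i`-th subtree: the subtrees `0`, `1`, `2` contain `A 0`, `A 1`,
`A 2`, and the extra subtrees `3, …, K + 2` are ordered by their least leaf labels. -/
noncomputable def subtreeLabel (t : DTree) (i : ℕ) : ℕ :=
  if i < 3 then i else Nat.nth (fun k => ∃ e ∈ extraEdges t, leastLabel t e = k) (i - 3)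

/-- The subtree `τ_i`, for `0 ≤ i ≤ K + 2`; it is empty for `i ≥ K + 3`. -/
noncomputable def subtree (t : DTree) (i : ℕ) : Finset Site :=
  if i < numExtra t + 3 then subtreeAt t (A (subtreeLabel t i)) else ∅

/-- The number `N_i` of leaves (excluding `V 2`) of `τ_i`; it is `0` for `i ≥ K + 3`. -/
noncomputable def leafCount (t : DTree) (i : ℕ) : ℕ :=
  if i < numExtra t + 3 then (leafLabelsAt t (A (subtreeLabel t i))).card else 0

/-- The remaining part `σ`: the union of the extra subtrees `τ_3, …, τ_{K + 2}`. -/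
noncomputable def extraPart (t : DTree) : Finset Site :=
  (Finset.range (numExtra t)).biUnion (fun j => subtree t (j + 3))

/-- The number of leaves (excluding `V 2`) of `σ`. -/
noncomputable def extraLeafCount (t : DTree) : ℕ :=
  ∑ j ∈ Finset.range (numExtra t), leafCount t (j + 3)

/-- `W(σ) + W({V_2})`. -/
noncomputable def remainingWeight (α : ℝ) (t : DTree) : ℝ :=
  weight α t (extraPart t) + weight α t {Sum.inr (V 2)}

/-- `(W(τ_0), W(τ_1), W(τ_2))`. -/
noncomputable def threeWeights (α : ℝ) (t : DTree) : Fin 3 → ℝ :=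
  ![weight α t (subtree t 0), weight α t (subtree t 1), weight α t (subtree t 2)]

/-- `(W(τ_0), W(τ_1), W(τ_2), W(σ) + W({V_2}))`. -/
noncomputable def fourWeights (α : ℝ) (t : DTree) : Fin 4 → ℝ :=
  ![weight α t (subtree t 0), weight α t (subtree t 1), weight α t (subtree t 2),
    remainingWeight α t]

/-! ### Generalised Pólya urns -/

/-- Composition of the urn with initialisation `γ` and step-size `s` after the first `n` draws of
the sequence `x`. -/
noncomputable def urnContent {K : ℕ} (γ : Fin K → ℝ) (s : ℝ) (x : ℕ → Fin K) (n : ℕ) :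
    Fin K → ℝ :=
  fun j => γ j + s * ((Finset.range n).filter (fun k => x k = j)).card

/-- `X 0, X 1, …` are the draws of a generalised Pólya urn with `K` colours, initialisation `γ` and
step-size `s`: given the first `n` draws, the next colour is drawn with probability proportional to
the content of the urn. -/
structure IsPolyaUrn {Ω : Type*} [MeasurableSpace Ω] (P : Measure Ω) {K : ℕ} (γ : Fin K → ℝ)
    (s : ℝ) (X : ℕ → Ω → Fin K) : Prop where
  measurable : ∀ n, Measurable (X n)
  step : ∀ (n : ℕ) (x : ℕ → Fin K) (j : Fin K),
    P {ω | (∀ k < n, X k ω = x k) ∧ X n ω = j} =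
      P {ω | ∀ k < n, X k ω = x k} *
        ENNReal.ofReal (urnContent γ s x n j / ∑ i, urnContent γ s x n i)

/-! ### Chinese restaurant processes -/

/-- Number of customers at table `j` after the first `n` customers are seated according to `c`. -/
def tableSize (c : ℕ → ℕ) (n j : ℕ) : ℕ := ((Finset.range n).filter (fun k => c k = j)).card

/-- Number of tables occupied after the first `n` customers are seated according to `c`. -/
def numTables (c : ℕ → ℕ) (n : ℕ) : ℕ := ((Finset.range n).image c).card

/-- `C 0, C 1, …` are the tables chosen by the successive customers in a Chinese restaurant process
with an `(a, θ)` seating plan; customers and tables are numbered from `0`, and tables are numbered in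
order of occupation. -/
structure IsCRP {Ω : Type*} [MeasurableSpace Ω] (P : Measure Ω) (a θ : ℝ)
    (C : ℕ → Ω → ℕ) : Prop where
  measurable : ∀ n, Measurable (C n)
  init : ∀ᵐ ω ∂P, C 0 ω = 0
  step : ∀ n, 1 ≤ n → ∀ (c : ℕ → ℕ) (j : ℕ),
    P {ω | (∀ k < n, C k ω = c k) ∧ C n ω = j} =
      P {ω | ∀ k < n, C k ω = c k} *
        ENNReal.ofReal
          (if j < numTables c n then ((tableSize c n j : ℝ) - a) / (n + θ)
           else if j = numTables c n then (θ + numTables c n * a) / (n + θ)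
           else 0)

/-! ### Dirichlet, Griffiths–Engen–McCloskey and Poisson–Dirichlet distributions -/

/-- The Dirichlet distribution: the law of `(G_1, …, G_K) / (G_1 + ⋯ + G_K)` for independent
`G_i ∼ Gamma(γ_i, 1)`. -/
noncomputable def dirichlet {K : ℕ} (γ : Fin K → ℝ) : Measure (Fin K → ℝ) :=
  (Measure.pi (fun i => gammaMeasure (γ i) 1)).map (fun g i => g i / ∑ j, g j)

/-- Stick breaking: `w ↦ (w_0, (1 - w_0) w_1, (1 - w_0) (1 - w_1) w_2, …)`. -/
noncomputable def stickBreaking (w : ℕ → ℝ) : ℕ → ℝ :=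
  fun j => (∏ i ∈ Finset.range j, (1 - w i)) * w j

theorem measurable_stickBreaking : Measurable stickBreaking := by
  unfold stickBreaking
  fun_prop

/-- `GEM(a, θ)`: the law of the stick-breaking sequence of independent `W_j ∼ Beta(1 - a, θ + j a)`,
`j ≥ 1`. It is a probability measure for `0 ≤ a < 1` and `θ > -a`. -/
noncomputable def GEM (a θ : ℝ) : Measure (ℕ → ℝ) :=
  (Measure.infinitePi
    (fun j : ℕ => betaMeasure (1 - a) (θ + ((j : ℝ) + 1) * a))).map stickBreaking

theorem isProbabilityMeasure_GEM {a θ : ℝ} (ha : 0 ≤ a) (ha' : a < 1) (hθ : -a < θ) :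
    IsProbabilityMeasure (GEM a θ) := by
  have h : ∀ j : ℕ, IsProbabilityMeasure (betaMeasure (1 - a) (θ + ((j : ℝ) + 1) * a)) := fun j =>
    isProbabilityMeasureBeta (by linarith) (by
      have : 0 ≤ (j : ℝ) * a := by positivity
      linarith)
  exact Measure.isProbabilityMeasure_map measurable_stickBreaking.aemeasurable

/-- Ranking in decreasing order: `ranked x i` is the `(i + 1)`-st largest term of `x`, that is, the
supremum over all sets of `i + 1` indices of the least term of `x` on the set. -/
noncomputable def ranked (x : ℕ → ℝ) : ℕ → ℝ :=
  fun i => ⨆ s : {s : Finset ℕ // s.card = i + 1}, ⨅ k : s.1, x k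

theorem measurable_ranked : Measurable ranked := by
  unfold ranked
  refine measurable_pi_lambda _ fun i => Measurable.iSup fun s => Measurable.iInf fun k => ?_
  exact measurable_pi_apply _

/-- `PD(a, θ)`: the law of a `GEM(a, θ)` sequence ranked in decreasing order. -/
noncomputable def PD (a θ : ℝ) : Measure (ℕ → ℝ) := (GEM a θ).map ranked

end MarchalTree

/-!
Cut the tree at `V 2` and number the resulting subtrees in the order of their least leaf labels.
By induction along the growth steps (`Labelled.grow`), a subtree with `k` leaves has weight
`α k - 1`, the vertex `V 2` has weight `d - 1 - α`, where `d` is the number of subtrees, and the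
total weight with `m` leaves is `α m - 1`. Hence the index of the subtree joined by the next leaf
is chosen according to the seating plan of a Chinese restaurant with parameters `1/α` and
`-(1 + 1/α)`, started from three tables with one customer each (`IsMarchal.leafProcess_step`).
Merging all tables but the first three yields the Pólya urns (`IsLeafProcess.isPolyaUrn_four`,
`IsLeafProcess.isPolyaUrn_three`). Observing only the customers at the other tables yields the
restaurant `CRP(1/α, 2/α - 1)` (`IsLeafProcess.isCRP`), where `1/α = 1 - β` and
`2/α - 1 = 1 - 2β`. For `α = 2` no other table is ever opened, since `V 2` then has weight `0`.

The almost sure limits rest on de Finetti's idea. A model is built from random frequencies and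
independent uniform variables, in which every draw selects a colour according to the frequencies
(`mixedDraw`); there, the law of large numbers identifies the limiting proportions with the
frequencies. If an urn or a restaurant gives the same probability as the model to each initial
segment, then it has the same law as the model, and the limits carry over together with their law
(`map_eq_map_of_forall_past`, `exists_limit_of_map_eq`).

* For the restaurant, the frequencies are obtained by stick breaking with independent beta
  fractions. The mean probability of a seating is a product of beta moments over the tables, and
  seating one more customer multiplies it by a telescoping product whose value is the seating
  probability (`prod_betaMoment_succ`).
* For the urn, the frequencies are normalised gamma variables. Up to a factor that depends on the
  order of the moment only, their moments follow from writing a power of the sum as a Laplace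
  transform, and that factor is determined because the frequencies sum to `1`
  (`lintegral_dirichlet_update`).

For `α < 2` the limiting fraction of the fourth colour is almost surely positive, so the
restaurant receives infinitely many customers, and it opens infinitely many tables because stick
breaking never exhausts the unit mass.
-/

namespace MarchalTree

/-! ### Restricted growth sequences -/

/-- The first `n` terms of `c` are a restricted growth sequence: a value that is new at time `k` is
the least value not taken before. -/
def IsRG (c : ℕ → ℕ) (n : ℕ) : Prop := ∀ k < n, c k ≤ numTables c k

theorem IsRG.mono {c : ℕ → ℕ} {m n : ℕ} (h : IsRG c n) (hmn : m ≤ n) : IsRG c m :=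
  fun k hk => h k (hk.trans_le hmn)

theorem isRG_succ {c : ℕ → ℕ} {n : ℕ} : IsRG c (n + 1) ↔ IsRG c n ∧ c n ≤ numTables c n := by
  constructor
  · exact fun h => ⟨h.mono n.le_succ, h n n.lt_succ_self⟩
  · rintro ⟨h, hn⟩ k hk
    rcases Nat.lt_succ_iff_lt_or_eq.1 hk with h' | rfl
    exacts [h k h', hn]

theorem numTables_congr {c c' : ℕ → ℕ} {n : ℕ} (h : ∀ k < n, c k = c' k) :
    numTables c n = numTables c' n := by
  unfold numTables
  rw [Finset.image_congr (g := c') fun k hk => h k (by simpa using hk)]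

theorem tableSize_congr {c c' : ℕ → ℕ} {n : ℕ} (h : ∀ k < n, c k = c' k) (j : ℕ) :
    tableSize c n j = tableSize c' n j := by
  unfold tableSize
  rw [Finset.filter_congr fun k hk => by rw [h k (by simpa using hk)]]

theorem isRG_congr {c c' : ℕ → ℕ} {n : ℕ} (h : ∀ k < n, c k = c' k) : IsRG c n ↔ IsRG c' n := by
  refine forall₂_congr fun k hk => ?_
  rw [h k hk, numTables_congr fun i hi => h i (hi.trans hk)]

@[simp] theorem numTables_zero (c : ℕ → ℕ) : numTables c 0 = 0 := rfl

@[simp] theorem tableSize_zero (c : ℕ → ℕ) (j : ℕ) : tableSize c 0 j = 0 := rfl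

theorem tableSize_succ (c : ℕ → ℕ) (n j : ℕ) :
    tableSize c (n + 1) j = tableSize c n j + if c n = j then 1 else 0 := by
  unfold tableSize
  rw [Finset.range_add_one, Finset.filter_insert]
  split_ifs with h
  · rw [Finset.card_insert_of_notMem (by simp)]
  · rfl

/-- The values taken by a restricted growth sequence form an initial segment. -/
theorem IsRG.image_eq {c : ℕ → ℕ} {n : ℕ} (h : IsRG c n) :
    (Finset.range n).image c = Finset.range (numTables c n) := by
  induction n with
  | zero => simp
  | succ n ih =>
    rw [isRG_succ] at h
    have ih := ih h.1
    rcases h.2.lt_or_eq with h' | h'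
    · have : (Finset.range (n + 1)).image c = (Finset.range n).image c := by
        rw [Finset.range_add_one, Finset.image_insert, Finset.insert_eq_of_mem]
        rw [ih]; simpa using h'
      rw [numTables, this]
      exact ih
    · have : (Finset.range (n + 1)).image c = Finset.range (numTables c n + 1) := by
        rw [Finset.range_add_one, Finset.image_insert, ih, Finset.range_add_one, h']
      rw [numTables, this, Finset.card_range]

theorem IsRG.numTables_succ {c : ℕ → ℕ} {n : ℕ} (h : IsRG c (n + 1)) :
    numTables c (n + 1) = numTables c n + if c n = numTables c n then 1 else 0 := by
  have h1 := (isRG_succ.1 h).1.image_eq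
  have h2 : numTables c (n + 1) = (insert (c n) (Finset.range (numTables c n))).card := by
    rw [← h1, ← Finset.image_insert, ← Finset.range_add_one]; rfl
  rw [h2]
  split_ifs with h'
  · rw [h', ← Finset.range_add_one, Finset.card_range]
  · rw [Finset.insert_eq_of_mem, Finset.card_range, Nat.add_zero]
    exact Finset.mem_range.2 (lt_of_le_of_ne (isRG_succ.1 h).2 h')

theorem IsRG.lt_numTables {c : ℕ → ℕ} {n k : ℕ} (h : IsRG c n) (hk : k < n) :
    c k < numTables c n := by
  have : c k ∈ (Finset.range n).image c := Finset.mem_image_of_mem _ (by simpa using hk)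
  rwa [h.image_eq, Finset.mem_range] at this

theorem IsRG.exists_eq {c : ℕ → ℕ} {n j : ℕ} (h : IsRG c n) (hj : j < numTables c n) :
    ∃ k < n, c k = j := by
  have : j ∈ (Finset.range n).image c := by rw [h.image_eq]; simpa using hj
  simpa using this

theorem tableSize_eq_zero {c : ℕ → ℕ} {n j : ℕ} : tableSize c n j = 0 ↔ ∀ k < n, c k ≠ j := by
  simp [tableSize, Finset.filter_eq_empty_iff]

theorem IsRG.tableSize_pos {c : ℕ → ℕ} {n j : ℕ} (h : IsRG c n) :
    0 < tableSize c n j ↔ j < numTables c n := by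
  rw [Nat.pos_iff_ne_zero, Ne, tableSize_eq_zero]
  push Not
  exact ⟨fun ⟨k, hk, e⟩ => e ▸ h.lt_numTables hk, fun hj => h.exists_eq hj⟩

theorem IsRG.tableSize_eq_zero {c : ℕ → ℕ} {n j : ℕ} (h : IsRG c n) (hj : numTables c n ≤ j) :
    tableSize c n j = 0 := by
  have := h.tableSize_pos (j := j)
  omega

theorem IsRG.sum_tableSize {c : ℕ → ℕ} {n M : ℕ} (h : IsRG c n) (hM : numTables c n ≤ M) :
    ∑ j ∈ Finset.range M, tableSize c n j = n := by
  unfold tableSize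
  rw [← Finset.card_eq_sum_card_fiberwise, Finset.card_range]
  intro k hk
  simpa using (h.lt_numTables (by simpa using hk)).trans_le hM

theorem numTables_le_succ (c : ℕ → ℕ) (n : ℕ) : numTables c n ≤ numTables c (n + 1) :=
  Finset.card_le_card (Finset.image_subset_image (Finset.range_mono n.le_succ))

theorem numTables_mono (c : ℕ → ℕ) : Monotone (numTables c) :=
  monotone_nat_of_le_succ (numTables_le_succ c)

theorem numTables_succ (c : ℕ → ℕ) (n : ℕ) :
    numTables c (n + 1) = numTables c n + if tableSize c n (c n) = 0 then 1 else 0 := by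
  have h1 : numTables c (n + 1) = (insert (c n) ((Finset.range n).image c)).card := by
    rw [← Finset.image_insert, ← Finset.range_add_one]; rfl
  have h2 : c n ∈ (Finset.range n).image c ↔ ¬ tableSize c n (c n) = 0 := by
    rw [tableSize_eq_zero]; simp
  rw [h1]
  split_ifs with h
  · rw [Finset.card_insert_of_notMem fun hm => h2.1 hm h]; rfl
  · rw [Finset.insert_eq_of_mem (h2.2 h)]; rfl

/-- The probability with which the seating plan of `CRP(a, θ)` sends the customer that follows the
first `n` customers of `c` to table `j`. -/
noncomputable def crpProb (a θ : ℝ) (c : ℕ → ℕ) (n j : ℕ) : ℝ :=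
  if j < numTables c n then ((tableSize c n j : ℝ) - a) / (n + θ)
  else if j = numTables c n then (θ + numTables c n * a) / (n + θ)
  else 0

theorem crpProb_congr {a θ : ℝ} {c c' : ℕ → ℕ} {n : ℕ} (h : ∀ k < n, c k = c' k) (j : ℕ) :
    crpProb a θ c n j = crpProb a θ c' n j := by
  simp only [crpProb, numTables_congr h, tableSize_congr h]

/-! ### Shape of the trees along Marchal's algorithm -/

theorem mem_vertices {t : DTree} {v : Vertex} : v ∈ vertices t ↔ ∃ e ∈ t, v ∈ e := by
  simp [vertices]

theorem degree_eq_sum (t : DTree) (v : Vertex) :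
    degree t v = ∑ e ∈ t, if v ∈ e then 1 else 0 := by
  rw [degree, Finset.card_filter]

theorem degree_eq_zero {t : DTree} {v : Vertex} (h : v ∉ vertices t) : degree t v = 0 := by
  rw [degree, Finset.card_eq_zero, Finset.filter_eq_empty_iff]
  exact fun e he hv => h (mem_vertices.2 ⟨e, he, hv⟩)

theorem grow_edge_eq (m : ℕ) (t : DTree) (a b : Vertex) :
    grow m t (Sum.inl s(a, b)) =
      insert s(V (m + 1), A (m + 1))
        (insert s(a, V (m + 1)) (insert s(b, V (m + 1)) (t.erase s(a, b)))) := by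
  ext e
  simp only [grow, Finset.mem_union, Finset.mem_image, Sym2.mem_toFinset, Sym2.mem_iff,
    Finset.mem_insert, Finset.mem_singleton]
  constructor
  · rintro ((h | ⟨v, rfl | rfl, rfl⟩) | h) <;> simp_all
  · rintro (h | h | h | h)
    · exact Or.inr h
    · exact Or.inl (Or.inr ⟨a, Or.inl rfl, h.symm⟩)
    · exact Or.inl (Or.inr ⟨b, Or.inr rfl, h.symm⟩)
    · exact Or.inl (Or.inl h)

/-- A tree of Marchal's algorithm with leaves `A 0, …, A m`, as far as its shape is concerned: all
the vertices `V k` are branch points, all the vertices `A k` are leaves, and `V 2` has been created.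
-/
structure Shape (m : ℕ) (t : DTree) : Prop where
  two_le : 2 ≤ m
  leaf_mem : ∀ k, A k ∈ vertices t ↔ k ≤ m
  branch_le : ∀ k, V k ∈ vertices t → k ≤ m
  not_diag : ∀ e ∈ t, ¬ e.IsDiag
  leaf_degree : ∀ k, degree t (A k) ≤ 1
  branch_degree : ∀ k, V k ∈ vertices t → 3 ≤ degree t (V k)
  hub_mem : V 2 ∈ vertices t

section Growth

variable {m : ℕ} {t : DTree} (h : Shape m t)
include h

theorem Shape.newLeaf_notMem : A (m + 1) ∉ vertices t := by
  rw [h.leaf_mem]; omega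

theorem Shape.newBranch_notMem : V (m + 1) ∉ vertices t := fun hx => by
  have := h.branch_le _ hx; omega

theorem Shape.ne_newLeaf {v : Vertex} (hv : v ∈ vertices t) : v ≠ A (m + 1) :=
  fun e => h.newLeaf_notMem (e ▸ hv)

theorem Shape.ne_newBranch {v : Vertex} (hv : v ∈ vertices t) : v ≠ V (m + 1) :=
  fun e => h.newBranch_notMem (e ▸ hv)

theorem Shape.newBranch_ne_hub : V (m + 1) ≠ V 2 := fun e => by
  have := h.two_le
  have := Sum.inr_injective e
  omega

theorem Shape.mem_branchPoints {v : Vertex} :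
    v ∈ branchPoints t ↔ v ∈ vertices t ∧ ∃ k, v = V k := by
  rw [branchPoints, Finset.mem_filter]
  refine and_congr_right fun hv => ⟨fun hd => ?_, ?_⟩
  · rcases v with k | k
    · have := h.leaf_degree k
      exact absurd (hd.trans this) (by norm_num)
    · exact ⟨k, rfl⟩
  · rintro ⟨k, rfl⟩
    exact h.branch_degree k hv

theorem Shape.ne_of_mem {a b : Vertex} (he : s(a, b) ∈ t) : a ≠ b :=
  fun e => h.not_diag _ he (Sym2.mk_isDiag_iff.2 e)

omit h in
theorem left_mem_vertices {a b : Vertex} (he : s(a, b) ∈ t) : a ∈ vertices t :=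
  mem_vertices.2 ⟨_, he, Sym2.mem_mk_left a b⟩

omit h in
theorem right_mem_vertices {a b : Vertex} (he : s(a, b) ∈ t) : b ∈ vertices t :=
  mem_vertices.2 ⟨_, he, Sym2.mem_mk_right a b⟩

/-- Splitting the edge `e` changes a sum over all edges by the three new terms and the term of `e`.
-/
theorem Shape.sum_grow_edge {M : Type*} [AddCommMonoid M] {a b : Vertex} (he : s(a, b) ∈ t)
    (F : Sym2 Vertex → M) :
    ∑ e ∈ grow m t (Sum.inl s(a, b)), F e + F s(a, b) =
      ∑ e ∈ t, F e + F s(a, V (m + 1)) + F s(b, V (m + 1)) + F s(V (m + 1), A (m + 1)) := by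
  have ha := left_mem_vertices he
  have hb := right_mem_vertices he
  have hab := h.ne_of_mem he
  have hax := h.ne_newBranch ha
  have hbx := h.ne_newBranch hb
  have hay := h.ne_newLeaf ha
  have hby := h.ne_newLeaf hb
  have hx : ∀ v, s(v, V (m + 1)) ∉ t := fun v hv =>
    h.newBranch_notMem (right_mem_vertices hv)
  have hy : ∀ v, s(v, A (m + 1)) ∉ t := fun v hv =>
    h.newLeaf_notMem (right_mem_vertices hv)
  rw [grow_edge_eq, Finset.sum_insert, Finset.sum_insert, Finset.sum_insert,
    ← Finset.add_sum_erase t F he]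
  · abel
  · simp [hx]
  · simp [hx, hab, hax]
  · simp [hy, hay.symm, hby.symm]

theorem Shape.sum_grow_vertex {M : Type*} [AddCommMonoid M] (v : Vertex) (F : Sym2 Vertex → M) :
    ∑ e ∈ grow m t (Sum.inr v), F e = ∑ e ∈ t, F e + F s(v, A (m + 1)) := by
  rw [grow, Finset.sum_insert, add_comm]
  exact fun hv => h.newLeaf_notMem (right_mem_vertices hv)

omit h in
theorem mem_vertices_grow_edge {a b : Vertex} (he : s(a, b) ∈ t) {v : Vertex} :
    v ∈ vertices (grow m t (Sum.inl s(a, b))) ↔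
      v ∈ vertices t ∨ v = V (m + 1) ∨ v = A (m + 1) := by
  have ha := left_mem_vertices he
  have hb := right_mem_vertices he
  rw [mem_vertices, grow_edge_eq]
  constructor
  · rintro ⟨e, he', hv⟩
    simp only [Finset.mem_insert, Finset.mem_erase] at he'
    rcases he' with rfl | rfl | rfl | he'
    · exact Or.inr (Sym2.mem_iff.1 hv)
    · rcases Sym2.mem_iff.1 hv with rfl | rfl <;> simp [ha]
    · rcases Sym2.mem_iff.1 hv with rfl | rfl <;> simp [hb]
    · exact Or.inl (mem_vertices.2 ⟨e, he'.2, hv⟩)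
  · rintro (hv | rfl | rfl)
    · obtain ⟨e, he', hv⟩ := mem_vertices.1 hv
      by_cases hee : e = s(a, b)
      · subst hee
        rcases Sym2.mem_iff.1 hv with rfl | rfl
        · exact ⟨s(v, V (m + 1)), by simp, by simp⟩
        · exact ⟨s(v, V (m + 1)), by simp, by simp⟩
      · exact ⟨e, by simp [he', hee], hv⟩
    · exact ⟨s(V (m + 1), A (m + 1)), by simp, by simp⟩
    · exact ⟨s(V (m + 1), A (m + 1)), by simp, by simp⟩

omit h in
theorem mem_vertices_grow_vertex {v w : Vertex} (hv : v ∈ vertices t) :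
    w ∈ vertices (grow m t (Sum.inr v)) ↔ w ∈ vertices t ∨ w = A (m + 1) := by
  simp only [mem_vertices, grow, Finset.mem_insert, exists_eq_or_imp, Sym2.mem_iff] at hv ⊢
  constructor
  · rintro ((rfl | rfl) | hw)
    exacts [Or.inl hv, Or.inr rfl, Or.inl hw]
  · rintro (hw | rfl)
    exacts [Or.inr hw, Or.inl (Or.inr rfl)]

theorem Shape.degree_grow_edge {a b : Vertex} (he : s(a, b) ∈ t) {v : Vertex} (hx : v ≠ V (m + 1))
    (hy : v ≠ A (m + 1)) : degree (grow m t (Sum.inl s(a, b))) v = degree t v := by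
  have := h.sum_grow_edge he fun e => if v ∈ e then 1 else 0
  simp only [← degree_eq_sum, Sym2.mem_iff, hx, hy, or_false] at this
  have hab := h.ne_of_mem he
  by_cases h1 : v = a
  · subst h1
    simp [hab] at this
    omega
  · simp [h1] at this
    exact this

theorem Shape.degree_grow_edge_newBranch {a b : Vertex} (he : s(a, b) ∈ t) :
    degree (grow m t (Sum.inl s(a, b))) (V (m + 1)) = 3 := by
  have := h.sum_grow_edge he fun e => if V (m + 1) ∈ e then 1 else 0
  have h1 := h.ne_newBranch (left_mem_vertices he)
  have h2 := h.ne_newBranch (right_mem_vertices he)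
  simp only [← degree_eq_sum] at this
  simpa [h1.symm, h2.symm, degree_eq_zero h.newBranch_notMem] using this

theorem Shape.degree_grow_edge_newLeaf {a b : Vertex} (he : s(a, b) ∈ t) :
    degree (grow m t (Sum.inl s(a, b))) (A (m + 1)) = 1 := by
  have := h.sum_grow_edge he fun e => if A (m + 1) ∈ e then 1 else 0
  have h1 := h.ne_newLeaf (left_mem_vertices he)
  have h2 := h.ne_newLeaf (right_mem_vertices he)
  simp only [← degree_eq_sum] at this
  simpa [h1.symm, h2.symm, degree_eq_zero h.newLeaf_notMem] using this

theorem Shape.degree_grow_vertex (v : Vertex) {w : Vertex} (hw : w ≠ A (m + 1)) :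
    degree (grow m t (Sum.inr v)) w = degree t w + if w = v then 1 else 0 := by
  have := h.sum_grow_vertex v fun e => if w ∈ e then 1 else 0
  simp only [← degree_eq_sum] at this
  simpa [hw] using this

theorem Shape.degree_grow_vertex_newLeaf (v : Vertex) :
    degree (grow m t (Sum.inr v)) (A (m + 1)) = 1 := by
  have := h.sum_grow_vertex v fun e => if A (m + 1) ∈ e then 1 else 0
  simp only [← degree_eq_sum] at this
  simpa [degree_eq_zero h.newLeaf_notMem] using this

/-- Splitting an edge preserves the shape. -/
theorem Shape.grow_edge {a b : Vertex} (he : s(a, b) ∈ t) :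
    Shape (m + 1) (grow m t (Sum.inl s(a, b))) where
  two_le := h.two_le.trans m.le_succ
  leaf_mem k := by
    rw [mem_vertices_grow_edge he, h.leaf_mem]
    simp
    omega
  branch_le k hk := by
    rw [mem_vertices_grow_edge he] at hk
    rcases hk with hk | hk | hk
    · exact (h.branch_le k hk).trans m.le_succ
    · exact (Sum.inr_injective hk).le
    · simp at hk
  not_diag e he' := by
    have h1 := h.ne_newBranch (left_mem_vertices he)
    have h2 := h.ne_newBranch (right_mem_vertices he)
    rw [grow_edge_eq] at he'
    simp only [Finset.mem_insert, Finset.mem_erase] at he'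
    rcases he' with rfl | rfl | rfl | he'
    · simp
    · simpa using h1
    · simpa using h2
    · exact h.not_diag e he'.2
  leaf_degree k := by
    by_cases hk : k = m + 1
    · subst hk; exact (h.degree_grow_edge_newLeaf he).le
    · rw [h.degree_grow_edge he (by simp) (by simpa using hk)]
      exact h.leaf_degree k
  branch_degree k hk := by
    rw [mem_vertices_grow_edge he] at hk
    by_cases hk' : k = m + 1
    · subst hk'; exact (h.degree_grow_edge_newBranch he).ge
    · rw [h.degree_grow_edge he (by simpa using hk') (by simp)]
      exact h.branch_degree k (by simpa [hk'] using hk)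
  hub_mem := (mem_vertices_grow_edge he).2 (Or.inl h.hub_mem)

/-- Attaching a leaf to a branch point preserves the shape. -/
theorem Shape.grow_vertex {v : Vertex} (hv : v ∈ branchPoints t) :
    Shape (m + 1) (grow m t (Sum.inr v)) := by
  obtain ⟨hv, i, rfl⟩ := h.mem_branchPoints.1 hv
  refine ⟨h.two_le.trans m.le_succ, fun k => ?_, fun k hk => ?_, fun e he => ?_, fun k => ?_,
    fun k hk => ?_, ?_⟩
  · rw [mem_vertices_grow_vertex hv, h.leaf_mem]
    simp
    omega
  · rw [mem_vertices_grow_vertex hv] at hk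
    exact (h.branch_le k (by simpa using hk)).trans m.le_succ
  · simp only [grow, Finset.mem_insert] at he
    rcases he with rfl | he
    · simp
    · exact h.not_diag e he
  · by_cases hk : k = m + 1
    · subst hk; exact (h.degree_grow_vertex_newLeaf _).le
    · rw [h.degree_grow_vertex _ (by simpa using hk)]
      simpa using h.leaf_degree k
  · rw [mem_vertices_grow_vertex hv] at hk
    rw [h.degree_grow_vertex _ (by simp)]
    exact (h.branch_degree k (by simpa using hk)).trans (Nat.le_add_right _ _)
  · exact (mem_vertices_grow_vertex hv).2 (Or.inl h.hub_mem)

theorem Shape.branchPoints_grow_edge {a b : Vertex} (he : s(a, b) ∈ t) :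
    branchPoints (grow m t (Sum.inl s(a, b))) = insert (V (m + 1)) (branchPoints t) := by
  ext v
  rw [(h.grow_edge he).mem_branchPoints, Finset.mem_insert, h.mem_branchPoints,
    mem_vertices_grow_edge he]
  constructor
  · rintro ⟨hv | rfl | rfl, k, hk⟩
    exacts [Or.inr ⟨hv, k, hk⟩, Or.inl rfl, by simp at hk]
  · rintro (rfl | ⟨hv, hk⟩)
    exacts [⟨Or.inr (Or.inl rfl), _, rfl⟩, ⟨Or.inl hv, hk⟩]

theorem Shape.branchPoints_grow_vertex {v : Vertex} (hv : v ∈ branchPoints t) :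
    branchPoints (grow m t (Sum.inr v)) = branchPoints t := by
  ext w
  rw [(h.grow_vertex hv).mem_branchPoints, h.mem_branchPoints,
    mem_vertices_grow_vertex (h.mem_branchPoints.1 hv).1]
  constructor
  · rintro ⟨hw | rfl, k, hk⟩
    exacts [⟨hw, k, hk⟩, by simp at hk]
  · exact fun hw => ⟨Or.inl hw.1, hw.2⟩

theorem Shape.hub_mem_branchPoints : V 2 ∈ branchPoints t :=
  h.mem_branchPoints.2 ⟨h.hub_mem, 2, rfl⟩

end Growth

/-! ### Labelling the vertices by the subtrees at `V 2` -/

/-- The edge `e` belongs to the subtree with index `i`, where `ℓ` maps a vertex to the index of its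
subtree (the value `ℓ (V 2)` being irrelevant). -/
def EdgeIn (ℓ : Vertex → ℕ) (i : ℕ) (e : Sym2 Vertex) : Prop := ∃ v ∈ e, v ≠ V 2 ∧ ℓ v = i

theorem edgeIn_mk {ℓ : Vertex → ℕ} {i : ℕ} {a b : Vertex} :
    EdgeIn ℓ i s(a, b) ↔ (a ≠ V 2 ∧ ℓ a = i) ∨ (b ≠ V 2 ∧ ℓ b = i) := by
  simp [EdgeIn]

open Classical in
/-- The edges and branch points of the subtree with index `i`, where `ℓ` maps a vertex to the index
of its subtree. -/
noncomputable def component (t : DTree) (ℓ : Vertex → ℕ) (i : ℕ) : Finset Site :=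
  (t.filter (EdgeIn ℓ i)).disjSum ((branchPoints t).filter (fun v => v ≠ V 2 ∧ ℓ v = i))

/-- The indices of the subtrees to which the successive leaves `A 0, A 1, …` belong. -/
def leafIndex (ℓ : Vertex → ℕ) (k : ℕ) : ℕ := ℓ (A k)

/-- `ℓ` maps each vertex of `t` to the index of its subtree at `V 2`, where the subtrees are
numbered in the order of their least leaf labels. The leaves of `t` are `A 0, …, A m`. -/
structure Labelled (α : ℝ) (m : ℕ) (t : DTree) (ℓ : Vertex → ℕ) : Prop extends Shape m t where
  edge_label : ∀ v w, s(v, w) ∈ t → v ≠ V 2 → w ≠ V 2 → ℓ v = ℓ w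
  joined : ∀ v ∈ vertices t, ∀ w ∈ vertices t, v ≠ V 2 → w ≠ V 2 → ℓ v = ℓ w → Joined t v w
  exists_leaf : ∀ v ∈ vertices t, v ≠ V 2 → ∃ k ≤ m, leafIndex ℓ k = ℓ v
  isRG : IsRG (leafIndex ℓ) (m + 1)
  leafIndex_lt_three : ∀ i < 3, leafIndex ℓ i = i
  card_hub_edges : ∀ i, ∑ e ∈ t, (open Classical in if V 2 ∈ e ∧ EdgeIn ℓ i e then 1 else 0) =
    if i < numTables (leafIndex ℓ) (m + 1) then 1 else 0
  weight_component : ∀ i, weight α t (component t ℓ i) =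
    α * tableSize (leafIndex ℓ) (m + 1) i -
      if i < numTables (leafIndex ℓ) (m + 1) then 1 else 0

/-- The labelling after the growth step that joins the leaf `A (m + 1)` to the subtree with
index `j`. -/
def relabel (m : ℕ) (ℓ : Vertex → ℕ) (j : ℕ) (v : Vertex) : ℕ :=
  if v = V (m + 1) ∨ v = A (m + 1) then j else ℓ v

@[simp] theorem relabel_newBranch (m : ℕ) (ℓ : Vertex → ℕ) (j : ℕ) :
    relabel m ℓ j (V (m + 1)) = j := by simp [relabel]

@[simp] theorem relabel_newLeaf (m : ℕ) (ℓ : Vertex → ℕ) (j : ℕ) :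
    relabel m ℓ j (A (m + 1)) = j := by simp [relabel]

@[simp] theorem leafIndex_relabel (m : ℕ) (ℓ : Vertex → ℕ) (j : ℕ) :
    leafIndex (relabel m ℓ j) (m + 1) = j := by simp [leafIndex]

theorem leafIndex_relabel_of_lt (m : ℕ) (ℓ : Vertex → ℕ) (j : ℕ) :
    ∀ k < m + 1, leafIndex (relabel m ℓ j) k = leafIndex ℓ k := by
  intro k hk
  have : k ≠ m + 1 := hk.ne
  simp [leafIndex, relabel, this]

theorem Shape.relabel_eq {m : ℕ} {t : DTree} (h : Shape m t) (ℓ : Vertex → ℕ) (j : ℕ) {v : Vertex}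
    (hv : v ∈ vertices t) : relabel m ℓ j v = ℓ v := by
  simp [relabel, h.ne_newBranch hv, h.ne_newLeaf hv]

theorem Shape.edgeIn_relabel {m : ℕ} {t : DTree} (h : Shape m t) (ℓ : Vertex → ℕ) (i j : ℕ)
    {e : Sym2 Vertex} (he : e ∈ t) : EdgeIn (relabel m ℓ j) i e ↔ EdgeIn ℓ i e :=
  exists_congr fun _ => and_congr_right fun hv => by
    rw [h.relabel_eq ℓ j (mem_vertices.2 ⟨e, he, hv⟩)]

theorem Shape.sum_edgeIn_relabel {M : Type*} [AddCommMonoid M] {m : ℕ} {t : DTree}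
    (h : Shape m t) (ℓ : Vertex → ℕ) (i j : ℕ) (F : Sym2 Vertex → Prop → M) :
    ∑ e ∈ t, F e (EdgeIn (relabel m ℓ j) i e) = ∑ e ∈ t, F e (EdgeIn ℓ i e) :=
  Finset.sum_congr rfl fun _ he => by rw [h.edgeIn_relabel ℓ i j he]

section

open Classical in
theorem weight_component_eq (α : ℝ) (t : DTree) (ℓ : Vertex → ℕ) (i : ℕ) :
    weight α t (component t ℓ i) =
      ∑ e ∈ t, (if EdgeIn ℓ i e then α - 1 else 0) +
        ∑ v ∈ branchPoints t,
          if v ≠ V 2 ∧ ℓ v = i then (degree t v : ℝ) - 1 - α else 0 := by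
  rw [weight, component, Finset.sum_disjSum, Finset.sum_filter, Finset.sum_filter]
  rfl

variable {α : ℝ} {m : ℕ} {t : DTree} {ℓ : Vertex → ℕ}

theorem Labelled.label_of_mem (h : Labelled α m t ℓ) {e : Sym2 Vertex} (he : e ∈ t) {i : ℕ}
    (hi : EdgeIn ℓ i e) {v : Vertex} (hv : v ∈ e) (hv2 : v ≠ V 2) : ℓ v = i := by
  obtain ⟨w, hw, hw2, rfl⟩ := hi
  by_cases hvw : v = w
  · rw [hvw]
  · rw [(Sym2.mem_and_mem_iff hvw).1 ⟨hv, hw⟩] at he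
    exact h.edge_label v w he hv2 hw2

theorem Labelled.edgeIn_iff (h : Labelled α m t ℓ) {e : Sym2 Vertex} (he : e ∈ t) {i j : ℕ}
    (hj : EdgeIn ℓ j e) : EdgeIn ℓ i e ↔ i = j := by
  constructor
  · rintro ⟨v, hv, hv2, rfl⟩
    exact h.label_of_mem he hj hv hv2
  · rintro rfl; exact hj

theorem Labelled.exists_edgeIn (h : Labelled α m t ℓ) {e : Sym2 Vertex} (he : e ∈ t) :
    ∃ i, EdgeIn ℓ i e := by
  induction e using Sym2.ind with
  | _ a b =>
    by_cases ha : a = V 2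
    · have : b ≠ V 2 := fun hb => h.ne_of_mem he (ha.trans hb.symm)
      exact ⟨ℓ b, edgeIn_mk.2 (Or.inr ⟨this, rfl⟩)⟩
    · exact ⟨ℓ a, edgeIn_mk.2 (Or.inl ⟨ha, rfl⟩)⟩

theorem Labelled.label_lt (h : Labelled α m t ℓ) {v : Vertex} (hv : v ∈ vertices t)
    (hv2 : v ≠ V 2) : ℓ v < numTables (leafIndex ℓ) (m + 1) := by
  obtain ⟨k, hk, e⟩ := h.exists_leaf v hv hv2
  rw [← e]
  exact h.isRG.lt_numTables (Nat.lt_succ_of_le hk)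

theorem Labelled.edgeIn_lt (h : Labelled α m t ℓ) {e : Sym2 Vertex} (he : e ∈ t) {i : ℕ}
    (hi : EdgeIn ℓ i e) : i < numTables (leafIndex ℓ) (m + 1) := by
  obtain ⟨v, hv, hv2, rfl⟩ := hi
  exact h.label_lt (mem_vertices.2 ⟨e, he, hv⟩) hv2

theorem Joined.label_eq (h : ∀ v w, s(v, w) ∈ t → v ≠ V 2 → w ≠ V 2 → ℓ v = ℓ w) {v w : Vertex}
    (hvw : Joined t v w) : ℓ v = ℓ w ∧ (w ≠ V 2 → v ≠ V 2) := by
  obtain ⟨p⟩ := hvw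
  induction p with
  | nil => exact ⟨rfl, id⟩
  | cons hadj _ ih =>
    simp only [cutGraph, SimpleGraph.fromEdgeSet_adj, Set.mem_ofPred_eq, Sym2.mem_iff,
      not_or] at hadj
    exact ⟨(h _ _ hadj.1.1 (Ne.symm hadj.1.2.1) (Ne.symm hadj.1.2.2)).trans ih.1,
      fun _ => Ne.symm hadj.1.2.1⟩

theorem Labelled.joined_iff (h : Labelled α m t ℓ) {v w : Vertex} (hv : v ∈ vertices t)
    (hw : w ∈ vertices t) (hw2 : w ≠ V 2) : Joined t v w ↔ v ≠ V 2 ∧ ℓ v = ℓ w := by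
  constructor
  · intro hj
    have := Joined.label_eq h.edge_label hj
    exact ⟨this.2 hw2, this.1⟩
  · rintro ⟨hv2, he⟩
    exact h.joined v hv w hw hv2 hw2 he

theorem joined_of_mem {v w : Vertex} (hvw : s(v, w) ∈ t) (hne : v ≠ w) (hv : v ≠ V 2)
    (hw : w ≠ V 2) : Joined t v w := by
  refine SimpleGraph.Adj.reachable ?_
  simp [cutGraph, hvw, hne, Ne.symm hv, Ne.symm hw]

/-- Joinedness passes to a tree in which the endpoints of the old edges remain joined. -/
theorem Joined.mono_of_adj {t' : DTree}
    (h : ∀ v w, s(v, w) ∈ t → v ≠ w → v ≠ V 2 → w ≠ V 2 → Joined t' v w) {v w : Vertex}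
    (hvw : Joined t v w) : Joined t' v w := by
  obtain ⟨p⟩ := hvw
  induction p with
  | nil => exact SimpleGraph.Reachable.refl _
  | cons hadj _ ih =>
    simp only [cutGraph, SimpleGraph.fromEdgeSet_adj, Set.mem_ofPred_eq, Sym2.mem_iff,
      not_or] at hadj
    exact (h _ _ hadj.1.1 hadj.2 (Ne.symm hadj.1.2.1) (Ne.symm hadj.1.2.2)).trans ih

theorem Labelled.isRG_relabel (h : Labelled α m t ℓ) {j : ℕ}
    (hj : j ≤ numTables (leafIndex ℓ) (m + 1)) : IsRG (leafIndex (relabel m ℓ j)) (m + 1 + 1) := by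
  have hc := leafIndex_relabel_of_lt m ℓ j
  rw [isRG_succ, isRG_congr hc, numTables_congr hc, leafIndex_relabel]
  exact ⟨h.isRG, hj⟩

theorem Labelled.numTables_relabel (h : Labelled α m t ℓ) {j : ℕ}
    (hj : j ≤ numTables (leafIndex ℓ) (m + 1)) :
    numTables (leafIndex (relabel m ℓ j)) (m + 1 + 1) =
      numTables (leafIndex ℓ) (m + 1) + if j = numTables (leafIndex ℓ) (m + 1) then 1 else 0 := by
  rw [(h.isRG_relabel hj).numTables_succ, numTables_congr (leafIndex_relabel_of_lt m ℓ j),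
    leafIndex_relabel]

theorem tableSize_relabel (m : ℕ) (ℓ : Vertex → ℕ) (j i : ℕ) :
    tableSize (leafIndex (relabel m ℓ j)) (m + 1 + 1) i =
      tableSize (leafIndex ℓ) (m + 1) i + if j = i then 1 else 0 := by
  rw [tableSize_succ, tableSize_congr (leafIndex_relabel_of_lt m ℓ j), leafIndex_relabel]

theorem Labelled.leafIndex_relabel_lt_three (h : Labelled α m t ℓ) (j : ℕ) :
    ∀ i < 3, leafIndex (relabel m ℓ j) i = i := fun i hi => by
  have := h.two_le
  rw [leafIndex_relabel_of_lt m ℓ j i (by omega), h.leafIndex_lt_three i hi]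

end

section GrowEdge

variable {α : ℝ} {m : ℕ} {t : DTree} {ℓ : Vertex → ℕ} {a b : Vertex} {j : ℕ}

theorem Labelled.joined_grow_edge (h : Labelled α m t ℓ) (he : s(a, b) ∈ t) {v w : Vertex}
    (hvw : Joined t v w) : Joined (grow m t (Sum.inl s(a, b))) v w := by
  have hax := h.ne_newBranch (left_mem_vertices he)
  have hbx := h.ne_newBranch (right_mem_vertices he)
  have hx2 := h.newBranch_ne_hub
  refine Joined.mono_of_adj (fun v w hvw hne hv hw => ?_) hvw
  have key : ∀ {c}, (c = a ∨ c = b) → c ≠ V 2 →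
      Joined (grow m t (Sum.inl s(a, b))) c (V (m + 1)) := by
    rintro c (rfl | rfl) hc
    · exact joined_of_mem (by simp [grow_edge_eq]) hax hc hx2
    · exact joined_of_mem (by simp [grow_edge_eq]) hbx hc hx2
  by_cases hee : s(v, w) = s(a, b)
  · refine (key ?_ hv).trans (key ?_ hw).symm
    · rcases Sym2.eq_iff.1 hee with ⟨rfl, rfl⟩ | ⟨rfl, rfl⟩ <;> simp
    · rcases Sym2.eq_iff.1 hee with ⟨rfl, rfl⟩ | ⟨rfl, rfl⟩ <;> simp
  · exact joined_of_mem (by simp [grow_edge_eq, hee, hvw]) hne hv hw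

/-- Splitting an edge of the subtree with index `j` adds the new leaf to this subtree: one leaf, two
edges and one branch point of degree three, hence the weight `2 (α - 1) + (2 - α) = α`. -/
theorem Labelled.grow_edge (h : Labelled α m t ℓ) (he : s(a, b) ∈ t) (hj : EdgeIn ℓ j s(a, b)) :
    Labelled α (m + 1) (grow m t (Sum.inl s(a, b))) (relabel m ℓ j) := by
  have ha := left_mem_vertices he
  have hb := right_mem_vertices he
  have hax := h.ne_newBranch ha
  have hbx := h.ne_newBranch hb
  have hx2 := h.newBranch_ne_hub
  have hy2 : A (m + 1) ≠ V 2 := by simp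
  have hxy : V (m + 1) ≠ A (m + 1) := by simp
  have hlt : j < numTables (leafIndex ℓ) (m + 1) := h.edgeIn_lt he hj
  have hla : a ≠ V 2 → ℓ a = j := h.label_of_mem he hj (by simp)
  have hlb : b ≠ V 2 → ℓ b = j := h.label_of_mem he hj (by simp)
  have hla' : a ≠ V 2 → relabel m ℓ j a = j := fun h2 => by rw [h.relabel_eq _ _ ha, hla h2]
  have hlb' : b ≠ V 2 → relabel m ℓ j b = j := fun h2 => by rw [h.relabel_eq _ _ hb, hlb h2]
  have hK : numTables (leafIndex (relabel m ℓ j)) (m + 1 + 1) =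
      numTables (leafIndex ℓ) (m + 1) := by
    rw [h.numTables_relabel hlt.le, if_neg hlt.ne, add_zero]
  have hnew : ∀ i c, (c ≠ V 2 → relabel m ℓ j c = j) →
      (EdgeIn (relabel m ℓ j) i s(c, V (m + 1)) ↔ i = j) := by
    intro i c hc
    rw [edgeIn_mk, relabel_newBranch]
    constructor
    · rintro (⟨h1, h2⟩ | ⟨-, h2⟩)
      exacts [h2.symm.trans (hc h1), h2.symm]
    · rintro rfl; exact Or.inr ⟨hx2, rfl⟩
  have hxyIn : ∀ i, EdgeIn (relabel m ℓ j) i s(V (m + 1), A (m + 1)) ↔ i = j := fun i => by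
    rw [Sym2.eq_swap]; exact hnew i _ fun _ => relabel_newLeaf m ℓ j
  have hmem := @mem_vertices_grow_edge m t a b he
  -- each vertex of the grown tree is joined to an old vertex with the same label
  have hold : ∀ v ∈ vertices (grow m t (Sum.inl s(a, b))), v ≠ V 2 →
      ∃ w ∈ vertices t, w ≠ V 2 ∧ ℓ w = relabel m ℓ j v ∧
        Joined (grow m t (Sum.inl s(a, b))) v w := by
    have hxold : ∃ w ∈ vertices t, w ≠ V 2 ∧ ℓ w = j ∧
        Joined (grow m t (Sum.inl s(a, b))) (V (m + 1)) w := by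
      obtain ⟨w, hw, hw2, hwj⟩ := hj
      refine ⟨w, mem_vertices.2 ⟨_, he, hw⟩, hw2, hwj, ?_⟩
      rcases Sym2.mem_iff.1 hw with rfl | rfl
      · exact joined_of_mem (by simp [grow_edge_eq, Sym2.eq_swap]) hax.symm hx2 hw2
      · exact joined_of_mem (by simp [grow_edge_eq, Sym2.eq_swap]) hbx.symm hx2 hw2
    intro v hv hv2
    rcases hmem.1 hv with hv | rfl | rfl
    · exact ⟨v, hv, hv2, (h.relabel_eq _ _ hv).symm, SimpleGraph.Reachable.refl _⟩
    · simpa using hxold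
    · obtain ⟨w, hw, hw2, hwj, hwx⟩ := hxold
      refine ⟨w, hw, hw2, by simpa using hwj, SimpleGraph.Reachable.trans ?_ hwx⟩
      exact joined_of_mem (by simp [grow_edge_eq, Sym2.eq_swap]) hxy.symm hy2 hx2
  refine ⟨h.toShape.grow_edge he, ?_, ?_, ?_, h.isRG_relabel hlt.le,
    h.leafIndex_relabel_lt_three j, fun i => ?_, fun i => ?_⟩
  · intro v w hvw hv hw
    have hvw' : EdgeIn (relabel m ℓ j) (relabel m ℓ j v) s(v, w) := ⟨v, by simp, hv, rfl⟩
    have hvw'' : EdgeIn (relabel m ℓ j) (relabel m ℓ j w) s(v, w) := ⟨w, by simp, hw, rfl⟩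
    rw [grow_edge_eq] at hvw
    simp only [Finset.mem_insert, Finset.mem_erase] at hvw
    rcases hvw with hvw | hvw | hvw | hvw
    · rw [hvw, hxyIn] at hvw' hvw''; exact hvw'.trans hvw''.symm
    · rw [hvw, hnew _ _ hla'] at hvw' hvw''; exact hvw'.trans hvw''.symm
    · rw [hvw, hnew _ _ hlb'] at hvw' hvw''; exact hvw'.trans hvw''.symm
    · rw [h.relabel_eq _ _ (left_mem_vertices hvw.2), h.relabel_eq _ _ (right_mem_vertices hvw.2)]
      exact h.edge_label v w hvw.2 hv hw
  · intro v hv w hw hv2 hw2 hvw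
    obtain ⟨v', hv', hv2', hlv, hjv⟩ := hold v hv hv2
    obtain ⟨w', hw', hw2', hlw, hjw⟩ := hold w hw hw2
    have := h.joined v' hv' w' hw' hv2' hw2' (by rw [hlv, hlw, hvw])
    exact (hjv.trans (h.joined_grow_edge he this)).trans hjw.symm
  · intro v hv hv2
    obtain ⟨v', hv', hv2', hlv, -⟩ := hold v hv hv2
    obtain ⟨k, hk, e⟩ := h.exists_leaf v' hv' hv2'
    refine ⟨k, hk.trans m.le_succ, ?_⟩
    rw [leafIndex_relabel_of_lt m ℓ j k (Nat.lt_succ_of_le hk), e, hlv]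
  · classical
    have hs := h.toShape.sum_grow_edge he
      fun e => if V 2 ∈ e ∧ EdgeIn (relabel m ℓ j) i e then 1 else 0
    rw [h.toShape.sum_edgeIn_relabel ℓ i j (fun e p => if V 2 ∈ e ∧ p then 1 else 0),
      h.card_hub_edges i] at hs
    simp only [hnew i a hla', hnew i b hlb', hxyIn, h.toShape.edgeIn_relabel ℓ i j he,
      h.edgeIn_iff he hj, Sym2.mem_iff, hx2.symm, hy2.symm, or_false, false_and, if_false,
      add_zero] at hs
    rw [hK]
    by_cases h1 : V 2 = a
    · have h2 : V 2 ≠ b := fun h2 => h.ne_of_mem he (h1.symm.trans h2)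
      simp only [h1, true_or, true_and] at hs h2 ⊢
      simp only [h2, false_and, if_false, add_zero] at hs
      exact Nat.add_right_cancel hs
    · simp only [h1, false_or, false_and, if_false, add_zero] at hs
      exact Nat.add_right_cancel hs
  · classical
    have hs := h.toShape.sum_grow_edge he
      fun e => if EdgeIn (relabel m ℓ j) i e then α - 1 else 0
    rw [h.toShape.sum_edgeIn_relabel ℓ i j (fun _ p => if p then α - 1 else 0)] at hs
    simp only [hnew i a hla', hnew i b hlb', hxyIn, h.toShape.edgeIn_relabel ℓ i j he,
      h.edgeIn_iff he hj] at hs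
    have hw := h.weight_component i
    rw [weight_component_eq] at hw
    have hbp : ∑ v ∈ branchPoints t, (if v ≠ V 2 ∧ relabel m ℓ j v = i then
        (degree (grow m t (Sum.inl s(a, b))) v : ℝ) - 1 - α else 0) =
        ∑ v ∈ branchPoints t, if v ≠ V 2 ∧ ℓ v = i then (degree t v : ℝ) - 1 - α else 0 := by
      refine Finset.sum_congr rfl fun v hv => ?_
      have hv := (h.mem_branchPoints.1 hv).1
      rw [h.relabel_eq _ _ hv, h.degree_grow_edge he (h.ne_newBranch hv) (h.ne_newLeaf hv)]
    rw [weight_component_eq, h.branchPoints_grow_edge he, Finset.sum_insert fun hx =>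
      h.newBranch_notMem (h.mem_branchPoints.1 hx).1, hbp, h.degree_grow_edge_newBranch he, hK,
      tableSize_relabel, relabel_newBranch]
    simp only [hx2, ne_eq, not_false_eq_true, true_and, @eq_comm _ j i]
    split_ifs at hs hw ⊢ <;> push_cast at hs hw ⊢ <;> linarith

end GrowEdge

section GrowVertex

variable {α : ℝ} {m : ℕ} {t : DTree} {ℓ : Vertex → ℕ} {v : Vertex} {j : ℕ}

/-- Attaching a leaf to a branch point adds it to the subtree of this branch point, whose weight
grows by `1` for the degree and by `α - 1` for the edge; attaching it to `V 2` opens a new subtree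
of weight `α - 1`. -/
theorem Labelled.grow_vertex (h : Labelled α m t ℓ) (hv : v ∈ branchPoints t)
    (hj : v ≠ V 2 → ℓ v = j) (hj2 : v = V 2 → j = numTables (leafIndex ℓ) (m + 1)) :
    Labelled α (m + 1) (grow m t (Sum.inr v)) (relabel m ℓ j) := by
  have hv' := (h.mem_branchPoints.1 hv).1
  have hvy := h.ne_newLeaf hv'
  have hy2 : A (m + 1) ≠ V 2 := by simp
  have hle : j ≤ numTables (leafIndex ℓ) (m + 1) := by
    by_cases hv2 : v = V 2
    · exact (hj2 hv2).le
    · exact hj hv2 ▸ (h.label_lt hv' hv2).le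
  have hjK : j = numTables (leafIndex ℓ) (m + 1) ↔ v = V 2 := by
    refine ⟨fun e => ?_, hj2⟩
    by_contra hv2
    exact (h.label_lt hv' hv2).ne ((hj hv2).trans e)
  have hK := h.numTables_relabel hle
  have hmem : ∀ {w}, w ∈ vertices (grow m t (Sum.inr v)) ↔ w ∈ vertices t ∨ w = A (m + 1) :=
    mem_vertices_grow_vertex hv'
  have hnew : ∀ i, EdgeIn (relabel m ℓ j) i s(v, A (m + 1)) ↔ i = j := by
    intro i
    rw [edgeIn_mk, relabel_newLeaf, h.relabel_eq _ _ hv']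
    constructor
    · rintro (⟨h1, h2⟩ | ⟨-, h2⟩)
      exacts [h2.symm.trans (hj h1), h2.symm]
    · rintro rfl; exact Or.inr ⟨hy2, rfl⟩
  have hjoin : ∀ {u w}, Joined t u w → Joined (grow m t (Sum.inr v)) u w := fun huw =>
    Joined.mono_of_adj (fun _ _ huw hne hu hw =>
      joined_of_mem (by simp [grow, huw]) hne hu hw) huw
  -- an old vertex with the label of the new leaf is joined to it
  have hjnew : ∀ u ∈ vertices t, u ≠ V 2 → ℓ u = j →
      Joined (grow m t (Sum.inr v)) u (A (m + 1)) := by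
    intro u hu hu2 huj
    by_cases hv2 : v = V 2
    · exact absurd (huj.trans (hj2 hv2)) (h.label_lt hu hu2).ne
    · refine (hjoin (h.joined u hu v hv' hu2 hv2 (huj.trans (hj hv2).symm))).trans ?_
      exact joined_of_mem (by simp [grow]) hvy hv2 hy2
  refine ⟨h.toShape.grow_vertex hv, ?_, ?_, ?_, h.isRG_relabel hle,
    h.leafIndex_relabel_lt_three j, fun i => ?_, fun i => ?_⟩
  · intro u w huw hu hw
    have huw' : EdgeIn (relabel m ℓ j) (relabel m ℓ j u) s(u, w) := ⟨u, by simp, hu, rfl⟩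
    have huw'' : EdgeIn (relabel m ℓ j) (relabel m ℓ j w) s(u, w) := ⟨w, by simp, hw, rfl⟩
    simp only [grow, Finset.mem_insert] at huw
    rcases huw with huw | huw
    · rw [huw, hnew] at huw' huw''; exact huw'.trans huw''.symm
    · rw [h.relabel_eq _ _ (left_mem_vertices huw), h.relabel_eq _ _ (right_mem_vertices huw)]
      exact h.edge_label u w huw hu hw
  · intro u hu w hw hu2 hw2 huw
    rcases hmem.1 hu with hu | rfl <;> rcases hmem.1 hw with hw | rfl
    · rw [h.relabel_eq _ _ hu, h.relabel_eq _ _ hw] at huw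
      exact hjoin (h.joined u hu w hw hu2 hw2 huw)
    · rw [h.relabel_eq _ _ hu, relabel_newLeaf] at huw
      exact hjnew u hu hu2 huw
    · rw [h.relabel_eq _ _ hw, relabel_newLeaf] at huw
      exact (hjnew w hw hw2 huw.symm).symm
    · exact SimpleGraph.Reachable.refl _
  · intro u hu hu2
    rcases hmem.1 hu with hu | rfl
    · obtain ⟨k, hk, e⟩ := h.exists_leaf u hu hu2
      refine ⟨k, hk.trans m.le_succ, ?_⟩
      rw [leafIndex_relabel_of_lt m ℓ j k (Nat.lt_succ_of_le hk), e, h.relabel_eq _ _ hu]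
    · exact ⟨m + 1, le_rfl, rfl⟩
  · classical
    have hs := h.toShape.sum_grow_vertex v
      fun e => if V 2 ∈ e ∧ EdgeIn (relabel m ℓ j) i e then 1 else 0
    rw [h.toShape.sum_edgeIn_relabel ℓ i j (fun e p => if V 2 ∈ e ∧ p then 1 else 0),
      h.card_hub_edges i] at hs
    simp only [hnew i, Sym2.mem_iff, hy2.symm, or_false] at hs
    rw [hs, hK]
    by_cases hv2 : v = V 2
    · have := hj2 hv2
      simp only [hv2, true_and, this, if_true]
      split_ifs <;> omega
    · have : j ≠ numTables (leafIndex ℓ) (m + 1) := fun e => hv2 (hjK.1 e)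
      simp [Ne.symm hv2, this]
  · classical
    have hs := h.toShape.sum_grow_vertex v
      fun e => if EdgeIn (relabel m ℓ j) i e then α - 1 else 0
    rw [h.toShape.sum_edgeIn_relabel ℓ i j (fun _ p => if p then α - 1 else 0)] at hs
    simp only [hnew i] at hs
    have hw := h.weight_component i
    rw [weight_component_eq] at hw
    have hbp : ∑ w ∈ branchPoints t, (if w ≠ V 2 ∧ relabel m ℓ j w = i then
        (degree (grow m t (Sum.inr v)) w : ℝ) - 1 - α else 0) =
        ∑ w ∈ branchPoints t, (if w ≠ V 2 ∧ ℓ w = i then (degree t w : ℝ) - 1 - α else 0) +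
        if v ≠ V 2 ∧ ℓ v = i then 1 else 0 := by
      rw [← Finset.sum_ite_eq_of_mem' (branchPoints t) v
        (fun w => if w ≠ V 2 ∧ ℓ w = i then (1 : ℝ) else 0) hv, ← Finset.sum_add_distrib]
      refine Finset.sum_congr rfl fun w hw => ?_
      have hw := (h.mem_branchPoints.1 hw).1
      rw [h.relabel_eq _ _ hw, h.degree_grow_vertex v (h.ne_newLeaf hw)]
      split_ifs <;> push_cast <;> ring
    rw [weight_component_eq, h.branchPoints_grow_vertex hv, hbp, hs, hK, tableSize_relabel]
    by_cases hv2 : v = V 2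
    · have := hj2 hv2
      simp only [hv2, this, ne_eq, not_true_eq_false, false_and, if_false, if_true,
        @eq_comm _ _ i] at hw ⊢
      split_ifs at hw ⊢ <;> first | omega | (push_cast at hw ⊢; linarith)
    · have hne : j ≠ numTables (leafIndex ℓ) (m + 1) := fun e => hv2 (hjK.1 e)
      simp only [hv2, hne, hj hv2, ne_eq, not_false_eq_true, true_and, if_false, add_zero,
        @eq_comm _ i j] at hw ⊢
      split_ifs at hw ⊢ <;> push_cast at hw ⊢ <;> linarith

end GrowVertex

/-! ### The subtrees in terms of the labelling -/

/-- The tree with leaves `A 0`, `A 1`, `A 2` is labelled by the leaf labels. -/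
theorem labelled_initial (α : ℝ) :
    Labelled α 2 (grow 1 initialTree (Sum.inl s(A 0, A 1))) (Sum.elim id fun _ => 0) := by
  have ht : grow 1 initialTree (Sum.inl s(A 0, A 1)) =
      {s(V 2, A 2), s(A 0, V 2), s(A 1, V 2)} := by
    rw [grow_edge_eq]; rfl
  rw [ht]
  have hsum : ∀ {M : Type} [AddCommMonoid M] (F : Sym2 Vertex → M),
      ∑ e ∈ ({s(V 2, A 2), s(A 0, V 2), s(A 1, V 2)} : DTree), F e =
        F s(V 2, A 2) + (F s(A 0, V 2) + F s(A 1, V 2)) := by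
    intro M _ F
    rw [Finset.sum_insert (by decide), Finset.sum_insert (by decide), Finset.sum_singleton]
  have hmem : ∀ v, v ∈ vertices {s(V 2, A 2), s(A 0, V 2), s(A 1, V 2)} ↔
      v = A 0 ∨ v = A 1 ∨ v = A 2 ∨ v = V 2 := by
    intro v
    simp [mem_vertices]
    tauto
  have hdegV : degree {s(V 2, A 2), s(A 0, V 2), s(A 1, V 2)} (V 2) = 3 := by
    rw [degree_eq_sum, hsum]; simp
  have hs : Shape 2 {s(V 2, A 2), s(A 0, V 2), s(A 1, V 2)} := by
    refine ⟨le_rfl, fun k => ?_, fun k hk => ?_, fun e he => ?_, fun k => ?_, fun k hk => ?_, ?_⟩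
    · rw [hmem]; simp; omega
    · rw [hmem] at hk; simp at hk; omega
    · simp only [Finset.mem_insert, Finset.mem_singleton] at he
      rcases he with rfl | rfl | rfl <;> simp
    · rw [degree_eq_sum, hsum]
      simp
      split_ifs <;> omega
    · rw [hmem] at hk; simp at hk; subst hk; exact hdegV.ge
    · rw [hmem]; simp
  have hRG : ∀ k < 3, leafIndex (Sum.elim id fun _ => 0) k = k := fun k _ => rfl
  have hK : numTables (leafIndex (Sum.elim id fun _ => 0)) (2 + 1) = 3 := rfl
  have hbp : branchPoints {s(V 2, A 2), s(A 0, V 2), s(A 1, V 2)} = {V 2} := by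
    ext v
    rw [hs.mem_branchPoints, hmem, Finset.mem_singleton]
    constructor
    · rintro ⟨rfl | rfl | rfl | rfl, k, hk⟩ <;> simp_all
    · rintro rfl; exact ⟨by simp, 2, rfl⟩
  refine ⟨hs, fun v w hvw hv hw => ?_, fun v hv w hw hv2 hw2 hvw => ?_, fun v hv hv2 => ?_,
    fun k hk => ?_, fun i _ => rfl, fun i => ?_, fun i => ?_⟩
  · simp only [Finset.mem_insert, Finset.mem_singleton, Sym2.eq_iff] at hvw
    tauto
  · rw [hmem] at hv hw
    have : v = w := by
      rcases hv with rfl | rfl | rfl | rfl <;> rcases hw with rfl | rfl | rfl | rfl <;> simp_all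
    exact this ▸ SimpleGraph.Reachable.refl _
  · rw [hmem] at hv
    rcases hv with rfl | rfl | rfl | rfl
    exacts [⟨0, by simp, rfl⟩, ⟨1, by simp, rfl⟩, ⟨2, by simp, rfl⟩, absurd rfl hv2]
  · interval_cases k <;> decide
  · rw [hsum, hK]
    simp only [edgeIn_mk]
    simp
    split_ifs <;> omega
  · rw [weight_component_eq, hsum, hbp, Finset.sum_singleton, hK]
    simp only [edgeIn_mk]
    rcases lt_or_ge i 3 with hi | hi
    · have : tableSize (leafIndex (Sum.elim id fun _ => 0)) (2 + 1) i = 1 := by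
        interval_cases i <;> rfl
      rw [this]
      interval_cases i <;> simp
    · have : tableSize (leafIndex (Sum.elim id fun _ => 0)) (2 + 1) i = 0 := by
        rw [tableSize_eq_zero]
        intro k hk
        rw [hRG k hk]; omega
      rw [this]
      have h0 : ¬ 0 = i := by omega
      have h1 : ¬ 1 = i := by omega
      have h2 : ¬ 2 = i := by omega
      have h3 : ¬ i < 3 := by omega
      simp [h0, h1, h2, h3]

section

variable {α : ℝ} {m : ℕ} {t : DTree} {ℓ : Vertex → ℕ} (h : Labelled α m t ℓ)
include h

theorem Labelled.leaf_mem_vertices {k : ℕ} (hk : k ≤ m) : A k ∈ vertices t := (h.leaf_mem k).2 hk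

theorem Labelled.numTables_three : numTables (leafIndex ℓ) 3 = 3 := by
  rw [numTables_congr (c' := id) h.leafIndex_lt_three]; rfl

theorem Labelled.three_le_numTables : 3 ≤ numTables (leafIndex ℓ) (m + 1) := by
  have := h.two_le
  exact h.numTables_three.ge.trans (numTables_mono _ (by omega))

theorem Labelled.joined_leaf_iff {v : Vertex} (hv : v ∈ vertices t) {k : ℕ} (hk : k ≤ m) :
    Joined t v (A k) ↔ v ≠ V 2 ∧ ℓ v = leafIndex ℓ k :=
  h.joined_iff hv (h.leaf_mem_vertices hk) (by simp)

theorem Labelled.exists_joined_leaf_iff {e : Sym2 Vertex} (he : e ∈ t) {k : ℕ} (hk : k ≤ m) :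
    (∃ v ∈ e, Joined t v (A k)) ↔ EdgeIn ℓ (leafIndex ℓ k) e :=
  exists_congr fun _ => and_congr_right fun hv =>
    h.joined_leaf_iff (mem_vertices.2 ⟨e, he, hv⟩) hk

theorem Labelled.subtreeAt_eq {k : ℕ} (hk : k ≤ m) :
    subtreeAt t (A k) = component t ℓ (leafIndex ℓ k) := by
  classical
  rw [subtreeAt, component]
  congr 1
  · exact Finset.filter_congr fun e he => h.exists_joined_leaf_iff he hk
  · exact Finset.filter_congr fun v hv =>
      h.joined_leaf_iff (h.mem_branchPoints.1 hv).1 hk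

theorem Labelled.card_leafLabelsAt {k : ℕ} (hk : k ≤ m) :
    (leafLabelsAt t (A k)).card = tableSize (leafIndex ℓ) (m + 1) (leafIndex ℓ k) := by
  rw [leafLabelsAt, tableSize]
  congr 1
  ext i
  simp only [Finset.mem_filter, Finset.mem_toLeft, Finset.mem_range, Nat.lt_succ_iff]
  rw [show (Sum.inl i : Vertex) = A i from rfl, h.leaf_mem]
  refine and_congr_right fun hi => ?_
  rw [h.joined_leaf_iff (h.leaf_mem_vertices hi) hk]
  exact and_iff_right (by simp)

open Classical in
/-- Each subtree has exactly one edge at `V 2`. -/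
theorem Labelled.card_hub_edges_Ico (a : ℕ) :
    (t.filter (fun e => V 2 ∈ e ∧ ∃ i, a ≤ i ∧ EdgeIn ℓ i e)).card =
      numTables (leafIndex ℓ) (m + 1) - a := by
  have : t.filter (fun e => V 2 ∈ e ∧ ∃ i, a ≤ i ∧ EdgeIn ℓ i e) =
      (Finset.Ico a (numTables (leafIndex ℓ) (m + 1))).biUnion
        fun i => t.filter (fun e => V 2 ∈ e ∧ EdgeIn ℓ i e) := by
    ext e
    simp only [Finset.mem_filter, Finset.mem_biUnion, Finset.mem_Ico]
    constructor
    · rintro ⟨he, he2, i, hi, hei⟩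
      exact ⟨i, ⟨hi, h.edgeIn_lt he hei⟩, he, he2, hei⟩
    · rintro ⟨i, ⟨hi, -⟩, he, he2, hei⟩
      exact ⟨he, he2, i, hi, hei⟩
  rw [this, Finset.card_biUnion, ← Nat.card_Ico, Finset.card_eq_sum_ones]
  · refine Finset.sum_congr rfl fun i hi => ?_
    rw [Finset.card_filter, h.card_hub_edges, if_pos (Finset.mem_Ico.1 hi).2]
  · intro i _ j _ hij
    refine Finset.disjoint_left.2 ?_
    intro e he he'
    simp only [Finset.mem_filter] at he he'
    exact hij ((h.edgeIn_iff he.1 he'.2.2).1 he.2.2)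

theorem Labelled.degree_hub : degree t (V 2) = numTables (leafIndex ℓ) (m + 1) := by
  classical
  have := h.card_hub_edges_Ico 0
  rw [Nat.sub_zero] at this
  rw [← this, degree]
  congr 1
  refine Finset.filter_congr fun e he => ?_
  simp [h.exists_edgeIn he]

theorem Labelled.mem_extraEdges {e : Sym2 Vertex} :
    e ∈ extraEdges t ↔ e ∈ t ∧ V 2 ∈ e ∧ ∃ i, 3 ≤ i ∧ EdgeIn ℓ i e := by
  classical
  have h2 := h.two_le
  rw [extraEdges, Finset.mem_filter]
  refine and_congr_right fun he => and_congr_right fun _ => ?_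
  obtain ⟨j, hj⟩ := h.exists_edgeIn he
  have hi : ∀ i, EdgeIn ℓ i e ↔ i = j := fun i => h.edgeIn_iff he hj
  have h3 : ∀ i < 3, (∃ v ∈ e, Joined t v (A i)) ↔ i = j := fun i hi3 => by
    rw [h.exists_joined_leaf_iff he (by omega), h.leafIndex_lt_three i hi3, hi]
  simp only [hi, exists_eq_right]
  constructor
  · intro hn
    by_contra! hj3
    obtain ⟨v, hv, hvj⟩ := (h3 j hj3).2 rfl
    exact hn v hv j hj3 hvj
  · intro hj3 v hv i hi3 hvi
    have := (h3 i hi3).1 ⟨v, hv, hvi⟩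
    omega

theorem Labelled.numExtra_eq : numExtra t = numTables (leafIndex ℓ) (m + 1) - 3 := by
  classical
  rw [numExtra, ← h.card_hub_edges_Ico 3]
  congr 1
  ext e
  rw [h.mem_extraEdges, Finset.mem_filter]

theorem Labelled.numExtra_add_three : numExtra t + 3 = numTables (leafIndex ℓ) (m + 1) := by
  have := h.three_le_numTables
  rw [h.numExtra_eq]
  omega

/-- The least leaf label of the subtree with index `i` is the time of the first visit to `i`. -/
theorem Labelled.leastLabel_eq_iff {e : Sym2 Vertex} (he : e ∈ t) {i : ℕ} (hi : EdgeIn ℓ i e)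
    {k : ℕ} : leastLabel t e = k ↔
      k ≤ m ∧ leafIndex ℓ k = i ∧ leafIndex ℓ k = numTables (leafIndex ℓ) k := by
  have hset : {k | A k ∈ vertices t ∧ ∃ v ∈ e, Joined t v (A k)} =
      {k | k ≤ m ∧ leafIndex ℓ k = i} := by
    ext k
    simp only [Set.mem_ofPred_eq, h.leaf_mem]
    refine and_congr_right fun hk => ?_
    rw [h.exists_joined_leaf_iff he hk, h.edgeIn_iff he hi]
  rw [leastLabel, hset]
  have hne : {k | k ≤ m ∧ leafIndex ℓ k = i}.Nonempty := by
    obtain ⟨k, hk, e⟩ := h.isRG.exists_eq (h.edgeIn_lt he hi)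
    exact ⟨k, Nat.lt_succ_iff.1 hk, e⟩
  constructor
  · rintro rfl
    obtain ⟨h1, h2⟩ := Nat.sInf_mem hne
    refine ⟨h1, h2, ?_⟩
    refine (h.isRG _ (Nat.lt_succ_of_le h1)).antisymm (not_lt.1 fun hlt => ?_)
    obtain ⟨k, hk, hk'⟩ := (h.isRG.mono (h1.trans m.le_succ)).exists_eq hlt
    exact Nat.notMem_of_lt_sInf hk ⟨hk.le.trans h1, hk'.trans h2⟩
  · rintro ⟨h1, h2, h3⟩
    refine le_antisymm (Nat.sInf_le ⟨h1, h2⟩) (not_lt.1 fun hlt => ?_)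
    obtain ⟨-, h4⟩ := Nat.sInf_mem hne
    have := (h.isRG.mono (h1.trans m.le_succ)).lt_numTables hlt
    omega

theorem Labelled.exists_leastLabel_iff {k : ℕ} :
    (∃ e ∈ extraEdges t, leastLabel t e = k) ↔
      3 ≤ k ∧ k ≤ m ∧ leafIndex ℓ k = numTables (leafIndex ℓ) k := by
  classical
  constructor
  · rintro ⟨e, he, hk⟩
    obtain ⟨he, -, i, hi, hei⟩ := h.mem_extraEdges.1 he
    obtain ⟨h1, h2, h3⟩ := (h.leastLabel_eq_iff he hei).1 hk
    refine ⟨?_, h1, h3⟩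
    by_contra! hk3
    have := h.leafIndex_lt_three k hk3
    omega
  · rintro ⟨h1, h2, h3⟩
    have hcard := h.card_hub_edges (leafIndex ℓ k)
    rw [if_pos (h.isRG.lt_numTables (Nat.lt_succ_of_le h2)), ← Finset.card_filter] at hcard
    obtain ⟨e, he⟩ := Finset.card_pos.1 (hcard ▸ Nat.one_pos)
    obtain ⟨he, he2, hei⟩ := Finset.mem_filter.1 he
    refine ⟨e, h.mem_extraEdges.2 ⟨he, he2, _, ?_, hei⟩,
      (h.leastLabel_eq_iff he hei).2 ⟨h2, rfl, h3⟩⟩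
    rw [h3, ← h.numTables_three]
    exact numTables_mono _ h1

open Classical in
/-- The extra subtrees whose least label is below `3 + k` are those already opened by the leaves
below `3 + k`. -/
theorem Labelled.count_leastLabel {k : ℕ} (hk : 3 + k ≤ m + 1) :
    Nat.count (fun k => ∃ e ∈ extraEdges t, leastLabel t e = k) (3 + k) + 3 =
      numTables (leafIndex ℓ) (3 + k) := by
  induction k with
  | zero =>
    rw [h.numTables_three]
    simp [Nat.count_succ, h.exists_leastLabel_iff]
  | succ k ih =>
    have ih := ih (by omega)
    rw [← add_assoc] at hk ⊢
    rw [Nat.count_succ, (h.isRG.mono hk).numTables_succ]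
    have h1 : 3 ≤ 3 + k := by omega
    have h2 : 3 + k ≤ m := by omega
    simp only [h.exists_leastLabel_iff, h1, h2, true_and] at ih ⊢
    split_ifs <;> omega

/-- The `i`-th subtree contains the leaf that carries the label of this subtree. -/
theorem Labelled.exists_subtreeLabel {i : ℕ} (hi : i < numExtra t + 3) :
    ∃ k ≤ m, subtreeLabel t i = k ∧ leafIndex ℓ k = i := by
  classical
  have h2 := h.two_le
  by_cases hi3 : i < 3
  · exact ⟨i, by omega, by rw [subtreeLabel, if_pos hi3], h.leafIndex_lt_three i hi3⟩
  rw [h.numExtra_add_three] at hi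
  -- the subtree with index `i` starts at the first visit to `i`
  have hex : ∃ k, k ≤ m ∧ leafIndex ℓ k = i := by
    obtain ⟨k, hk, e⟩ := h.isRG.exists_eq hi
    exact ⟨k, Nat.lt_succ_iff.1 hk, e⟩
  have hk := Nat.find_spec hex
  have hmin := fun l => Nat.find_min (H := hex) (m := l)
  set k := Nat.find hex
  have hk3 : 3 ≤ k := by
    by_contra! hk3
    have := h.leafIndex_lt_three k hk3
    omega
  have hnew : leafIndex ℓ k = numTables (leafIndex ℓ) k := by
    refine (h.isRG _ (Nat.lt_succ_of_le hk.1)).antisymm (not_lt.1 fun hlt => ?_)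
    obtain ⟨l, hl, hl'⟩ := (h.isRG.mono (hk.1.trans m.le_succ)).exists_eq hlt
    exact hmin l hl ⟨hl.le.trans hk.1, hl'.trans hk.2⟩
  have hp : ∃ e ∈ extraEdges t, leastLabel t e = k :=
    h.exists_leastLabel_iff.2 ⟨hk3, hk.1, hnew⟩
  refine ⟨k, hk.1, ?_, hk.2⟩
  have hc := h.count_leastLabel (k := k - 3) (by omega)
  rw [Nat.add_sub_cancel' hk3, ← hnew, hk.2] at hc
  have hn := Nat.nth_count (p := fun k => ∃ e ∈ extraEdges t, leastLabel t e = k) hp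
  rw [subtreeLabel, if_neg hi3]
  rwa [show Nat.count (fun k => ∃ e ∈ extraEdges t, leastLabel t e = k) k = i - 3 by omega] at hn

theorem Labelled.subtree_eq {i : ℕ} (hi : i < numExtra t + 3) :
    subtree t i = component t ℓ i := by
  obtain ⟨k, hk, e, hki⟩ := h.exists_subtreeLabel hi
  rw [subtree, if_pos hi, e, h.subtreeAt_eq hk, hki]

theorem Labelled.leafCount_eq {i : ℕ} (hi : i < numExtra t + 3) :
    leafCount t i = tableSize (leafIndex ℓ) (m + 1) i := by
  obtain ⟨k, hk, e, hki⟩ := h.exists_subtreeLabel hi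
  rw [leafCount, if_pos hi, e, h.card_leafLabelsAt hk, hki]

theorem Labelled.weight_subtree {i : ℕ} (hi : i < numExtra t + 3) :
    weight α t (subtree t i) = α * tableSize (leafIndex ℓ) (m + 1) i - 1 := by
  rw [h.subtree_eq hi, h.weight_component, if_pos (h.numExtra_add_three ▸ hi)]

theorem Labelled.weight_hub :
    weight α t {Sum.inr (V 2)} = numTables (leafIndex ℓ) (m + 1) - 1 - α := by
  rw [weight, Finset.sum_singleton, siteWeight, h.degree_hub]

theorem Labelled.disjoint_component {i j : ℕ} (hij : i ≠ j) :
    Disjoint (component t ℓ i) (component t ℓ j) := by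
  rw [Finset.disjoint_left]
  rintro (e | v) hi hj
  · simp only [component, Finset.inl_mem_disjSum, Finset.mem_filter] at hi hj
    exact hij ((h.edgeIn_iff hi.1 hj.2).1 hi.2)
  · simp only [component, Finset.inr_mem_disjSum, Finset.mem_filter] at hi hj
    exact hij (hi.2.2.symm.trans hj.2.2)

theorem Labelled.weight_extraPart :
    weight α t (extraPart t) = ∑ j ∈ Finset.range (numExtra t),
      (α * tableSize (leafIndex ℓ) (m + 1) (j + 3) - 1) := by
  rw [weight, extraPart, Finset.sum_biUnion]
  · refine Finset.sum_congr rfl fun j hj => h.weight_subtree ?_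
    have := Finset.mem_range.1 hj
    omega
  · intro i hi j hj hij
    have hi := Finset.mem_range.1 hi
    have hj := Finset.mem_range.1 hj
    simp only [Function.onFun]
    rw [h.subtree_eq (by omega), h.subtree_eq (by omega)]
    exact h.disjoint_component (by omega)

theorem Labelled.extraLeafCount_eq :
    extraLeafCount t = ∑ j ∈ Finset.range (numExtra t),
      tableSize (leafIndex ℓ) (m + 1) (j + 3) := by
  refine Finset.sum_congr rfl fun j hj => h.leafCount_eq ?_
  have := Finset.mem_range.1 hj
  omega

theorem Labelled.sum_tableSize_range :
    tableSize (leafIndex ℓ) (m + 1) 0 + tableSize (leafIndex ℓ) (m + 1) 1 +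
      tableSize (leafIndex ℓ) (m + 1) 2 + extraLeafCount t = m + 1 := by
  have := h.isRG.sum_tableSize h.numExtra_add_three.ge
  simp only [Finset.sum_range_succ', Nat.add_assoc] at this
  rw [h.extraLeafCount_eq]
  simp only [Nat.reduceAdd] at this
  omega

theorem Labelled.remainingWeight_eq :
    remainingWeight α t = α * extraLeafCount t + 2 - α := by
  rw [remainingWeight, h.weight_hub, h.weight_extraPart, h.extraLeafCount_eq,
    Finset.sum_sub_distrib, ← Finset.mul_sum, ← h.numExtra_add_three]
  push_cast
  simp
  ring

theorem Labelled.mem_sites {c : Site} : c ∈ sites t ↔ c = Sum.inr (V 2) ∨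
    ∃ i < numTables (leafIndex ℓ) (m + 1), c ∈ component t ℓ i := by
  rcases c with e | v
  · simp only [sites, component, Finset.inl_mem_disjSum, Finset.mem_filter, reduceCtorEq,
      false_or]
    constructor
    · intro he
      obtain ⟨i, hi⟩ := h.exists_edgeIn he
      exact ⟨i, h.edgeIn_lt he hi, he, hi⟩
    · rintro ⟨i, -, he, -⟩; exact he
  · simp only [sites, component, Finset.inr_mem_disjSum, Finset.mem_filter, Sum.inr.injEq]
    constructor
    · intro hv
      by_cases hv2 : v = V 2
      · exact Or.inl hv2
      · exact Or.inr ⟨ℓ v, h.label_lt (h.mem_branchPoints.1 hv).1 hv2, hv, hv2, rfl⟩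
    · rintro (rfl | ⟨i, -, hv, -⟩)
      exacts [h.hub_mem_branchPoints, hv]

/-- The total weight after `m` leaves is `α m - 1`, whatever the shape of the tree. -/
theorem Labelled.weight_sites : weight α t (sites t) = α * m - 1 := by
  classical
  have hs : sites t = insert (Sum.inr (V 2))
      ((Finset.range (numTables (leafIndex ℓ) (m + 1))).biUnion (component t ℓ)) := by
    ext c
    simp [h.mem_sites]
  have hnot : (Sum.inr (V 2) : Site) ∉
      (Finset.range (numTables (leafIndex ℓ) (m + 1))).biUnion (component t ℓ) := by
    simp [component]
  have h1 := h.weight_hub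
  rw [weight, Finset.sum_singleton] at h1
  rw [weight, hs, Finset.sum_insert hnot, h1, Finset.sum_biUnion fun i _ j _ hij =>
    h.disjoint_component hij]
  have h2 : ∀ i ∈ Finset.range (numTables (leafIndex ℓ) (m + 1)),
      ∑ c ∈ component t ℓ i, siteWeight α t c = α * tableSize (leafIndex ℓ) (m + 1) i - 1 :=
    fun i hi => by
      have := h.weight_component i
      rwa [if_pos (Finset.mem_range.1 hi), weight] at this
  rw [Finset.sum_congr rfl h2, Finset.sum_sub_distrib, ← Finset.mul_sum, ← Nat.cast_sum,
    h.isRG.sum_tableSize le_rfl]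
  push_cast
  simp
  ring

omit h in
theorem siteWeight_nonneg (hα₁ : 1 < α) (hα₂ : α ≤ 2) {c : Site} (hc : c ∈ sites t) :
    0 ≤ siteWeight α t c := by
  rcases c with e | v
  · simp only [siteWeight]; linarith
  · simp only [sites, Finset.inr_mem_disjSum, branchPoints, Finset.mem_filter] at hc
    have : (3 : ℝ) ≤ degree t v := by exact_mod_cast hc.2
    simp only [siteWeight]; linarith

/-- The indices of the subtrees containing the leaves are determined by the tree. -/
theorem Labelled.leafIndex_unique {α' : ℝ} {m' : ℕ} {ℓ' : Vertex → ℕ} (h' : Labelled α' m' t ℓ') :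
    ∀ k ≤ m, leafIndex ℓ' k = leafIndex ℓ k := by
  have hm : m = m' := le_antisymm ((h'.leaf_mem m).1 ((h.leaf_mem m).2 le_rfl))
    ((h.leaf_mem m').1 ((h'.leaf_mem m').2 le_rfl))
  subst hm
  intro k
  induction k using Nat.strong_induction_on with
  | _ k ih =>
    intro hk
    have hn : numTables (leafIndex ℓ') k = numTables (leafIndex ℓ) k :=
      numTables_congr fun i hi => ih i hi (hi.le.trans hk)
    have hlt : ∀ {α α' : ℝ} {ℓ ℓ' : Vertex → ℕ}, Labelled α m t ℓ → Labelled α' m t ℓ' →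
        (∀ i < k, leafIndex ℓ' i = leafIndex ℓ i) → leafIndex ℓ k < numTables (leafIndex ℓ) k →
        leafIndex ℓ' k = leafIndex ℓ k := by
      intro α α' ℓ ℓ' h h' ih hlt
      obtain ⟨i, hi, e⟩ := (h.isRG.mono (hk.trans m.le_succ)).exists_eq hlt
      have hj := (h.joined_leaf_iff (h.leaf_mem_vertices hk) (hi.le.trans hk)).2 ⟨by simp, e.symm⟩
      have hj' := ((h'.joined_leaf_iff (h'.leaf_mem_vertices hk) (hi.le.trans hk)).1 hj).2
      rw [← e, ← ih i hi]
      exact hj'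
    rcases (h.isRG k (Nat.lt_succ_of_le hk)).lt_or_eq with h1 | h1
    · exact hlt h h' (fun i hi => ih i hi (hi.le.trans hk)) h1
    rcases (h'.isRG k (Nat.lt_succ_of_le hk)).lt_or_eq with h2 | h2
    · exact (hlt h' h (fun i hi => (ih i hi (hi.le.trans hk)).symm) h2).symm
    · rw [h1, h2, hn]

end

/-! ### Conditioning on the past of a sequence with countably many values -/

section Past

variable {Ω : Type*} [MeasurableSpace Ω] {P : Measure Ω} {S : Type*} [Countable S]

/-- A property that holds almost surely given each possible past holds almost surely, as there are
countably many pasts. -/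
theorem ae_of_forall_past [Nonempty S] (Z : ℕ → Ω → S) (n : ℕ) {p : Ω → Prop}
    (h : ∀ z : ℕ → S, ∀ᵐ ω ∂P, (∀ k < n, Z k ω = z k) → p ω) : ∀ᵐ ω ∂P, p ω := by
  have s0 := Classical.arbitrary S
  have key : ∀ᵐ ω ∂P, ∀ v : Fin n → S,
      (∀ k < n, Z k ω = if hk : k < n then v ⟨k, hk⟩ else s0) → p ω :=
    ae_all_iff.2 fun v => h fun k => if hk : k < n then v ⟨k, hk⟩ else s0
  filter_upwards [key] with ω hω
  exact hω (fun k => Z k ω) fun k hk => by simp [hk]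

/-- If an event has the same conditional probability `r` given each past inside `B`, then it has
conditional probability `r` given `B`. -/
theorem measure_inter_of_forall_past [Nonempty S] {Z : ℕ → Ω → S}
    {n : ℕ} (hZ : ∀ k < n, ∀ s, MeasurableSet {ω | Z k ω = s}) {A B : Set Ω} (hB : MeasurableSet B)
    (hA : MeasurableSet A) (r : ENNReal)
    (h : ∀ z : ℕ → S, P ({ω | ∀ k < n, Z k ω = z k} ∩ (B ∩ A)) =
      P ({ω | ∀ k < n, Z k ω = z k} ∩ B) * r) :
    P (B ∩ A) = P B * r := by
  have s0 := Classical.arbitrary S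
  let ext : (Fin n → S) → ℕ → S := fun v k => if hk : k < n then v ⟨k, hk⟩ else s0
  let H : (Fin n → S) → Set Ω := fun v => {ω | ∀ k < n, Z k ω = ext v k}
  have hH : ∀ v, MeasurableSet (H v) := fun v => by
    have : H v = ⋂ k, ⋂ (_ : k < n), {ω | Z k ω = ext v k} := by ext; simp [H]
    rw [this]
    exact MeasurableSet.iInter fun k => MeasurableSet.iInter fun hk => hZ k hk _
  have hdisj : Pairwise (Function.onFun Disjoint H) := by
    intro v w hvw
    refine Set.disjoint_left.2 fun ω hv hw => hvw (funext fun k => ?_)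
    have := (hv k k.2).symm.trans (hw k k.2)
    simpa [ext] using this
  have hcover : ∀ D : Set Ω, D = ⋃ v, H v ∩ D := by
    intro D
    rw [← Set.iUnion_inter, Set.right_eq_inter]
    intro ω _
    exact Set.mem_iUnion.2 ⟨fun k => Z k ω, fun k hk => by simp [ext, hk]⟩
  have hsum : ∀ D : Set Ω, MeasurableSet D → P D = ∑' v, P (H v ∩ D) := by
    intro D hD
    conv_lhs => rw [hcover D]
    exact measure_iUnion (fun v w hvw => (hdisj hvw).mono Set.inter_subset_left
      Set.inter_subset_left) fun v => (hH v).inter hD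
  rw [hsum _ (hB.inter hA), hsum _ hB, ← ENNReal.tsum_mul_right]
  exact tsum_congr fun v => h (ext v)

end Past

/-- An event that depends on finitely many terms of a sequence with countably many values is
measurable. -/
theorem measurableSet_of_past {Ω S : Type*} [MeasurableSpace Ω] [Countable S] [Nonempty S]
    {Z : ℕ → Ω → S} {n : ℕ} (hZ : ∀ k < n, ∀ s, MeasurableSet {ω | Z k ω = s})
    {p : (ℕ → S) → Prop} (hp : ∀ c c' : ℕ → S, (∀ k < n, c k = c' k) → (p c ↔ p c')) :
    MeasurableSet {ω | p fun k => Z k ω} := by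
  have s0 := Classical.arbitrary S
  let ext : (Fin n → S) → ℕ → S := fun v k => if hk : k < n then v ⟨k, hk⟩ else s0
  have : {ω | p fun k => Z k ω} =
      ⋃ v ∈ {v | p (ext v)}, ⋂ k, ⋂ (_ : k < n), {ω | Z k ω = ext v k} := by
    ext ω
    simp only [Set.mem_ofPred_eq, Set.mem_iUnion, Set.mem_iInter, exists_prop]
    constructor
    · intro h
      exact ⟨fun k => Z k ω, (hp _ _ fun k hk => by simp [ext, hk]).1 h,
        fun k hk => by simp [ext, hk]⟩
    · rintro ⟨v, hv, hω⟩
      exact (hp _ _ hω).2 hv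
  rw [this]
  exact MeasurableSet.biUnion (Set.to_countable _) fun v _ =>
    MeasurableSet.iInter fun k => MeasurableSet.iInter fun hk => hZ k hk _

theorem setOf_forall_lt_succ {Ω S : Type*} (X : ℕ → Ω → S) (x : ℕ → S) (n : ℕ) :
    {ω | ∀ k < n + 1, X k ω = x k} = {ω | (∀ k < n, X k ω = x k) ∧ X n ω = x n} := by
  ext ω
  simp only [Set.mem_ofPred_eq, Nat.lt_succ_iff_lt_or_eq]
  exact ⟨fun h => ⟨fun k hk => h k (Or.inl hk), h n (Or.inr rfl)⟩, fun h k hk =>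
    hk.elim (h.1 k) (by rintro rfl; exact h.2)⟩

/-! ### The subtree indices of the successive leaves -/

/-- The index of the subtree of `t` that contains the leaf `A k` (`0` if `t` does not arise from
Marchal's algorithm). -/
noncomputable def indexOf (t : DTree) (k : ℕ) : ℕ :=
  open Classical in
  if h : ∃ ℓ : Vertex → ℕ, ∃ (α : ℝ) (m : ℕ), k ≤ m ∧ Labelled α m t ℓ then leafIndex h.choose k
  else 0

theorem Labelled.indexOf_eq {α : ℝ} {m : ℕ} {t : DTree} {ℓ : Vertex → ℕ} (h : Labelled α m t ℓ)
    {k : ℕ} (hk : k ≤ m) : indexOf t k = leafIndex ℓ k := by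
  have hex : ∃ ℓ : Vertex → ℕ, ∃ (α : ℝ) (m : ℕ), k ≤ m ∧ Labelled α m t ℓ := ⟨ℓ, α, m, hk, h⟩
  rw [indexOf, dif_pos hex]
  obtain ⟨α', m', -, h'⟩ := hex.choose_spec
  exact h.leafIndex_unique h' k hk

/-- The sites at which the tree grows when the next leaf joins the subtree with index `j`; the index
that is not yet in use belongs to `V 2`. -/
noncomputable def growthSites (t : DTree) (ℓ : Vertex → ℕ) (m j : ℕ) : Finset Site :=
  if j = numTables (leafIndex ℓ) (m + 1) then {Sum.inr (V 2)} else component t ℓ j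

section

variable {α : ℝ} {m : ℕ} {t : DTree} {ℓ : Vertex → ℕ}

theorem Labelled.growthSites_subset (h : Labelled α m t ℓ) (j : ℕ) :
    growthSites t ℓ m j ⊆ sites t := by
  intro c hc
  rw [growthSites] at hc
  split_ifs at hc with hj
  · exact h.mem_sites.2 (Or.inl (Finset.mem_singleton.1 hc))
  · rcases c with e | v
    · simp only [component, Finset.inl_mem_disjSum, Finset.mem_filter] at hc
      simpa [sites] using hc.1
    · simp only [component, Finset.inr_mem_disjSum, Finset.mem_filter] at hc
      simpa [sites] using hc.1

theorem Labelled.exists_growthSites (h : Labelled α m t ℓ) {c : Site} (hc : c ∈ sites t) :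
    ∃ j, c ∈ growthSites t ℓ m j := by
  rcases h.mem_sites.1 hc with rfl | ⟨i, hi, hci⟩
  · exact ⟨_, by rw [growthSites, if_pos rfl]; simp⟩
  · exact ⟨i, by rwa [growthSites, if_neg hi.ne]⟩

/-- Growing at a site of the subtree with index `j` labels the new leaf by `j`. -/
theorem Labelled.grow (h : Labelled α m t ℓ) {c : Site} {j : ℕ} (hc : c ∈ growthSites t ℓ m j) :
    Labelled α (m + 1) (grow m t c) (relabel m ℓ j) := by
  rw [growthSites] at hc
  split_ifs at hc with hj
  · rw [Finset.mem_singleton.1 hc]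
    exact h.grow_vertex h.hub_mem_branchPoints (fun hne => absurd rfl hne) fun _ => hj
  · rcases c with e | v
    · simp only [component, Finset.inl_mem_disjSum, Finset.mem_filter] at hc
      induction e using Sym2.ind with
      | _ a b => exact h.grow_edge hc.1 hc.2
    · simp only [component, Finset.inr_mem_disjSum, Finset.mem_filter] at hc
      exact h.grow_vertex hc.1 (fun _ => hc.2.2) fun hv => absurd hv hc.2.1

/-- The next leaf joins the subtrees according to the seating plan of `CRP(1/α, -(1 + 1/α))`. -/
theorem Labelled.weight_growthSites (hα : 1 < α) (h : Labelled α m t ℓ) (j : ℕ) :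
    weight α t (growthSites t ℓ m j) / weight α t (sites t) =
      crpProb (1 / α) (-(1 + 1 / α)) (leafIndex ℓ) (m + 1) j := by
  have hα0 : α ≠ 0 := by linarith
  have h2 : (2 : ℝ) ≤ m := by exact_mod_cast h.two_le
  have hpos : α * m - 1 ≠ 0 := by nlinarith
  have hden : ((m + 1 : ℕ) : ℝ) + -(1 + 1 / α) = (α * m - 1) / α := by
    push_cast; field_simp; ring
  rw [h.weight_sites, crpProb, growthSites, hden]
  rcases lt_trichotomy j (numTables (leafIndex ℓ) (m + 1)) with hj | hj | hj
  · rw [if_neg hj.ne, if_pos hj, h.weight_component, if_pos hj]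
    field_simp
  · rw [if_pos hj, if_neg hj.not_lt, if_pos hj, h.weight_hub]
    field_simp
    ring
  · rw [if_neg hj.ne', if_neg hj.not_gt, if_neg hj.ne', h.weight_component, if_neg hj.not_gt,
      h.isRG.tableSize_eq_zero hj.le]
    simp

/-- Different sites give different trees, so that the events of growing at different sites are
disjoint. -/
theorem Shape.grow_injOn (h : Shape m t) : Set.InjOn (grow m t) (sites t) := by
  have hx : ∀ e ∈ t, V (m + 1) ∉ e := fun e he hv =>
    h.newBranch_notMem (mem_vertices.2 ⟨e, he, hv⟩)
  have hy : ∀ e ∈ t, A (m + 1) ∉ e := fun e he hv =>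
    h.newLeaf_notMem (mem_vertices.2 ⟨e, he, hv⟩)
  have hev : ∀ e ∈ t, ∀ v ∈ branchPoints t,
      MarchalTree.grow m t (Sum.inl e) ≠ MarchalTree.grow m t (Sum.inr v) := by
    intro e he v hv heq
    have h1 : V (m + 1) ∈ vertices (MarchalTree.grow m t (Sum.inl e)) := by
      induction e using Sym2.ind with
      | _ a b => exact (mem_vertices_grow_edge he).2 (Or.inr (Or.inl rfl))
    rw [heq, mem_vertices_grow_vertex (h.mem_branchPoints.1 hv).1] at h1
    rcases h1 with h1 | h1
    · exact h.newBranch_notMem h1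
    · simp at h1
  rintro (e | v) hc (e' | v') hc' heq
  · simp only [sites, Finset.mem_coe, Finset.inl_mem_disjSum] at hc hc'
    by_contra hne
    have hne : e ≠ e' := fun h => hne (h ▸ rfl)
    have h1 : e ∈ MarchalTree.grow m t (Sum.inl e') := by
      simp [MarchalTree.grow, hne, hc]
    rw [← heq] at h1
    induction e using Sym2.ind with
    | _ a b =>
      rw [grow_edge_eq] at h1
      simp only [Finset.mem_insert, Finset.mem_erase, ne_eq, not_true_eq_false, false_and,
        or_false] at h1
      have := hx _ hc
      rcases h1 with h1 | h1 | h1 <;> rw [h1] at this <;> simp at this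
  · simp only [sites, Finset.mem_coe, Finset.inl_mem_disjSum, Finset.inr_mem_disjSum] at hc hc'
    exact absurd heq (hev e hc v' hc')
  · simp only [sites, Finset.mem_coe, Finset.inl_mem_disjSum, Finset.inr_mem_disjSum] at hc hc'
    exact absurd heq.symm (hev e' hc' v hc)
  · simp only [sites, Finset.mem_coe, Finset.inr_mem_disjSum] at hc hc'
    have hvy := h.ne_newLeaf (h.mem_branchPoints.1 hc).1
    have h1 : s(v, A (m + 1)) ∈ MarchalTree.grow m t (Sum.inr v') := by
      rw [← heq]; simp [MarchalTree.grow]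
    simp only [MarchalTree.grow, Finset.mem_insert] at h1
    rcases h1 with h1 | h1
    · rw [Sym2.eq_iff] at h1
      rcases h1 with h1 | h1
      · rw [h1.1]
      · exact absurd h1.1 hvy
    · exact absurd (Sym2.mem_mk_right _ _) (hy _ h1)

end

/-- The index of the subtree that contains the leaf `A k`, read from the tree at time `k`. -/
noncomputable def leafProcess {Ω : Type*} (T : ℕ → Ω → DTree) (k : ℕ) (ω : Ω) : ℕ :=
  if k < 3 then k else indexOf (T k ω) k

section Marchal

variable {Ω : Type*} [MeasurableSpace Ω] {P : Measure Ω} [IsProbabilityMeasure P] {α : ℝ}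
  {T : ℕ → Ω → DTree}

omit [IsProbabilityMeasure P] in
theorem IsMarchal.measurableSet_past (hT : IsMarchal P α T) (m : ℕ) (h : ℕ → DTree) :
    MeasurableSet {ω | ∀ k, 1 ≤ k → k ≤ m → T k ω = h k} := by
  simp only [Set.ofPred_forall]
  exact MeasurableSet.iInter fun k => MeasurableSet.iInter fun hk =>
    MeasurableSet.iInter fun _ => hT.measurable k hk _

omit [IsProbabilityMeasure P] in
/-- Given the past, the growth site lies in `S` with probability proportional to the weight
of `S`. -/
theorem IsMarchal.measure_grow (hT : IsMarchal P α T) (hα₁ : 1 < α) (hα₂ : α ≤ 2) {m : ℕ}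
    (hm : 1 ≤ m) (h : ℕ → DTree) (hinj : Set.InjOn (grow m (h m)) (sites (h m)))
    (hw : 0 ≤ weight α (h m) (sites (h m)))
    {S : Finset Site} (hS : S ⊆ sites (h m)) :
    P {ω | (∀ k, 1 ≤ k → k ≤ m → T k ω = h k) ∧ ∃ c ∈ S, T (m + 1) ω = grow m (h m) c} =
      P {ω | ∀ k, 1 ≤ k → k ≤ m → T k ω = h k} *
        ENNReal.ofReal (weight α (h m) S / weight α (h m) (sites (h m))) := by
  have hset : {ω | (∀ k, 1 ≤ k → k ≤ m → T k ω = h k) ∧ ∃ c ∈ S, T (m + 1) ω = grow m (h m) c} =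
      ⋃ c ∈ S, {ω | (∀ k, 1 ≤ k → k ≤ m → T k ω = h k) ∧ T (m + 1) ω = grow m (h m) c} := by
    ext ω
    simp only [Set.mem_ofPred_eq, Set.mem_iUnion, exists_prop]
    tauto
  rw [hset, measure_biUnion_finset, Finset.sum_congr rfl fun c hc => hT.step m hm h c (hS hc),
    ← Finset.mul_sum, ← ENNReal.ofReal_sum_of_nonneg, ← Finset.sum_div]
  · rfl
  · exact fun c hc => div_nonneg (siteWeight_nonneg hα₁ hα₂ (hS hc)) hw
  · intro c hc c' hc' hne
    refine Set.disjoint_left.2 fun ω h1 h2 => hne ?_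
    exact hinj (hS hc) (hS hc') (h1.2.symm.trans h2.2)
  · intro c _
    exact (hT.measurableSet_past m h).inter (hT.measurable (m + 1) (by omega) _)

/-- Given a past with positive total weight, the next tree is obtained by growing the current one.
-/
theorem IsMarchal.ae_exists_grow (hT : IsMarchal P α T) (hα₁ : 1 < α) (hα₂ : α ≤ 2) {m : ℕ}
    (hm : 1 ≤ m) (h : ℕ → DTree) (hinj : Set.InjOn (grow m (h m)) (sites (h m)))
    (hw : 0 < weight α (h m) (sites (h m))) :
    ∀ᵐ ω ∂P, (∀ k, 1 ≤ k → k ≤ m → T k ω = h k) →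
      ∃ c ∈ sites (h m), T (m + 1) ω = grow m (h m) c := by
  have h1 := hT.measure_grow hα₁ hα₂ hm h hinj hw.le subset_rfl
  rw [div_self hw.ne', ENNReal.ofReal_one, mul_one] at h1
  have hmeas : MeasurableSet {ω | (∀ k, 1 ≤ k → k ≤ m → T k ω = h k) ∧
      ∃ c ∈ sites (h m), T (m + 1) ω = grow m (h m) c} := by
    refine (hT.measurableSet_past m h).inter (s₂ :=
      {ω | ∃ c ∈ sites (h m), T (m + 1) ω = grow m (h m) c}) ?_
    have : {ω | ∃ c ∈ sites (h m), T (m + 1) ω = grow m (h m) c} =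
        ⋃ c ∈ sites (h m), {ω | T (m + 1) ω = grow m (h m) c} := by ext; simp
    rw [this]
    exact Finset.measurableSet_biUnion _ fun c _ => hT.measurable (m + 1) (by omega) _
  have h2 := ae_eq_of_subset_of_measure_ge (fun ω hω => hω.1) h1.ge hmeas.nullMeasurableSet
    (measure_ne_top P _)
  filter_upwards [h2] with ω hω hpast
  have : ω ∈ {ω | (∀ k, 1 ≤ k → k ≤ m → T k ω = h k) ∧
      ∃ c ∈ sites (h m), T (m + 1) ω = grow m (h m) c} := hω.mpr hpast
  exact this.2

theorem IsMarchal.ae_two (hT : IsMarchal P α T) (hα₁ : 1 < α) (hα₂ : α ≤ 2) :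
    ∀ᵐ ω ∂P, T 2 ω = grow 1 initialTree (Sum.inl s(A 0, A 1)) := by
  have hbp : branchPoints initialTree = ∅ := by decide
  have hs : sites initialTree = {Sum.inl s(A 0, A 1)} := by
    rw [sites, hbp]; rfl
  have := hT.ae_exists_grow hα₁ hα₂ le_rfl (fun _ => initialTree) (by rw [hs]; simp)
    (by rw [hs, weight, Finset.sum_singleton, siteWeight]; linarith)
  filter_upwards [this, hT.init] with ω hω h1
  obtain ⟨c, hc, hc'⟩ := hω fun k hk hk' => by rw [le_antisymm hk' hk, h1]
  rw [hs, Finset.mem_singleton] at hc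
  rw [hc', hc]

/-- Whether the tree at time `m` is labelled consistently with the indices read at the times at
which the leaves were added. -/
def ConsistentAt (α : ℝ) (T : ℕ → Ω → DTree) (m : ℕ) (ω : Ω) : Prop :=
  ∃ ℓ, Labelled α m (T m ω) ℓ ∧ ∀ k ≤ m, leafIndex ℓ k = leafProcess T k ω

omit [MeasurableSpace Ω] in
/-- The labelling, hence the consistency of the indices, is propagated by the growth of the tree. -/
theorem ConsistentAt.succ_of_grow {m : ℕ} {ω : Ω} {ℓ : Vertex → ℕ} (h : Labelled α m (T m ω) ℓ)
    (hk : ∀ k ≤ m, leafIndex ℓ k = leafProcess T k ω) {c : Site} {j : ℕ}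
    (hc : c ∈ growthSites (T m ω) ℓ m j) (hT : T (m + 1) ω = grow m (T m ω) c) :
    ConsistentAt α T (m + 1) ω ∧ leafProcess T (m + 1) ω = j := by
  have h' := h.grow hc
  rw [← hT] at h'
  have h2 := h.two_le
  have hj : leafProcess T (m + 1) ω = j := by
    rw [leafProcess, if_neg (by omega), h'.indexOf_eq le_rfl, leafIndex_relabel]
  refine ⟨⟨_, h', fun k hkm => ?_⟩, hj⟩
  rcases hkm.lt_or_eq with hlt | rfl
  · rw [leafIndex_relabel_of_lt m ℓ j k hlt, hk k (Nat.lt_succ_iff.1 hlt)]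
  · rw [leafIndex_relabel, hj]

theorem Labelled.weight_sites_pos {m : ℕ} {t : DTree} {ℓ : Vertex → ℕ} (h : Labelled α m t ℓ)
    (hα₁ : 1 < α) : 0 < weight α t (sites t) := by
  have h2 : (2 : ℝ) ≤ m := by exact_mod_cast h.two_le
  rw [h.weight_sites]
  nlinarith

theorem IsMarchal.ae_grow_of_labelled (hT : IsMarchal P α T) (hα₁ : 1 < α) (hα₂ : α ≤ 2) (m : ℕ) :
    ∀ᵐ ω ∂P, (∃ ℓ, Labelled α m (T m ω) ℓ) →
      ∃ c ∈ sites (T m ω), T (m + 1) ω = grow m (T m ω) c := by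
  refine ae_of_forall_past (fun k => T (k + 1)) m fun z => ?_
  by_cases hz : ∃ ℓ, Labelled α m (z (m - 1)) ℓ
  · obtain ⟨ℓ, hℓ⟩ := hz
    have hm : 1 ≤ m := one_le_two.trans hℓ.two_le
    filter_upwards [hT.ae_exists_grow hα₁ hα₂ hm (fun k => z (k - 1)) hℓ.grow_injOn
      (hℓ.weight_sites_pos hα₁)] with ω hω hpast _
    have hpast' : ∀ k, 1 ≤ k → k ≤ m → T k ω = z (k - 1) := fun k hk hkm => by
      have := hpast (k - 1) (by omega)
      rwa [Nat.sub_add_cancel hk] at this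
    rw [hpast' m hm le_rfl]
    exact hω hpast'
  · refine Eventually.of_forall fun ω hpast ⟨ℓ, hℓ⟩ => absurd ?_ hz
    have hm : 1 ≤ m := one_le_two.trans hℓ.two_le
    have := hpast (m - 1) (by omega)
    rw [Nat.sub_add_cancel hm] at this
    exact ⟨ℓ, this ▸ hℓ⟩

/-- Almost surely, the index of a leaf does not change after the leaf has been added. -/
theorem IsMarchal.ae_consistentAt (hT : IsMarchal P α T) (hα₁ : 1 < α) (hα₂ : α ≤ 2) :
    ∀ᵐ ω ∂P, ∀ n, ConsistentAt α T (n + 2) ω := by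
  filter_upwards [hT.ae_two hα₁ hα₂, ae_all_iff.2 (hT.ae_grow_of_labelled hα₁ hα₂)] with ω h2 hg n
  induction n with
  | zero =>
    refine ⟨Sum.elim id fun _ => 0, h2 ▸ labelled_initial α, fun k hk => ?_⟩
    rw [leafProcess, if_pos (Nat.lt_succ_of_le hk)]
    rfl
  | succ n ih =>
    obtain ⟨ℓ, hℓ, hk⟩ := ih
    obtain ⟨c, hc, hgrow⟩ := hg (n + 2) ⟨ℓ, hℓ⟩
    obtain ⟨j, hj⟩ := hℓ.exists_growthSites hc
    exact (ConsistentAt.succ_of_grow hℓ hk hj hgrow).1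

omit [IsProbabilityMeasure P] in
theorem IsMarchal.measurable_leafProcess (hT : IsMarchal P α T) (k : ℕ) :
    Measurable (leafProcess T k) := by
  by_cases hk : k < 3
  · have : leafProcess T k = fun _ => k := funext fun ω => if_pos hk
    rw [this]
    exact measurable_const
  · have : leafProcess T k = fun ω => indexOf (T k ω) k := funext fun ω => if_neg hk
    rw [this]
    refine measurable_to_countable' fun j => ?_
    have : (fun ω => indexOf (T k ω) k) ⁻¹' {j} =
        ⋃ t ∈ {t : DTree | indexOf t k = j}, {ω | T k ω = t} := by
      ext ω; simp
    rw [this]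
    exact MeasurableSet.biUnion (Set.to_countable _) fun t _ => hT.measurable k (by omega) t

/-- The process of subtree indices follows, from time `3` on, the seating plan
of `CRP(1/α, -(1 + 1/α))`. -/
theorem IsMarchal.leafProcess_step (hT : IsMarchal P α T) (hα₁ : 1 < α) (hα₂ : α ≤ 2) {n : ℕ}
    (hn : 3 ≤ n) (e : ℕ → ℕ) (j : ℕ) :
    P {ω | (∀ k < n, leafProcess T k ω = e k) ∧ leafProcess T n ω = j} =
      P {ω | ∀ k < n, leafProcess T k ω = e k} *
        ENNReal.ofReal (crpProb (1 / α) (-(1 + 1 / α)) e n j) := by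
  obtain ⟨m, rfl⟩ : ∃ m, n = m + 1 := ⟨n - 1, by omega⟩
  have hm : 1 ≤ m := by omega
  have hE := hT.measurable_leafProcess
  have hB : MeasurableSet {ω | ∀ k < m + 1, leafProcess T k ω = e k} := by
    simp only [Set.ofPred_forall]
    exact MeasurableSet.iInter fun k => MeasurableSet.iInter fun _ =>
      hE k (measurableSet_singleton _)
  refine measure_inter_of_forall_past (Z := fun k => T (k + 1)) (n := m)
    (fun k _ t => hT.measurable (k + 1) (by omega) t) hB (hE (m + 1) (measurableSet_singleton j)) _
    fun z => ?_
  have hpast : {ω | ∀ k < m, T (k + 1) ω = z k} =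
      {ω | ∀ k, 1 ≤ k → k ≤ m → T k ω = z (k - 1)} := by
    ext ω
    constructor
    · intro h k hk hkm
      have := h (k - 1) (by omega)
      rwa [Nat.sub_add_cancel hk] at this
    · intro h k hk
      exact h (k + 1) (by omega) (by omega)
  have hcons : ∀ᵐ ω ∂P, ConsistentAt α T m ω := by
    have := ae_all_iff.1 (hT.ae_consistentAt hα₁ hα₂) (m - 2)
    rwa [show m - 2 + 2 = m by omega] at this
  rw [hpast]
  set H : Set Ω := {ω | ∀ k, 1 ≤ k → k ≤ m → T k ω = z (k - 1)} with hH
  -- a past of the tree either determines the given past of the indices, or it contributes nothing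
  by_cases hz : ∃ ω ∈ H, (∀ k < m + 1, leafProcess T k ω = e k) ∧ ConsistentAt α T m ω
  · obtain ⟨ω₀, hω₀, he₀, ℓ, hℓ, hk⟩ := hz
    have hTz : ∀ ω ∈ H, T m ω = z (m - 1) := fun ω hω => hω m hm le_rfl
    rw [hTz ω₀ hω₀] at hℓ
    -- the past of the tree determines the past of the subtree indices
    have he : ∀ ω ∈ H, ∀ k < m + 1, leafProcess T k ω = e k := by
      intro ω hω k hkm
      rw [← he₀ k hkm, leafProcess, leafProcess]
      split_ifs with hk3
      · rfl
      · rw [hω k (by omega) (by omega), hω₀ k (by omega) (by omega)]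
    have hkl : ∀ ω ∈ H, ∀ k ≤ m, leafIndex ℓ k = leafProcess T k ω := fun ω hω k hkm => by
      rw [hk k hkm, he₀ k (Nat.lt_succ_of_le hkm), he ω hω k (Nat.lt_succ_of_le hkm)]
    have hHB : H ∩ {ω | ∀ k < m + 1, leafProcess T k ω = e k} = H :=
      Set.inter_eq_left.2 he
    rw [← Set.inter_assoc, hHB]
    have hprob := hT.measure_grow hα₁ hα₂ hm (fun k => z (k - 1)) hℓ.grow_injOn
      (hℓ.weight_sites_pos hα₁).le (hℓ.growthSites_subset j)
    rw [hℓ.weight_growthSites hα₁ j, crpProb_congr (c' := e) fun k hkm => by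
      rw [hk k (Nat.lt_succ_iff.1 hkm), he₀ k hkm]] at hprob
    rw [← hprob]
    refine measure_congr ?_
    filter_upwards [hT.ae_grow_of_labelled hα₁ hα₂ m] with ω hω
    refine propext ⟨?_, ?_⟩
    · rintro ⟨hωH, hj⟩
      refine ⟨hωH, ?_⟩
      have hℓ' := hℓ
      rw [← hTz ω hωH] at hℓ' ⊢
      obtain ⟨c, hc, hgrow⟩ := hω ⟨ℓ, hℓ'⟩
      obtain ⟨i, hi⟩ := hℓ'.exists_growthSites hc
      have := (ConsistentAt.succ_of_grow hℓ' (hkl ω hωH) hi hgrow).2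
      have hij : i = j := this.symm.trans hj
      exact ⟨c, hij ▸ hi, hgrow⟩
    · rintro ⟨hωH, c, hc, hgrow⟩
      refine ⟨hωH, ?_⟩
      have hℓ' := hℓ
      rw [← hTz ω hωH] at hℓ' hc hgrow
      exact (ConsistentAt.succ_of_grow hℓ' (hkl ω hωH) hc hgrow).2
  · have h0 : P (H ∩ {ω | ∀ k < m + 1, leafProcess T k ω = e k}) = 0 := by
      refine measure_mono_null ?_ hcons
      intro ω hω hc
      exact hz ⟨ω, hω.1, hω.2, hc⟩
    rw [h0, zero_mul]
    exact measure_mono_null (Set.inter_subset_inter_right _ Set.inter_subset_left) h0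

end Marchal

/-! ### The urn and the restaurant inside the process of subtree indices -/

theorem count_congr_of_lt {c c' : ℕ → ℕ} {n : ℕ} (h : ∀ k < n, c k = c' k) :
    Nat.count (fun k => 3 ≤ c k) n = Nat.count (fun k => 3 ≤ c' k) n := by
  rw [Nat.count_eq_card_filter_range, Nat.count_eq_card_filter_range,
    Finset.filter_congr fun k hk => by rw [h k (by simpa using hk)]]

theorem sum_tableSize_add_count (c : ℕ → ℕ) (n : ℕ) :
    tableSize c n 0 + tableSize c n 1 + tableSize c n 2 + Nat.count (fun k => 3 ≤ c k) n = n := by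
  induction n with
  | zero => simp
  | succ n ih =>
    simp only [tableSize_succ, Nat.count_succ]
    split_ifs <;> omega

/-- The visits of `e` to the values `≥ 3` before time `N` are described by the sequence `c`, shifted
by `3`. -/
def FollowsExtra (e c : ℕ → ℕ) (N : ℕ) : Prop :=
  ∀ i < N, 3 ≤ e i → e i = c (Nat.count (fun k => 3 ≤ e k) i) + 3

theorem followsExtra_congr {e e' : ℕ → ℕ} {N : ℕ} (h : ∀ k < N, e k = e' k) (c : ℕ → ℕ) :
    FollowsExtra e c N ↔ FollowsExtra e' c N := by
  refine forall₂_congr fun i hi => ?_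
  rw [h i hi, count_congr_of_lt fun k hk => h k (hk.trans hi)]

/-- The leaves in the extra subtrees are the customers at the tables of `c`. -/
theorem FollowsExtra.tableSize_eq {e c : ℕ → ℕ} {N : ℕ} (h : FollowsExtra e c N) (j : ℕ) :
    tableSize e N (j + 3) = tableSize c (Nat.count (fun k => 3 ≤ e k) N) j := by
  induction N with
  | zero => simp
  | succ N ih =>
    have ih := ih fun i hi => h i (hi.trans N.lt_succ_self)
    have hN := h N N.lt_succ_self
    rw [tableSize_succ, Nat.count_succ, ih]
    by_cases h3 : 3 ≤ e N
    · have := hN h3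
      rw [if_pos h3, tableSize_succ]
      congr 1
      exact if_congr (by omega) rfl rfl
    · rw [if_neg h3, if_neg (by omega), Nat.add_zero, Nat.add_zero]

theorem FollowsExtra.numTables_eq {e c : ℕ → ℕ} {N : ℕ} (h : FollowsExtra e c N) (hN : 3 ≤ N)
    (he : ∀ k < 3, e k = k) :
    numTables e N = numTables c (Nat.count (fun k => 3 ≤ e k) N) + 3 := by
  induction N, hN using Nat.le_induction with
  | base =>
    have : Nat.count (fun k => 3 ≤ e k) 3 = 0 := by
      simp [Nat.count_succ, he]
    rw [this, numTables_congr (c' := id) he]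
    rfl
  | succ N hN ih =>
    have h' : FollowsExtra e c N := fun i hi => h i (hi.trans N.lt_succ_self)
    rw [numTables_succ, ih h', Nat.count_succ]
    by_cases h3 : 3 ≤ e N
    · have hc := h N N.lt_succ_self h3
      rw [if_pos h3, numTables_succ]
      have : tableSize e N (e N) = tableSize c (Nat.count (fun k => 3 ≤ e k) N)
          (c (Nat.count (fun k => 3 ≤ e k) N)) := by
        rw [← h'.tableSize_eq, ← hc]
      rw [this]
      omega
    · have : tableSize e N (e N) ≠ 0 := by
        rw [Ne, tableSize_eq_zero]
        push Not
        exact ⟨e N, by omega, he _ (by omega)⟩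
      simp only [if_neg h3, if_neg this, Nat.add_zero]

/-- The law of the process of the subtree indices of the leaves `A 0, A 1, …`. -/
structure IsLeafProcess {Ω : Type*} [MeasurableSpace Ω] (P : Measure Ω) (α : ℝ)
    (E : ℕ → Ω → ℕ) : Prop where
  measurable : ∀ n, Measurable (E n)
  init : ∀ k < 3, ∀ ω, E k ω = k
  isRG : ∀ᵐ ω ∂P, ∀ n, IsRG (fun k => E k ω) n
  step : ∀ n, 3 ≤ n → ∀ (e : ℕ → ℕ) (j : ℕ),
    P {ω | (∀ k < n, E k ω = e k) ∧ E n ω = j} =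
      P {ω | ∀ k < n, E k ω = e k} * ENNReal.ofReal (crpProb (1 / α) (-(1 + 1 / α)) e n j)

theorem IsMarchal.isLeafProcess {Ω : Type*} [MeasurableSpace Ω] {P : Measure Ω}
    [IsProbabilityMeasure P] {α : ℝ} {T : ℕ → Ω → DTree} (hT : IsMarchal P α T) (hα₁ : 1 < α)
    (hα₂ : α ≤ 2) : IsLeafProcess P α (leafProcess T) where
  measurable := hT.measurable_leafProcess
  init k hk ω := if_pos hk
  isRG := by
    filter_upwards [hT.ae_consistentAt hα₁ hα₂] with ω hω n
    obtain ⟨ℓ, hℓ, hk⟩ := hω n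
    have := (isRG_congr fun k hkn => (hk k (Nat.lt_succ_iff.1 hkn)).symm).2 hℓ.isRG
    exact this.mono (by omega)
  step n hn e j := hT.leafProcess_step hα₁ hα₂ hn e j

section LeafProcess

variable {Ω : Type*} [MeasurableSpace Ω] {P : Measure Ω} [IsProbabilityMeasure P] {α : ℝ}
  {E : ℕ → Ω → ℕ}

omit [IsProbabilityMeasure P] in
theorem IsLeafProcess.measurableSet_eq (hE : IsLeafProcess P α E) (k s : ℕ) :
    MeasurableSet {ω | E k ω = s} := hE.measurable k (measurableSet_singleton s)

omit [IsProbabilityMeasure P] in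
/-- A conditional probability given an event of the past may be computed for each admissible past
separately. -/
theorem IsLeafProcess.measure_inter (hE : IsLeafProcess P α E) {n : ℕ} {A : Set Ω}
    (hA : MeasurableSet A) {p : (ℕ → ℕ) → Prop}
    (hp : ∀ c c' : ℕ → ℕ, (∀ k < n, c k = c' k) → (p c ↔ p c')) (r : ENNReal)
    (h : ∀ z, IsRG z n → (∀ k < n, k < 3 → z k = k) → p z →
      P ({ω | ∀ k < n, E k ω = z k} ∩ A) = P {ω | ∀ k < n, E k ω = z k} * r) :
    P ({ω | p fun k => E k ω} ∩ A) = P {ω | p fun k => E k ω} * r := by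
  refine measure_inter_of_forall_past (Z := E) (n := n) (fun k _ s => hE.measurableSet_eq k s)
    (measurableSet_of_past (fun k _ s => hE.measurableSet_eq k s) hp) hA r fun z => ?_
  by_cases hz : p z
  · have h1 : {ω | ∀ k < n, E k ω = z k} ∩ {ω | p fun k => E k ω} =
        {ω | ∀ k < n, E k ω = z k} :=
      Set.inter_eq_left.2 fun ω hω => (hp _ _ hω).2 hz
    rw [← Set.inter_assoc, h1]
    by_cases hz2 : IsRG z n ∧ ∀ k < n, k < 3 → z k = k
    · exact h z hz2.1 hz2.2 hz
    · have h0 : P {ω | ∀ k < n, E k ω = z k} = 0 := by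
        refine measure_mono_null ?_ hE.isRG
        intro ω hω hRG
        refine hz2 ⟨(isRG_congr hω).1 (hRG n), fun k hk hk3 => ?_⟩
        rw [← hω k hk, hE.init k hk3 ω]
      rw [h0, zero_mul, measure_mono_null Set.inter_subset_left h0]
  · have h1 : {ω | ∀ k < n, E k ω = z k} ∩ {ω | p fun k => E k ω} = ∅ :=
      Set.eq_empty_of_forall_notMem fun ω hω => hz ((hp _ _ hω.1).1 hω.2)
    rw [← Set.inter_assoc, h1, Set.empty_inter, measure_empty, zero_mul]

omit [IsProbabilityMeasure P] in
/-- The conditional probability of joining the subtree with index `j`, given an event of the past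
that determines it. -/
theorem IsLeafProcess.measure_eq (hE : IsLeafProcess P α E) {n : ℕ} (hn : 3 ≤ n)
    {p : (ℕ → ℕ) → Prop} (hp : ∀ c c' : ℕ → ℕ, (∀ k < n, c k = c' k) → (p c ↔ p c')) (j : ℕ)
    (r : ℝ) (h : ∀ z, IsRG z n → (∀ k < 3, z k = k) → p z →
      crpProb (1 / α) (-(1 + 1 / α)) z n j = r) :
    P ({ω | p fun k => E k ω} ∩ {ω | E n ω = j}) =
      P {ω | p fun k => E k ω} * ENNReal.ofReal r := by
  refine hE.measure_inter (hE.measurableSet_eq n j) hp _ fun z hz hz3 hpz => ?_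
  rw [← h z hz (fun k hk => hz3 k (hk.trans_le hn) hk) hpz]
  exact hE.step n hn z j

omit [MeasurableSpace Ω] [IsProbabilityMeasure P] in
theorem denominator_pos (hα₁ : 1 < α) {n : ℕ} (hn : 3 ≤ n) : 0 < (n : ℝ) + -(1 + 1 / α) := by
  have h1 : 1 / α < 1 := by rw [div_lt_one (by linarith)]; exact hα₁
  have h2 : (3 : ℝ) ≤ n := by exact_mod_cast hn
  linarith

/-- The conditional probability that the new leaf does not join one of the subtrees of
`A 0, A 1, A 2`. -/
theorem IsLeafProcess.measure_three_le (hE : IsLeafProcess P α E) (hα₁ : 1 < α) (hα₂ : α ≤ 2)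
    {n : ℕ} (hn : 3 ≤ n) {p : (ℕ → ℕ) → Prop}
    (hp : ∀ c c' : ℕ → ℕ, (∀ k < n, c k = c' k) → (p c ↔ p c')) (s : ℕ)
    (h : ∀ z, IsRG z n → (∀ k < 3, z k = k) → p z → Nat.count (fun k => 3 ≤ z k) n = s) :
    P ({ω | p fun k => E k ω} ∩ {ω | 3 ≤ E n ω}) =
      P {ω | p fun k => E k ω} *
        ENNReal.ofReal ((s + (2 / α - 1)) / (n + -(1 + 1 / α))) := by
  have hmeas : MeasurableSet {ω | 3 ≤ E n ω} := hE.measurable n measurableSet_Ici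
  refine hE.measure_inter hmeas hp _ fun z hz hz3 hpz => ?_
  have hz3 : ∀ k < 3, z k = k := fun k hk => hz3 k (hk.trans_le hn) hk
  have hs := h z hz hz3 hpz
  have hden := denominator_pos hα₁ hn
  have hα0 : 0 < 1 / α := by positivity
  have hα1 : 1 / α < 1 := by rw [div_lt_one (by linarith)]; exact hα₁
  have hα2 : 1 ≤ 2 / α := by rw [le_div_iff₀ (by linarith)]; linarith
  have hsize : ∀ i < 3, 0 < tableSize z n i := fun i hi => by
    rw [Nat.pos_iff_ne_zero, Ne, tableSize_eq_zero]
    push Not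
    exact ⟨i, hi.trans_le hn, hz3 i hi⟩
  have hr : ∀ i < 3, crpProb (1 / α) (-(1 + 1 / α)) z n i =
      ((tableSize z n i : ℝ) - 1 / α) / (n + -(1 + 1 / α)) := fun i hi => by
    rw [crpProb, if_pos ((hz.tableSize_pos).1 (hsize i hi))]
  have hr0 : ∀ i < 3, 0 ≤ ((tableSize z n i : ℝ) - 1 / α) / (n + -(1 + 1 / α)) := fun i hi => by
    have : (1 : ℝ) ≤ tableSize z n i := by exact_mod_cast hsize i hi
    exact div_nonneg (by linarith) hden.le
  have hr3 : 0 ≤ ((s : ℝ) + (2 / α - 1)) / (n + -(1 + 1 / α)) :=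
    div_nonneg (by have : (0 : ℝ) ≤ s := s.cast_nonneg
                   linarith) hden.le
  set B : Set Ω := {ω | ∀ k < n, E k ω = z k} with hB
  have hst : ∀ i < 3, P (B ∩ {ω | E n ω = i}) =
      P B * ENNReal.ofReal (((tableSize z n i : ℝ) - 1 / α) / (n + -(1 + 1 / α))) :=
    fun i hi => by rw [← hr i hi]; exact hE.step n hn z i
  have hsum : P B = P (B ∩ {ω | E n ω = 0}) + P (B ∩ {ω | E n ω = 1}) + P (B ∩ {ω | E n ω = 2}) +
      P (B ∩ {ω | 3 ≤ E n ω}) := by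
    rw [← measure_inter_add_sdiff B (hE.measurableSet_eq n 0),
      ← measure_inter_add_sdiff (B \ {ω | E n ω = 0}) (hE.measurableSet_eq n 1),
      ← measure_inter_add_sdiff ((B \ {ω | E n ω = 0}) \ {ω | E n ω = 1})
        (hE.measurableSet_eq n 2), add_assoc, add_assoc]
    congr 2
    · congr 1
      ext ω
      simp only [Set.mem_inter_iff, Set.mem_sdiff, Set.mem_ofPred_eq]
      constructor
      · rintro ⟨⟨h1, -⟩, h2⟩; exact ⟨h1, h2⟩
      · rintro ⟨h1, h2⟩; exact ⟨⟨h1, by omega⟩, h2⟩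
    · congr 2
      · ext ω
        simp only [Set.mem_inter_iff, Set.mem_sdiff, Set.mem_ofPred_eq]
        constructor
        · rintro ⟨⟨⟨h1, -⟩, -⟩, h2⟩; exact ⟨h1, h2⟩
        · rintro ⟨h1, h2⟩; exact ⟨⟨⟨h1, by omega⟩, by omega⟩, h2⟩
      · ext ω
        simp only [Set.mem_inter_iff, Set.mem_sdiff, Set.mem_ofPred_eq]
        constructor
        · rintro ⟨⟨⟨h1, h2⟩, h3⟩, h4⟩; exact ⟨h1, by omega⟩
        · rintro ⟨h1, h2⟩; exact ⟨⟨⟨h1, by omega⟩, by omega⟩, by omega⟩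
  rw [hst 0 (by norm_num), hst 1 (by norm_num), hst 2 (by norm_num), ← mul_add, ← mul_add,
    ← ENNReal.ofReal_add (hr0 0 (by norm_num)) (hr0 1 (by norm_num)),
    ← ENNReal.ofReal_add (add_nonneg (hr0 0 (by norm_num)) (hr0 1 (by norm_num)))
      (hr0 2 (by norm_num))] at hsum
  -- the complement of the first three tables gets what remains of the total probability `1`
  set R := ((tableSize z n 0 : ℝ) - 1 / α) / (n + -(1 + 1 / α)) +
    ((tableSize z n 1 : ℝ) - 1 / α) / (n + -(1 + 1 / α)) +
    ((tableSize z n 2 : ℝ) - 1 / α) / (n + -(1 + 1 / α)) with hR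
  have hone : R + ((s : ℝ) + (2 / α - 1)) / (n + -(1 + 1 / α)) = 1 := by
    rw [hR, ← add_div, ← add_div, ← add_div, div_eq_one_iff_eq hden.ne']
    have : ((tableSize z n 0 + tableSize z n 1 + tableSize z n 2 + s : ℕ) : ℝ) = n := by
      rw [← hs, sum_tableSize_add_count]
    push_cast at this
    rw [← this]
    ring
  have hR0 : 0 ≤ R := add_nonneg (add_nonneg (hr0 0 (by norm_num)) (hr0 1 (by norm_num)))
    (hr0 2 (by norm_num))
  have hsum2 : P B = P B * ENNReal.ofReal R +
      P B * ENNReal.ofReal (((s : ℝ) + (2 / α - 1)) / (n + -(1 + 1 / α))) := by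
    rw [← mul_add, ← ENNReal.ofReal_add hR0 hr3, hone, ENNReal.ofReal_one, mul_one]
  have hfin : P B * ENNReal.ofReal R ≠ ⊤ :=
    ENNReal.mul_ne_top (measure_ne_top P B) ENNReal.ofReal_ne_top
  exact (ENNReal.add_right_inj hfin).1 (hsum.symm.trans hsum2)

end LeafProcess

section Urn

variable {Ω : Type*} [MeasurableSpace Ω] {P : Measure Ω} [IsProbabilityMeasure P] {α : ℝ}
  {E : ℕ → Ω → ℕ}

/-- The colours drawn from the urn with four colours: the subtrees containing `A 0`, `A 1`, `A 2`,
and all the rest. -/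
def fourColour (i : ℕ) : Fin 4 := ⟨min i 3, by omega⟩

/-- The colours drawn from the urn with three colours (for an index `i < 3`). -/
def threeColour (i : ℕ) : Fin 3 := ⟨i % 3, Nat.mod_lt _ (by norm_num)⟩

theorem tableSize_add_three {c : ℕ → ℕ} (hc : ∀ k < 3, c k = k) {j : ℕ} (hj : j < 3) (n : ℕ) :
    tableSize c (n + 3) j = ((Finset.range n).filter (fun k => c (k + 3) = j)).card + 1 := by
  induction n with
  | zero =>
    rw [tableSize_congr (c' := id) hc]
    interval_cases j <;> rfl
  | succ n ih =>
    rw [Nat.add_right_comm, tableSize_succ, ih, Finset.range_add_one, Finset.filter_insert]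
    split_ifs with h
    · rw [Finset.card_insert_of_notMem (by simp)]
    · rfl

theorem count_add_three {c : ℕ → ℕ} (hc : ∀ k < 3, c k = k) (n : ℕ) :
    Nat.count (fun k => 3 ≤ c k) (n + 3) =
      ((Finset.range n).filter (fun k => 3 ≤ c (k + 3))).card := by
  induction n with
  | zero => simp [Nat.count_succ, hc]
  | succ n ih =>
    rw [Nat.add_right_comm, Nat.count_succ, ih, Finset.range_add_one, Finset.filter_insert]
    split_ifs with h
    · rw [Finset.card_insert_of_notMem (by simp)]
    · rfl

theorem sum_urnContent {K : ℕ} (γ : Fin K → ℝ) (s : ℝ) (x : ℕ → Fin K) (n : ℕ) :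
    ∑ i, urnContent γ s x n i = ∑ i, γ i + s * n := by
  simp only [urnContent]
  rw [Finset.sum_add_distrib, ← Finset.mul_sum, ← Nat.cast_sum,
    ← Finset.card_eq_sum_card_fiberwise (fun _ _ => Finset.mem_coe.2 (Finset.mem_univ _)),
    Finset.card_range]

theorem fourColour_eq_iff {i : ℕ} {j : Fin 4} (hj : (j : ℕ) < 3) : fourColour i = j ↔ i = j := by
  rw [fourColour, Fin.ext_iff]; simp only; omega

theorem fourColour_eq_three {i : ℕ} : fourColour i = 3 ↔ 3 ≤ i := by
  rw [fourColour, Fin.ext_iff]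
  simp

theorem urnContent_four (α : ℝ) {c : ℕ → ℕ} (hc : ∀ k < 3, c k = k) (n : ℕ) (j : Fin 4) :
    urnContent ![α - 1, α - 1, α - 1, 2 - α] α (fun k => fourColour (c (k + 3))) n j =
      if (j : ℕ) < 3 then α * tableSize c (n + 3) j - 1
      else α * Nat.count (fun k => 3 ≤ c k) (n + 3) + (2 - α) := by
  rw [urnContent]
  by_cases hj : (j : ℕ) < 3
  · rw [if_pos hj, tableSize_add_three hc hj]
    simp only [fourColour_eq_iff hj]
    push_cast
    fin_cases j <;> simp at hj ⊢ <;> ring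
  · have : j = 3 := by omega
    subst this
    rw [if_neg (by decide), count_add_three hc]
    simp only [fourColour_eq_three]
    simp
    ring

/-- Merging all the extra subtrees into one colour turns the seating plan into a Pólya urn. -/
theorem IsLeafProcess.isPolyaUrn_four (hE : IsLeafProcess P α E) (hα₁ : 1 < α) (hα₂ : α ≤ 2) :
    IsPolyaUrn P ![α - 1, α - 1, α - 1, 2 - α] α (fun n ω => fourColour (E (n + 3) ω)) where
  measurable n := (measurable_of_countable fourColour).comp (hE.measurable _)
  step n x j := by
    have hα0 : (0 : ℝ) < α := by linarith
    have hp : ∀ c c' : ℕ → ℕ, (∀ k < n + 3, c k = c' k) →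
        ((∀ k < n, fourColour (c (k + 3)) = x k) ↔ ∀ k < n, fourColour (c' (k + 3)) = x k) :=
      fun c c' h => forall₂_congr fun k hk => by rw [h (k + 3) (by omega)]
    -- the content of the urn in terms of the subtree indices
    have hcont : ∀ z : ℕ → ℕ, (∀ k < 3, z k = k) → (∀ k < n, fourColour (z (k + 3)) = x k) →
        ∀ j, urnContent ![α - 1, α - 1, α - 1, 2 - α] α x n j =
          if (j : ℕ) < 3 then α * tableSize z (n + 3) j - 1
          else α * Nat.count (fun k => 3 ≤ z k) (n + 3) + (2 - α) := by
      intro z hz hzx j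
      have hf : (Finset.range n).filter (fun k => fourColour (z (k + 3)) = j) =
          (Finset.range n).filter (fun k => x k = j) :=
        Finset.filter_congr fun k hk => by rw [hzx k (by simpa using hk)]
      rw [← urnContent_four α hz, urnContent, urnContent, hf]
    have hden : ∑ i, urnContent ![α - 1, α - 1, α - 1, 2 - α] α x n i =
        α * (((n + 3 : ℕ) : ℝ) + -(1 + 1 / α)) := by
      rw [sum_urnContent, Fin.sum_univ_four]
      push_cast
      simp
      field_simp
      ring
    have hden0 := denominator_pos hα₁ (show 3 ≤ n + 3 by omega)
    rw [hden]
    by_cases hj : (j : ℕ) < 3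
    · have := hE.measure_eq (n := n + 3) (by omega) hp j
        (urnContent ![α - 1, α - 1, α - 1, 2 - α] α x n j /
          (α * (((n + 3 : ℕ) : ℝ) + -(1 + 1 / α)))) fun z hz hz3 hzx => ?_
      · rw [← this]
        congr 1
        ext ω
        exact and_congr_right fun _ => fourColour_eq_iff hj
      · have hpos : (j : ℕ) < numTables z (n + 3) := by
          rw [← hz.tableSize_pos, tableSize_add_three hz3 hj]; omega
        rw [crpProb, if_pos hpos, hcont z hz3 hzx, if_pos hj]
        field_simp
    · have hj3 : j = 3 := Fin.ext (by
        have := j.isLt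
        change (j : ℕ) = 3
        omega)
      subst hj3
      have hs : ∀ z : ℕ → ℕ, IsRG z (n + 3) → (∀ k < 3, z k = k) →
          (∀ k < n, fourColour (z (k + 3)) = x k) → Nat.count (fun k => 3 ≤ z k) (n + 3) =
            ((Finset.range n).filter (fun k => x k = 3)).card := by
        intro z _ hz3 hzx
        have hf : (Finset.range n).filter (fun k => 3 ≤ z (k + 3)) =
            (Finset.range n).filter (fun k => x k = 3) :=
          Finset.filter_congr fun k hk => by rw [← hzx k (by simpa using hk), fourColour_eq_three]
        rw [count_add_three hz3, hf]
      have := hE.measure_three_le hα₁ hα₂ (n := n + 3) (by omega) hp _ hs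
      have hset : {ω | (∀ k < n, fourColour (E (k + 3) ω) = x k) ∧ fourColour (E (n + 3) ω) = 3} =
          {ω | ∀ k < n, fourColour (E (k + 3) ω) = x k} ∩ {ω | 3 ≤ E (n + 3) ω} := by
        ext ω
        exact and_congr_right fun _ => fourColour_eq_three
      rw [hset, this]
      congr 2
      rw [urnContent]
      simp
      field_simp
      ring

/-- For `α = 2`, the branch points have weight zero, so that there are no extra subtrees. -/
theorem IsLeafProcess.ae_lt_three (hE : IsLeafProcess P 2 E) : ∀ᵐ ω ∂P, ∀ n, E n ω < 3 := by
  refine ae_all_iff.2 fun n => ?_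
  induction n using Nat.strong_induction_on with
  | _ n ih =>
    by_cases hn : n < 3
    · exact Eventually.of_forall fun ω => by rw [hE.init n hn ω]; exact hn
    push Not at hn
    have h0 := hE.measure_three_le (by norm_num) le_rfl hn (p := fun c => ∀ k < n, c k < 3)
      (fun c c' h => forall₂_congr fun k hk => by rw [h k hk]) 0 fun z _ _ hz => by
        rw [Nat.count_eq_card_filter_range, Finset.card_eq_zero, Finset.filter_eq_empty_iff]
        intro k hk
        exact not_le.2 (hz k (by simpa using hk))
    have h1 : P ({ω | ∀ k < n, E k ω < 3} ∩ {ω | 3 ≤ E n ω}) = 0 := by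
      rw [h0]; simp
    have h2 : ∀ᵐ ω ∂P, ∀ k < n, E k ω < 3 := by
      rw [ae_all_iff]; intro k; rw [ae_all_iff]; exact ih k
    have h3 : ∀ᵐ ω ∂P, ω ∉ {ω | ∀ k < n, E k ω < 3} ∩ {ω | 3 ≤ E n ω} :=
      measure_eq_zero_iff_ae_notMem.1 h1
    filter_upwards [h2, h3] with ω h2 h3
    by_contra! hlt
    exact h3 ⟨h2, hlt⟩

theorem threeColour_eq_iff {i : ℕ} (hi : i < 3) {j : Fin 3} : threeColour i = j ↔ i = j := by
  rw [threeColour, Fin.ext_iff]; simp only; omega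

theorem urnContent_three {c : ℕ → ℕ} (hc : ∀ k < 3, c k = k) (hc3 : ∀ k, c k < 3) (n : ℕ)
    (j : Fin 3) :
    urnContent ![1, 1, 1] 2 (fun k => threeColour (c (k + 3))) n j =
      2 * tableSize c (n + 3) j - 1 := by
  rw [urnContent, tableSize_add_three hc j.2]
  simp only [threeColour_eq_iff (hc3 _)]
  push_cast
  fin_cases j <;> simp <;> ring

/-- For `α = 2` there are no extra subtrees, and three colours remain. -/
theorem IsLeafProcess.isPolyaUrn_three (hE : IsLeafProcess P 2 E) :
    IsPolyaUrn P ![1, 1, 1] 2 (fun n ω => threeColour (E (n + 3) ω)) where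
  measurable n := (measurable_of_countable threeColour).comp (hE.measurable _)
  step n x j := by
    have hp : ∀ c c' : ℕ → ℕ, (∀ k < n + 3, c k = c' k) →
        ((∀ k < n, c (k + 3) = x k) ↔ ∀ k < n, c' (k + 3) = x k) :=
      fun c c' h => forall₂_congr fun k hk => by rw [h (k + 3) (by omega)]
    have := hE.measure_eq (n := n + 3) (by omega) hp j
        (urnContent ![1, 1, 1] 2 x n j / ∑ i, urnContent ![1, 1, 1] 2 x n i) fun z hz hz3 hzx => ?_
    · have h1 : {ω | (∀ k < n, threeColour (E (k + 3) ω) = x k) ∧ threeColour (E (n + 3) ω) = j}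
          =ᵐ[P] ({ω | ∀ k < n, E (k + 3) ω = x k} ∩ {ω | E (n + 3) ω = j} : Set Ω) := by
        filter_upwards [hE.ae_lt_three] with ω hω
        exact propext (and_congr (forall₂_congr fun k _ => threeColour_eq_iff (hω _))
          (threeColour_eq_iff (hω _)))
      have h2 : {ω | ∀ k < n, threeColour (E (k + 3) ω) = x k}
          =ᵐ[P] {ω | ∀ k < n, E (k + 3) ω = x k} := by
        filter_upwards [hE.ae_lt_three] with ω hω
        exact propext (forall₂_congr fun k _ => threeColour_eq_iff (hω _))
      rw [measure_congr h1, measure_congr h2, this]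
    · have hpos : (j : ℕ) < numTables z (n + 3) := by
        rw [← hz.tableSize_pos, tableSize_add_three hz3 j.2]; omega
      have hcount : (Finset.range n).filter (fun k => z (k + 3) = j) =
          (Finset.range n).filter (fun k => x k = j) := Finset.filter_congr fun k hk => by
        rw [hzx k (by simpa using hk), Fin.ext_iff]
      rw [crpProb, if_pos hpos, sum_urnContent, urnContent, tableSize_add_three hz3 j.2, hcount,
        Fin.sum_univ_three]
      have hd : ((n + 3 : ℕ) : ℝ) + -(1 + 1 / 2) = (1 + 1 + 1 + 2 * n) / 2 := by
        push_cast; ring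
      have hγ : ∀ j : Fin 3, (![1, 1, 1] : Fin 3 → ℝ) j = 1 := fun j => by fin_cases j <;> rfl
      have h0 : (1 : ℝ) + 1 + 1 + 2 * n ≠ 0 := by positivity
      rw [hd, hγ, hγ, hγ, hγ]
      push_cast
      field_simp
      ring

end Urn

section Restaurant

variable {Ω : Type*} [MeasurableSpace Ω] {P : Measure Ω} [IsProbabilityMeasure P] {α : ℝ}
  {E : ℕ → Ω → ℕ}

/-- The indices, shifted by `3`, of the extra subtrees to which the successive leaves in these
subtrees belong. -/
noncomputable def extraIndex (E : ℕ → Ω → ℕ) (n : ℕ) (ω : Ω) : ℕ :=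
  E (Nat.nth (fun k => 3 ≤ E k ω) n) ω - 3

omit [MeasurableSpace Ω] in
theorem followsExtra_extraIndex (E : ℕ → Ω → ℕ) (ω : Ω) (N : ℕ) :
    FollowsExtra (fun k => E k ω) (fun k => extraIndex E k ω) N := by
  intro i _ h3
  have h3 : 3 ≤ E i ω := h3
  simp only [extraIndex]
  rw [Nat.nth_count (p := fun k => 3 ≤ E k ω) h3]
  omega

omit [MeasurableSpace Ω] in
/-- Until time `N`, the first extra indices are `c 0, c 1, …` if and only if the sequence of subtree
indices follows `c`. -/
theorem forall_extraIndex_iff (E : ℕ → Ω → ℕ) (ω : Ω) {N n : ℕ}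
    (hn : Nat.count (fun k => 3 ≤ E k ω) N = n) (c : ℕ → ℕ) :
    (∀ k < n, extraIndex E k ω = c k) ↔ FollowsExtra (fun k => E k ω) c N := by
  subst hn
  constructor
  · intro h i hi h3
    rw [← h _ (Nat.count_strict_mono (p := fun k => 3 ≤ E k ω) h3 hi)]
    exact followsExtra_extraIndex E ω N i hi h3
  · intro h k hk
    have hfin : ∀ hf : (Set.ofPred fun k => 3 ≤ E k ω).Finite, k < hf.toFinset.card := fun hf =>
      hk.trans_le (Nat.count_le_card hf N)
    have h1 := h _ (Nat.nth_lt_of_lt_count hk) (Nat.nth_mem _ hfin)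
    rw [Nat.count_nth hfin] at h1
    have h1 : E _ ω = c k + 3 := h1
    rw [extraIndex, h1, Nat.add_sub_cancel]

/-- Sampled at the arrival times of the extra leaves, the seating plan of `CRP(1/α, -(1 + 1/α))`,
conditioned on avoiding the first three tables, is that of `CRP(1/α, 2/α - 1)`. -/
theorem IsLeafProcess.isCRP (hE : IsLeafProcess P α E) (hα₁ : 1 < α) (hα₂ : α ≤ 2)
    (hinf : ∀ᵐ ω ∂P, (Set.ofPred fun k => 3 ≤ E k ω).Infinite) :
    IsCRP P (1 / α) (2 / α - 1) (extraIndex E) := by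
  have hα0 : (0 : ℝ) < α := by linarith
  have hα2 : 1 ≤ 2 / α := by rw [le_div_iff₀ hα0]; linarith
  -- `G n N` is the event that the `n`-th extra leaf arrives at time `N`
  let G : ℕ → ℕ → Set Ω := fun n N => {ω | Nat.count (fun k => 3 ≤ E k ω) N = n ∧ 3 ≤ E N ω}
  have hG : ∀ n N, MeasurableSet (G n N) := fun n N => by
    refine MeasurableSet.inter (s₁ := {ω | Nat.count (fun k => 3 ≤ E k ω) N = n})
      (measurableSet_of_past (Z := E) (n := N) (fun k _ s => hE.measurableSet_eq k s)
        (p := fun c => Nat.count (fun k => 3 ≤ c k) N = n)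
        fun c c' h => by rw [count_congr_of_lt h]) ?_
    exact hE.measurable N measurableSet_Ici
  have hGnth : ∀ {n N ω}, ω ∈ G n N → Nat.nth (fun k => 3 ≤ E k ω) n = N := by
    rintro n N ω ⟨h1, h2⟩
    rw [← h1]
    exact Nat.nth_count (p := fun k => 3 ≤ E k ω) h2
  have hGdisj : ∀ n, Pairwise (Function.onFun Disjoint (G n)) := fun n N N' hne =>
    Set.disjoint_left.2 fun ω h h' => hne ((hGnth h).symm.trans (hGnth h'))
  have hGcover : ∀ n, ∀ᵐ ω ∂P, ω ∈ ⋃ N, G n N := fun n => by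
    filter_upwards [hinf] with ω hω
    exact Set.mem_iUnion.2 ⟨Nat.nth (fun k => 3 ≤ E k ω) n,
      Nat.count_nth_of_infinite hω n, Nat.nth_mem_of_infinite hω n⟩
  have hmeas : ∀ n, Measurable (extraIndex E n) := fun n => by
    refine measurable_to_countable' fun j => ?_
    have : extraIndex E n ⁻¹' {j} = (⋃ N, (G n N ∩ {ω | E N ω - 3 = j})) ∪
        ((⋃ N, G n N)ᶜ ∩ {_ω | 0 = j}) := by
      ext ω
      simp only [Set.mem_preimage, Set.mem_singleton_iff, Set.mem_union, Set.mem_iUnion,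
        Set.mem_inter_iff, Set.mem_compl_iff, Set.mem_ofPred_eq]
      by_cases h : ∃ N, ω ∈ G n N
      · obtain ⟨N, hN⟩ := h
        have h1 : extraIndex E n ω = E N ω - 3 := by rw [extraIndex, hGnth hN]
        rw [h1]
        constructor
        · exact fun h => Or.inl ⟨N, hN, h⟩
        · rintro (⟨N', hN', h⟩ | ⟨h, -⟩)
          · rwa [← (hGnth hN).symm.trans (hGnth hN')] at h
          · exact absurd ⟨N, hN⟩ h
      · have h1 : extraIndex E n ω = 0 := by
          have hn : ¬ ∀ hf : (Set.ofPred fun k => 3 ≤ E k ω).Finite, n < hf.toFinset.card := by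
            intro hf
            exact h ⟨Nat.nth (fun k => 3 ≤ E k ω) n, Nat.count_nth hf, Nat.nth_mem n hf⟩
          push Not at hn
          obtain ⟨hf, hn⟩ := hn
          rw [extraIndex, Nat.nth_of_card_le hf hn, hE.init 0 (by norm_num)]
        rw [h1]
        constructor
        · exact fun h0 => Or.inr ⟨h, h0⟩
        · rintro (⟨N, hN, -⟩ | ⟨-, h0⟩)
          exacts [absurd ⟨N, hN⟩ h, h0]
    rw [this]
    refine MeasurableSet.union (MeasurableSet.iUnion fun N => (hG n N).inter ?_)
      ((MeasurableSet.iUnion fun N => hG n N).compl.inter (MeasurableSet.const _))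
    exact ((measurable_of_countable fun i => i - 3).comp (hE.measurable N))
      (measurableSet_singleton j)
  refine ⟨hmeas, ?_, ?_⟩
  · filter_upwards [hGcover 0, hE.isRG] with ω h0 hRG
    obtain ⟨N, hN⟩ := Set.mem_iUnion.1 h0
    have h3 : 3 ≤ N := by
      by_contra! hlt
      have := hN.2
      rw [hE.init N hlt] at this
      omega
    have hle := hRG (N + 1) N N.lt_succ_self
    rw [(followsExtra_extraIndex E ω N).numTables_eq h3 fun k hk => hE.init k hk ω, hN.1,
      numTables_zero] at hle
    have hle : E N ω ≤ 0 + 3 := hle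
    rw [extraIndex, hGnth hN]
    omega
  · intro n hn c j
    let p : ℕ → (ℕ → ℕ) → Prop := fun N e =>
      Nat.count (fun k => 3 ≤ e k) N = n ∧ FollowsExtra e c N
    have hp : ∀ N, ∀ e e' : ℕ → ℕ, (∀ k < N, e k = e' k) → (p N e ↔ p N e') := fun N e e' h =>
      and_congr (by rw [count_congr_of_lt h]) (followsExtra_congr h c)
    have hden : 0 < (n : ℝ) + (2 / α - 1) := by
      have : (1 : ℝ) ≤ n := by exact_mod_cast hn
      linarith
    have hcrp : (if j < numTables c n then ((tableSize c n j : ℝ) - 1 / α) / (n + (2 / α - 1))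
           else if j = numTables c n then ((2 / α - 1) + numTables c n * (1 / α)) /
             (n + (2 / α - 1)) else 0) = crpProb (1 / α) (2 / α - 1) c n j := rfl
    rw [hcrp]
    -- given that the `n`-th extra leaf arrives at time `N`, it chooses its subtree as required
    have key : ∀ N, P ({ω | p N fun k => E k ω} ∩ {ω | E N ω = j + 3}) =
        P ({ω | p N fun k => E k ω} ∩ {ω | 3 ≤ E N ω}) *
          ENNReal.ofReal (crpProb (1 / α) (2 / α - 1) c n j) := by
      intro N
      by_cases hN : 3 ≤ N
      · have hdenN := denominator_pos hα₁ hN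
        rw [hE.measure_three_le hα₁ hα₂ hN (hp N) n fun z _ _ hz => hz.1,
          hE.measure_eq hN (hp N) (j + 3)
            (((n : ℝ) + (2 / α - 1)) / (N + -(1 + 1 / α)) *
              crpProb (1 / α) (2 / α - 1) c n j) fun z hz hz3 hpz => ?_, mul_assoc,
          ENNReal.ofReal_mul (div_nonneg hden.le hdenN.le)]
        have h1 := hpz.2.numTables_eq hN hz3
        have h2 := hpz.2.tableSize_eq j
        rw [hpz.1] at h1 h2
        rw [crpProb, crpProb, h1, h2]
        simp only [Nat.add_lt_add_iff_right, Nat.add_right_cancel_iff]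
        have hα0' := hα0.ne'
        split_ifs
        · rw [div_mul_div_comm, mul_comm, mul_div_mul_right _ _ hden.ne']
        · rw [div_mul_div_comm, mul_comm ((n : ℝ) + (2 / α - 1)), mul_div_mul_right _ _ hden.ne']
          push_cast
          congr 1
          field_simp
          ring
        · simp
      · have h0 : ({ω | p N fun k => E k ω} ∩ {ω | 3 ≤ E N ω} : Set Ω) = ∅ := by
          refine Set.eq_empty_of_forall_notMem fun ω hω => ?_
          have h3 : 3 ≤ E N ω := hω.2
          rw [hE.init N (by omega)] at h3
          omega
        have h0' : P ({ω | p N fun k => E k ω} ∩ {ω | 3 ≤ E N ω}) = 0 := by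
          rw [h0, measure_empty]
        rw [h0', zero_mul]
        refine measure_mono_null (Set.inter_subset_inter_right _ fun ω hω => ?_) h0'
        have : E N ω = j + 3 := hω
        show 3 ≤ E N ω
        omega
    have hpmeas : ∀ N, MeasurableSet {ω | p N fun k => E k ω} := fun N =>
      measurableSet_of_past (Z := E) (fun k _ s => hE.measurableSet_eq k s) (hp N)
    have hsub : ∀ N, ({ω | p N fun k => E k ω} ∩ {ω | 3 ≤ E N ω} : Set Ω) ⊆ G n N :=
      fun N ω hω => ⟨hω.1.1, hω.2⟩
    have hsub' : ∀ N, ({ω | p N fun k => E k ω} ∩ {ω | E N ω = j + 3} : Set Ω) ⊆ G n N :=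
      fun N ω hω => ⟨hω.1.1, by have : E N ω = j + 3 := hω.2
                                omega⟩
    -- decompose according to the arrival time of the `n`-th extra leaf
    have h1 : {ω | (∀ k < n, extraIndex E k ω = c k) ∧ extraIndex E n ω = j} =ᵐ[P]
        ⋃ N, ({ω | p N fun k => E k ω} ∩ {ω | E N ω = j + 3} : Set Ω) := by
      filter_upwards [hGcover n] with ω hω
      obtain ⟨N, hN⟩ := Set.mem_iUnion.1 hω
      refine propext ⟨?_, ?_⟩
      · rintro ⟨hk, hj⟩
        refine Set.mem_iUnion.2 ⟨N, ⟨hN.1, (forall_extraIndex_iff E ω hN.1 c).1 hk⟩, ?_⟩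
        rw [extraIndex, hGnth hN] at hj
        have := hN.2
        show E N ω = j + 3
        omega
      · intro h
        obtain ⟨N', hN'⟩ := Set.mem_iUnion.1 h
        have hG' := hsub' N' hN'
        refine ⟨(forall_extraIndex_iff E ω hG'.1 c).2 hN'.1.2, ?_⟩
        have : E N' ω = j + 3 := hN'.2
        rw [extraIndex, hGnth hG', this, Nat.add_sub_cancel]
    have h2 : {ω | ∀ k < n, extraIndex E k ω = c k} =ᵐ[P]
        ⋃ N, ({ω | p N fun k => E k ω} ∩ {ω | 3 ≤ E N ω} : Set Ω) := by
      filter_upwards [hGcover n] with ω hω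
      obtain ⟨N, hN⟩ := Set.mem_iUnion.1 hω
      refine propext ⟨?_, ?_⟩
      · intro hk
        exact Set.mem_iUnion.2 ⟨N, ⟨hN.1, (forall_extraIndex_iff E ω hN.1 c).1 hk⟩, hN.2⟩
      · intro h
        obtain ⟨N', hN'⟩ := Set.mem_iUnion.1 h
        exact (forall_extraIndex_iff E ω (hsub N' hN').1 c).2 hN'.1.2
    rw [measure_congr h1, measure_congr h2,
      measure_iUnion (fun N N' hne => (hGdisj n hne).mono (hsub' N) (hsub' N'))
        fun N => (hpmeas N).inter (hE.measurableSet_eq N _),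
      measure_iUnion (fun N N' hne => (hGdisj n hne).mono (hsub N) (hsub N'))
        fun N => (hpmeas N).inter (hE.measurable N measurableSet_Ici), ← ENNReal.tsum_mul_right]
    exact tsum_congr key

end Restaurant

/-! ### Sequences of draws from random frequencies -/

/-- `p` is a sequence of nonnegative numbers with sum at most `1`. -/
def IsSubprob (p : ℕ → ℝ) : Prop := (∀ j, 0 ≤ p j) ∧ ∀ j, ∑ i ∈ Finset.range j, p i ≤ 1

/-- The colour `j ≤ m` selected by the number `u ∈ [0, 1]` when `[0, 1]` is cut into consecutive
intervals of lengths `p 0, …, p (m - 1)`, and a last one for the colour `m`. -/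
noncomputable def select (p : ℕ → ℝ) (u : ℝ) : ℕ → ℕ
  | 0 => 0
  | m + 1 => if select p u m < m then select p u m
      else if u < ∑ i ∈ Finset.range (m + 1), p i then m else m + 1

/-- The probability of the colour `j` under `select p · m`. -/
noncomputable def selectProb (p : ℕ → ℝ) (m j : ℕ) : ℝ :=
  if j < m then p j else if j = m then 1 - ∑ i ∈ Finset.range m, p i else 0

theorem select_eq_iff {p : ℕ → ℝ} (hp : ∀ j, 0 ≤ p j) {u : ℝ} (hu : 0 ≤ u) (m j : ℕ) :
    select p u m = j ↔ (j < m ∧ ∑ i ∈ Finset.range j, p i ≤ u ∧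
      u < ∑ i ∈ Finset.range (j + 1), p i) ∨ (j = m ∧ ∑ i ∈ Finset.range m, p i ≤ u) := by
  induction m generalizing j with
  | zero => simp [select, hu, eq_comm]
  | succ m ih =>
    have hmono : ∑ i ∈ Finset.range m, p i ≤ ∑ i ∈ Finset.range (m + 1), p i := by
      rw [Finset.sum_range_succ]; linarith [hp m]
    rw [select]
    have hself := (ih (select p u m)).1 rfl
    split_ifs with h1 h2
    · rw [ih]
      have h3 := hself.resolve_right fun h => h1.ne h.1
      constructor
      · rintro (h | ⟨rfl, h⟩)
        · exact Or.inl ⟨h.1.trans m.lt_succ_self, h.2⟩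
        · have := (ih j).2 (Or.inr ⟨rfl, h⟩)
          omega
      · rintro (⟨hj, h⟩ | ⟨rfl, h⟩)
        · rcases Nat.lt_succ_iff_lt_or_eq.1 hj with hj | rfl
          · exact Or.inl ⟨hj, h⟩
          · exact Or.inr ⟨rfl, h.1⟩
        · have := (ih m).2 (Or.inr ⟨rfl, hmono.trans h⟩)
          omega
    · have h3 := hself.resolve_left fun h => h1 h.1
      constructor
      · rintro rfl
        exact Or.inl ⟨m.lt_succ_self, h3.2, h2⟩
      · rintro (⟨hj, h⟩ | ⟨rfl, h⟩)
        · rcases Nat.lt_succ_iff_lt_or_eq.1 hj with hj | rfl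
          · have := (ih j).2 (Or.inl ⟨hj, h⟩)
            omega
          · rfl
        · linarith
    · have h3 := hself.resolve_left fun h => h1 h.1
      push Not at h2
      constructor
      · rintro rfl
        exact Or.inr ⟨rfl, h2⟩
      · rintro (⟨hj, h⟩ | ⟨rfl, h⟩)
        · rcases Nat.lt_succ_iff_lt_or_eq.1 hj with hj | rfl
          · have := (ih j).2 (Or.inl ⟨hj, h⟩)
            omega
          · linarith
        · rfl

theorem volume_interval {a b : ℝ} (ha : 0 ≤ a) (hab : a ≤ b) (hb : b ≤ 1) :
    volume {u : unitInterval | a ≤ u ∧ (u : ℝ) < b} = ENNReal.ofReal (b - a) :=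
  unitInterval.volume_Ico ⟨a, ha, hab.trans hb⟩ ⟨b, ha.trans hab, hb⟩

theorem volume_tail {a : ℝ} (ha : 0 ≤ a) (ha1 : a ≤ 1) :
    volume {u : unitInterval | a ≤ u} = ENNReal.ofReal (1 - a) :=
  unitInterval.volume_Ici ⟨a, ha, ha1⟩

theorem IsSubprob.sum_nonneg {p : ℕ → ℝ} (hp : IsSubprob p) (j : ℕ) :
    0 ≤ ∑ i ∈ Finset.range j, p i := Finset.sum_nonneg fun i _ => hp.1 i

/-- A uniform number selects the colour `j` with probability `selectProb p m j`. -/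
theorem IsSubprob.volume_select {p : ℕ → ℝ} (hp : IsSubprob p) (m j : ℕ) :
    volume {u : unitInterval | select p u m = j} = ENNReal.ofReal (selectProb p m j) := by
  have hset : {u : unitInterval | select p u m = j} =
      {u : unitInterval | (j < m ∧ ∑ i ∈ Finset.range j, p i ≤ u ∧
      u < ∑ i ∈ Finset.range (j + 1), p i) ∨ (j = m ∧ ∑ i ∈ Finset.range m, p i ≤ u)} := by
    ext u
    exact select_eq_iff hp.1 u.2.1 m j
  rw [hset, selectProb]
  rcases lt_trichotomy j m with h | h | h
  · simp only [h, h.ne, true_and, false_and, or_false, if_true]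
    rw [volume_interval (hp.sum_nonneg j) _ (hp.2 (j + 1)), Finset.sum_range_succ,
      add_sub_cancel_left]
    rw [Finset.sum_range_succ]; linarith [hp.1 j]
  · simp only [h, lt_irrefl, true_and, false_and, false_or, if_true, if_false]
    exact volume_tail (hp.sum_nonneg m) (hp.2 m)
  · simp [h.not_gt, h.ne']

/-- The state after `n` draws: the sequence of the colours drawn so far, continued by `0`. The next
draw selects one of the colours `0, …, m`, where `m` is given by `cap` and the past. -/
noncomputable def drawState (cap : (ℕ → ℕ) → ℕ → ℕ) (p : ℕ → ℝ) (u : ℕ → ℝ) : ℕ → ℕ → ℕ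
  | 0 => fun _ => 0
  | n + 1 => Function.update (drawState cap p u n) n
      (select p (u n) (cap (drawState cap p u n) n))

/-- The colour of the `n`-th draw. -/
noncomputable def draw (cap : (ℕ → ℕ) → ℕ → ℕ) (p : ℕ → ℝ) (u : ℕ → ℝ) (n : ℕ) : ℕ :=
  drawState cap p u (n + 1) n

/-- `cap c n` depends on the first `n` terms of `c` only. -/
def IsAdapted (cap : (ℕ → ℕ) → ℕ → ℕ) : Prop :=
  ∀ n c c', (∀ k < n, c k = c' k) → cap c n = cap c' n

section Draw

variable {cap : (ℕ → ℕ) → ℕ → ℕ}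

theorem drawState_eq (p : ℕ → ℝ) (u : ℕ → ℝ) {n k : ℕ} (hk : k < n) :
    drawState cap p u n k = draw cap p u k := by
  induction n with
  | zero => omega
  | succ n ih =>
    rcases Nat.lt_succ_iff_lt_or_eq.1 hk with hk | rfl
    · rw [drawState, Function.update_of_ne hk.ne, ih hk]
    · rfl

theorem draw_eq (hcap : IsAdapted cap) (p : ℕ → ℝ) (u : ℕ → ℝ) (n : ℕ) :
    draw cap p u n = select p (u n) (cap (draw cap p u) n) := by
  rw [draw, drawState, Function.update_self, hcap n _ _ fun k hk => drawState_eq p u hk]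

/-- As the number of available colours depends on the past only, prescribed draws amount to one
condition on each of the independent numbers `u k`. -/
theorem forall_draw_eq_iff (hcap : IsAdapted cap) (p : ℕ → ℝ) (u : ℕ → ℝ) (c : ℕ → ℕ) (n : ℕ) :
    (∀ k < n, draw cap p u k = c k) ↔ ∀ k < n, select p (u k) (cap c k) = c k := by
  constructor
  · intro h k hk
    rw [← hcap k _ _ fun i hi => h i (hi.trans hk), ← draw_eq hcap, h k hk]
  · intro h k
    induction k using Nat.strong_induction_on with
    | _ k ih =>
      intro hk
      rw [draw_eq hcap, hcap k _ c fun i hi => ih i hi (hi.trans hk), h k hk]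

end Draw

/-! ### Mixtures -/

section Mixture

variable {Θ : Type*} [MeasurableSpace Θ] {π : Measure Θ}
  {p : Θ → ℕ → ℝ} {cap : (ℕ → ℕ) → ℕ → ℕ}

/-- Independent uniform random variables. -/
noncomputable abbrev uniforms : Measure (ℕ → unitInterval) :=
  Measure.infinitePi fun _ : ℕ => (volume : Measure unitInterval)

/-- The draws as functions of the random frequencies and of independent uniforms. -/
noncomputable def mixedDraw (cap : (ℕ → ℕ) → ℕ → ℕ) (p : Θ → ℕ → ℝ) (n : ℕ)
    (x : Θ × (ℕ → unitInterval)) : ℕ :=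
  draw cap (p x.1) (fun k => x.2 k) n

theorem measurable_select (hp : ∀ j, Measurable fun θ => p θ j) (k m : ℕ) :
    Measurable fun x : Θ × (ℕ → unitInterval) => select (p x.1) (x.2 k) m := by
  have hu : Measurable fun x : Θ × (ℕ → unitInterval) => (x.2 k : ℝ) := by fun_prop
  have hS : ∀ m, Measurable fun x : Θ × (ℕ → unitInterval) =>
      ∑ i ∈ Finset.range m, p x.1 i := fun m =>
    Finset.measurable_fun_sum _ fun i _ => (hp i).comp measurable_fst
  induction m with
  | zero => exact measurable_const
  | succ m ih =>
    simp only [select]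
    exact Measurable.ite (ih measurableSet_Iio) ih
      (Measurable.ite (measurableSet_lt hu (hS _)) measurable_const measurable_const)

theorem measurable_mixedDraw (hcap : IsAdapted cap) (hp : ∀ j, Measurable fun θ => p θ j) (n : ℕ) :
    Measurable (mixedDraw cap p n) := by
  induction n using Nat.strong_induction_on with
  | _ n ih =>
    have hm : ∀ m, MeasurableSet {x | cap (fun k => mixedDraw cap p k x) n = m} := fun m =>
      measurableSet_of_past (Z := mixedDraw cap p) (n := n) (p := fun c => cap c n = m)
        (fun k hk s => ih k hk (measurableSet_singleton s)) fun c c' h => by rw [hcap n c c' h]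
    refine measurable_to_countable' fun j => ?_
    have : mixedDraw cap p n ⁻¹' {j} =
        ⋃ m, ({x | cap (fun k => mixedDraw cap p k x) n = m} ∩
          {x | select (p x.1) (x.2 n) m = j}) := by
      ext x
      simp only [Set.mem_preimage, Set.mem_singleton_iff, Set.mem_iUnion, Set.mem_inter_iff,
        Set.mem_ofPred_eq, exists_eq_left']
      rw [mixedDraw, draw_eq hcap]
      rfl
    rw [this]
    exact MeasurableSet.iUnion fun m => (hm m).inter
      (measurable_select hp n m (measurableSet_singleton j))

/-- The probability of prescribed first draws is a mixture of products. -/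
theorem measure_mixedDraw (hcap : IsAdapted cap) (hp : ∀ j, Measurable fun θ => p θ j)
    (hsub : ∀ᵐ θ ∂π, IsSubprob (p θ)) (c : ℕ → ℕ) (n : ℕ) :
    π.prod uniforms {x | ∀ k < n, mixedDraw cap p k x = c k} =
      ∫⁻ θ, ∏ k ∈ Finset.range n, ENNReal.ofReal (selectProb (p θ) (cap c k) (c k)) ∂π := by
  have hmeas : MeasurableSet {x | ∀ k < n, mixedDraw cap p k x = c k} := by
    simp only [Set.ofPred_forall]
    exact MeasurableSet.iInter fun k => MeasurableSet.iInter fun _ =>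
      measurable_mixedDraw hcap hp k (measurableSet_singleton _)
  rw [Measure.prod_apply hmeas]
  refine lintegral_congr_ae ?_
  filter_upwards [hsub] with θ hθ
  have hset : Prod.mk θ ⁻¹' {x | ∀ k < n, mixedDraw cap p k x = c k} =
      Set.pi (Finset.range n) fun k => {u : unitInterval | select (p θ) u (cap c k) = c k} := by
    ext u
    simp only [Set.mem_preimage, Set.mem_ofPred_eq, Set.mem_pi, Finset.coe_range, Set.mem_Iio]
    exact forall_draw_eq_iff hcap (p θ) (fun k => u k) c n
  rw [hset, Measure.infinitePi_pi]
  · exact Finset.prod_congr rfl fun k _ => hθ.volume_select _ _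
  · intro k _
    have hset : {u : unitInterval | select (p θ) u (cap c k) = c k} =
        {u : unitInterval | (c k < cap c k ∧ ∑ i ∈ Finset.range (c k), p θ i ≤ u ∧
        u < ∑ i ∈ Finset.range (c k + 1), p θ i) ∨
          (c k = cap c k ∧ ∑ i ∈ Finset.range (cap c k), p θ i ≤ u)} := by
      ext u
      exact select_eq_iff hθ.1 u.2.1 _ _
    rw [hset]
    measurability

/-- The strong law of large numbers for the number of visits to a set. -/
theorem ae_tendsto_frequency {S : Set unitInterval} (hS : MeasurableSet S) :
    ∀ᵐ u ∂uniforms, Tendsto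
      (fun n : ℕ => (∑ k ∈ Finset.range n, S.indicator (1 : unitInterval → ℝ) (u k)) / n) atTop
      (𝓝 (volume.real S)) := by
  have hf : Measurable (S.indicator (1 : unitInterval → ℝ)) := measurable_one.indicator hS
  have hident : ∀ i, IdentDistrib
      (fun u : ℕ → unitInterval => S.indicator (1 : unitInterval → ℝ) (u i))
      (fun u => S.indicator (1 : unitInterval → ℝ) (u 0)) uniforms uniforms := fun i => by
    have : IdentDistrib (fun u : ℕ → unitInterval => u i) (fun u => u 0) uniforms uniforms :=
      ⟨(measurable_pi_apply i).aemeasurable, (measurable_pi_apply 0).aemeasurable, by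
        rw [Measure.infinitePi_map_eval, Measure.infinitePi_map_eval]⟩
    exact this.comp hf
  have h := strong_law_ae_real (μ := uniforms)
    (fun k (u : ℕ → unitInterval) => S.indicator (1 : unitInterval → ℝ) (u k)) ?_ ?_ hident
  · have hint : ∫ u, S.indicator (1 : unitInterval → ℝ) (u 0) ∂uniforms = volume.real S := by
      have h1 : MeasurePreserving (fun u : ℕ → unitInterval => u 0) uniforms volume :=
        measurePreserving_eval_infinitePi _ 0
      have h2 : ∫ u, S.indicator (1 : unitInterval → ℝ) (u 0) ∂uniforms =
          ∫ x, S.indicator (1 : unitInterval → ℝ) x ∂(uniforms.map fun u => u 0) :=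
        (integral_map (measurable_pi_apply 0).aemeasurable hf.aestronglyMeasurable).symm
      rw [h2, h1.map_eq, integral_indicator_one hS]
    rw [hint] at h
    exact h
  · refine Integrable.of_bound ((hf.comp (measurable_pi_apply 0)).aestronglyMeasurable) 1 ?_
    refine Eventually.of_forall fun u => ?_
    by_cases hu : u 0 ∈ S <;> simp [hu]
  · intro i j hij
    exact (iIndepFun_infinitePi (P := fun _ : ℕ => (volume : Measure unitInterval))
      (X := fun _ => S.indicator (1 : unitInterval → ℝ)) fun _ => hf).indepFun hij

end Mixture

section Mixture

variable {Θ : Type*} [MeasurableSpace Θ] {π : Measure Θ}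
  {p : Θ → ℕ → ℝ} {cap : (ℕ → ℕ) → ℕ → ℕ}

theorem measurable_selectProb (hp : ∀ j, Measurable fun θ => p θ j) (m j : ℕ) :
    Measurable fun θ => selectProb (p θ) m j := by
  unfold selectProb
  split_ifs
  · exact hp j
  · exact measurable_const.sub (Finset.measurable_fun_sum _ fun i _ => hp i)
  · exact measurable_const

/-- The frequency with which a colour is selected tends to its probability. -/
theorem ae_tendsto_select (hp : ∀ j, Measurable fun θ => p θ j)
    (hsub : ∀ᵐ θ ∂π, IsSubprob (p θ)) :
    ∀ᵐ x ∂π.prod uniforms, ∀ m j, Tendsto (fun n : ℕ =>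
      (((Finset.range n).filter fun k => select (p x.1) (x.2 k) m = j).card : ℝ) / n) atTop
      (𝓝 (selectProb (p x.1) m j)) := by
  rw [ae_all_iff]
  intro m
  rw [ae_all_iff]
  intro j
  have hmeas : MeasurableSet {x : Θ × (ℕ → unitInterval) | Tendsto (fun n : ℕ =>
      (((Finset.range n).filter fun k => select (p x.1) (x.2 k) m = j).card : ℝ) / n) atTop
      (𝓝 (selectProb (p x.1) m j))} := by
    refine measurableSet_tendsto_fun (fun n => ?_) ((measurable_selectProb hp m j).comp
      measurable_fst)
    simp only [Finset.card_filter, Nat.cast_sum]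
    refine (Finset.measurable_fun_sum _ fun k _ => ?_).div_const _
    exact (measurable_from_nat (f := fun i => (((if i = j then 1 else 0 : ℕ)) : ℝ))).comp
      (measurable_select hp k m)
  rw [Measure.ae_prod_iff_ae_ae hmeas]
  filter_upwards [hsub] with θ hθ
  have hS : MeasurableSet {u : unitInterval | select (p θ) u m = j} := by
    have h := measurable_select (p := p) hp 0 m (measurableSet_singleton j)
    exact measurable_prodMk_left (x := θ) |>.comp
      (measurable_pi_lambda (fun u : unitInterval => fun _ : ℕ => u) fun _ => measurable_id) h
  filter_upwards [ae_tendsto_frequency hS] with u hu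
  have h1 : volume.real {u : unitInterval | select (p θ) u m = j} = selectProb (p θ) m j := by
    rw [Measure.real, hθ.volume_select, ENNReal.toReal_ofReal]
    rw [selectProb]
    split_ifs
    · exact hθ.1 j
    · linarith [hθ.2 m]
    · exact le_rfl
  rw [h1] at hu
  refine hu.congr fun n => ?_
  rw [Finset.card_filter, Nat.cast_sum]
  congr 1
  refine Finset.sum_congr rfl fun k _ => ?_
  by_cases h : select (p θ) (u k) m = j <;> simp [Set.indicator, h]

/-- With a constant number of colours, the frequency of each colour tends to its probability. -/
theorem ae_tendsto_mixedDraw_const (hp : ∀ j, Measurable fun θ => p θ j)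
    (hsub : ∀ᵐ θ ∂π, IsSubprob (p θ)) (m : ℕ) :
    ∀ᵐ x ∂π.prod uniforms, ∀ j, Tendsto (fun n : ℕ =>
      (tableSize (fun k => mixedDraw (fun _ _ => m) p k x) n j : ℝ) / n) atTop
      (𝓝 (selectProb (p x.1) m j)) := by
  filter_upwards [ae_tendsto_select hp hsub] with x hx j
  refine (hx m j).congr fun n => ?_
  rw [tableSize]
  have : ∀ k, mixedDraw (fun _ _ => m) p k x = select (p x.1) (x.2 k) m := fun k =>
    draw_eq (fun _ _ _ _ => rfl) _ _ _
  simp only [this]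

theorem isAdapted_numTables : IsAdapted numTables := fun _ _ _ h => numTables_congr h

/-- The interval of the colour `j` does not depend on the number of available colours, once it
exceeds `j`. -/
theorem select_eq_iff_of_lt {q : ℕ → ℝ} (hq : ∀ j, 0 ≤ q j) {u : ℝ} (hu : 0 ≤ u) {m m' j : ℕ}
    (hm : j < m) (hm' : j < m') : select q u m = j ↔ select q u m' = j := by
  rw [select_eq_iff hq hu, select_eq_iff hq hu]
  simp [hm, hm', hm.ne, hm'.ne]

theorem select_le (q : ℕ → ℝ) (u : ℝ) (m : ℕ) : select q u m ≤ m := by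
  induction m with
  | zero => exact le_rfl
  | succ m ih => rw [select]; split_ifs <;> omega

section Restaurant

variable {q : ℕ → ℝ} {u : ℕ → ℝ}

theorem draw_le_numTables (n : ℕ) :
    draw numTables q u n ≤ numTables (draw numTables q u) n := by
  conv_lhs => rw [draw_eq isAdapted_numTables]
  exact select_le _ _ _

theorem isRG_draw (n : ℕ) : IsRG (draw numTables q u) n := fun k _ => draw_le_numTables k

/-- If every colour has a chance of being exceeded, then the number of tables tends to infinity. -/
theorem tendsto_numTables_draw
    (hinf : ∀ m, ∃ᶠ k in atTop, select q (u k) m = m) :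
    Tendsto (numTables (draw numTables q u)) atTop atTop := by
  set c := draw numTables q u with hc
  have hmono : Monotone (numTables c) := fun _ _ h => numTables_mono c h
  rcases tendsto_atTop_of_monotone hmono with h | ⟨l, hl⟩
  · exact h
  · exfalso
    have hl' : ∀ᶠ n in atTop, numTables c n = l := by
      simpa using (nhds_discrete ℕ ▸ hl : Tendsto (numTables c) atTop (pure l))
    obtain ⟨N, hN⟩ := eventually_atTop.1 hl'
    obtain ⟨k, hk, hkN⟩ := ((hinf l).and_eventually (eventually_ge_atTop N)).exists
    have h1 : c k = l := by
      rw [hc, draw_eq isAdapted_numTables, ← hc, hN k hkN, hk]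
    have h2 : tableSize c k (c k) = 0 := (isRG_draw k).tableSize_eq_zero (by
      rw [h1]; exact (hN k hkN).le)
    have h3 := numTables_succ c k
    rw [if_pos h2, hN k hkN, hN (k + 1) (by omega)] at h3
    omega

/-- Once the table `j` is open, it is chosen exactly when `select · · (j + 1)` gives `j`. -/
theorem tendsto_tableSize_draw (hq : ∀ j, 0 ≤ q j) (hu : ∀ k, 0 ≤ u k)
    (hinf : Tendsto (numTables (draw numTables q u)) atTop atTop) {j : ℕ} {l : ℝ}
    (h : Tendsto (fun n : ℕ =>
      (((Finset.range n).filter fun k => select q (u k) (j + 1) = j).card : ℝ) / n) atTop (𝓝 l)) :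
    Tendsto (fun n : ℕ => (tableSize (draw numTables q u) n j : ℝ) / n) atTop (𝓝 l) := by
  set c := draw numTables q u with hc
  set s : ℕ → ℕ := fun n => ((Finset.range n).filter fun k => select q (u k) (j + 1) = j).card
    with hs
  have hs_succ : ∀ n, s (n + 1) = s n + if select q (u n) (j + 1) = j then 1 else 0 := by
    intro n
    simp only [hs]
    rw [Finset.range_add_one, Finset.filter_insert]
    split_ifs with h
    · rw [Finset.card_insert_of_notMem (by simp)]
    · rfl
  obtain ⟨N, hN⟩ := eventually_atTop.1 (hinf.eventually_gt_atTop j)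
  have key : ∀ n, N ≤ n → (tableSize c n j : ℝ) = s n + ((tableSize c N j : ℝ) - s N) := by
    intro n hn
    induction n, hn using Nat.le_induction with
    | base => ring
    | succ n hn ih =>
      have h1 : c n = j ↔ select q (u n) (j + 1) = j := by
        rw [hc, draw_eq isAdapted_numTables, ← hc]
        exact select_eq_iff_of_lt hq (hu n) (hN n hn) j.lt_succ_self
      rw [tableSize_succ, hs_succ]
      push_cast
      rw [ih]
      simp only [h1]
      ring
  have h2 : Tendsto (fun n : ℕ => (s n : ℝ) / n + ((tableSize c N j : ℝ) - s N) / n) atTop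
      (𝓝 (l + 0)) :=
    h.add (tendsto_const_div_atTop_nhds_zero_nat _)
  rw [add_zero] at h2
  refine h2.congr' ?_
  filter_upwards [eventually_ge_atTop N] with n hn
  rw [key n hn, add_div]

end Restaurant

/-- In the mixture, the number of tables tends to infinity, and the frequencies of the tables tend
to the mixing frequencies. -/
theorem ae_tendsto_mixedDraw_numTables (hp : ∀ j, Measurable fun θ => p θ j)
    (hsub : ∀ᵐ θ ∂π, IsSubprob (p θ))
    (hlt : ∀ᵐ θ ∂π, ∀ m, ∑ i ∈ Finset.range m, p θ i < 1) :
    ∀ᵐ x ∂π.prod uniforms,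
      Tendsto (numTables fun k => mixedDraw numTables p k x) atTop atTop ∧
      ∀ j, Tendsto (fun n : ℕ =>
        (tableSize (fun k => mixedDraw numTables p k x) n j : ℝ) / n) atTop (𝓝 (p x.1 j)) := by
  have hfst : Tendsto Prod.fst (ae (π.prod uniforms)) (ae π) :=
    Measure.quasiMeasurePreserving_fst.tendsto_ae
  filter_upwards [ae_tendsto_select hp hsub, hfst.eventually hsub, hfst.eventually hlt]
    with x hx hsubx hltx
  have h1 : Tendsto (numTables fun k => mixedDraw numTables p k x) atTop atTop := by
    refine tendsto_numTables_draw fun m hm => ?_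
    -- if `m` were selected finitely often, its frequency would vanish
    have h2 := hx m m
    have h3 : 0 < selectProb (p x.1) m m := by
      rw [selectProb, if_neg (lt_irrefl _), if_pos rfl]
      linarith [hltx m]
    obtain ⟨N, hN⟩ := eventually_atTop.1 hm
    have h4 : Tendsto (fun n : ℕ =>
        (((Finset.range n).filter fun k => select (p x.1) (x.2 k) m = m).card : ℝ) / n) atTop
        (𝓝 0) := by
      refine squeeze_zero (fun n => by positivity) (fun n => ?_)
        (tendsto_const_div_atTop_nhds_zero_nat (N : ℝ))
      have h5 : ((Finset.range n).filter fun k => select (p x.1) (x.2 k) m = m).card ≤ N := by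
        calc _ ≤ (Finset.range N).card := Finset.card_le_card fun k hk => by
              rw [Finset.mem_filter] at hk
              by_contra hkN
              exact hN k (by simpa using hkN) hk.2
          _ = N := Finset.card_range N
      gcongr
    linarith [tendsto_nhds_unique h2 h4]
  refine ⟨h1, fun j => ?_⟩
  refine tendsto_tableSize_draw hsubx.1 (fun k => (x.2 k).2.1) h1 ?_
  have h2 := hx (j + 1) j
  rwa [selectProb, if_pos j.lt_succ_self] at h2

end Mixture

/-! ### Equality in law and transfer of limits -/

theorem measurable_tableSize (n j : ℕ) : Measurable fun c : ℕ → ℕ => tableSize c n j := by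
  unfold tableSize
  simp only [Finset.card_filter]
  exact Finset.measurable_fun_sum _ fun k _ =>
    (measurable_from_nat (f := fun i => if i = j then 1 else 0)).comp (measurable_pi_apply k)

section Transfer

variable {Ω Ω' : Type*} [MeasurableSpace Ω] [MeasurableSpace Ω'] {P : Measure Ω} {P' : Measure Ω'}

/-- The law of a sequence of natural numbers is determined by the probabilities of its initial
segments. -/
theorem map_eq_map_of_forall_past [IsProbabilityMeasure P] [IsProbabilityMeasure P']
    {X : ℕ → Ω → ℕ} {Y : ℕ → Ω' → ℕ}
    (hX : ∀ n, Measurable (X n)) (hY : ∀ n, Measurable (Y n))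
    (h : ∀ n (c : ℕ → ℕ), P {ω | ∀ k < n, X k ω = c k} = P' {ω | ∀ k < n, Y k ω = c k}) :
    P.map (fun ω k => X k ω) = P'.map (fun ω k => Y k ω) := by
  have hX' : Measurable fun ω k => X k ω := measurable_pi_lambda _ hX
  have hY' : Measurable fun ω k => Y k ω := measurable_pi_lambda _ hY
  have := Measure.isProbabilityMeasure_map (μ := P) hX'.aemeasurable
  have := Measure.isProbabilityMeasure_map (μ := P') hY'.aemeasurable
  -- the cylinders fixing an initial segment form a generating `π`-system
  let C : Set (Set (ℕ → ℕ)) := {s | ∃ (n : ℕ) (c : ℕ → ℕ), s = {f | ∀ k < n, f k = c k}}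
  have hCm : ∀ s ∈ C, MeasurableSet s := by
    rintro _ ⟨n, c, rfl⟩
    simp only [Set.ofPred_forall]
    exact MeasurableSet.iInter fun k => MeasurableSet.iInter fun _ =>
      measurable_pi_apply k (measurableSet_singleton _)
  refine ext_of_generate_finite C ?_ ?_ ?_ ?_
  · refine le_antisymm ?_ (MeasurableSpace.generateFrom_le hCm)
    refine iSup_le fun i => ?_
    rintro _ ⟨s, -, rfl⟩
    have hs : (fun f : ℕ → ℕ => f i) ⁻¹' s =
        ⋃ (g : Fin (i + 1) → ℕ) (_ : g (Fin.last i) ∈ s),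
          {f | ∀ k < i + 1, f k = if hk : k < i + 1 then g ⟨k, hk⟩ else 0} := by
      ext f
      simp only [Set.mem_preimage, Set.mem_iUnion, Set.mem_ofPred_eq]
      constructor
      · intro hf
        exact ⟨fun k => f k, hf, fun k hk => by simp [hk]⟩
      · rintro ⟨g, hg, hf⟩
        have := hf i (by omega)
        rw [dif_pos (by omega)] at this
        rw [this]
        exact hg
    rw [hs]
    exact MeasurableSet.iUnion fun g => MeasurableSet.iUnion fun _ =>
      MeasurableSpace.measurableSet_generateFrom ⟨i + 1, _, rfl⟩
  · rintro _ ⟨n, c, rfl⟩ _ ⟨m, d, rfl⟩ ⟨f, hf1, hf2⟩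
    refine ⟨max n m, f, ?_⟩
    ext g
    simp only [Set.mem_inter_iff, Set.mem_ofPred_eq] at hf1 hf2 ⊢
    constructor
    · rintro ⟨h1, h2⟩ k hk
      rcases lt_max_iff.1 hk with hk | hk
      · rw [h1 k hk, hf1 k hk]
      · rw [h2 k hk, hf2 k hk]
    · intro h1
      exact ⟨fun k hk => by rw [h1 k (lt_max_of_lt_left hk), hf1 k hk],
        fun k hk => by rw [h1 k (lt_max_of_lt_right hk), hf2 k hk]⟩
  · rintro s hs
    rw [Measure.map_apply hX' (hCm s hs), Measure.map_apply hY' (hCm s hs)]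
    obtain ⟨n, c, rfl⟩ := hs
    exact h n c
  · simp

/-- Almost sure convergence, and the law of the limit, depend on the law of a sequence only. -/
theorem exists_limit_of_map_eq {S B : Type*} [MeasurableSpace S] [MeasurableSpace B]
    [TopologicalSpace B] [TopologicalSpace.IsCompletelyMetrizableSpace B]
    [SecondCountableTopology B] [BorelSpace B]
    {X : Ω → S} {Y : Ω' → S} (hX : Measurable X) (hY : Measurable Y)
    (hXY : P.map X = P'.map Y) {F : ℕ → S → B} (hF : ∀ n, Measurable (F n)) {Z : Ω' → B}
    (hZ : ∀ᵐ ω ∂P', Tendsto (fun n => F n (Y ω)) atTop (𝓝 (Z ω))) :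
    ∃ Q : Ω → B, HasLaw Q (P'.map Z) P ∧
      ∀ᵐ ω ∂P, Tendsto (fun n => F n (X ω)) atTop (𝓝 (Q ω)) := by
  have h1 : ∀ᵐ s ∂P'.map Y, ∃ l, Tendsto (fun n => F n s) atTop (𝓝 l) := by
    rw [ae_map_iff hY.aemeasurable (measurableSet_exists_tendsto hF)]
    exact hZ.mono fun ω h => ⟨_, h⟩
  obtain ⟨G, hG, hlim⟩ := measurable_limit_of_tendsto_metrizable_ae
    (fun n => (hF n).aemeasurable) h1
  have h2 : ∀ᵐ ω ∂P', Tendsto (fun n => F n (Y ω)) atTop (𝓝 (G (Y ω))) :=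
    ae_of_ae_map hY.aemeasurable hlim
  have h3 : G ∘ Y =ᵐ[P'] Z := by
    filter_upwards [h2, hZ] with ω h h' using tendsto_nhds_unique h h'
  rw [← hXY] at hlim
  refine ⟨G ∘ X, ⟨(hG.comp hX).aemeasurable, ?_⟩, ae_of_ae_map hX.aemeasurable hlim⟩
  rw [← Measure.map_map hG hX, hXY, Measure.map_map hG hY]
  exact Measure.map_congr h3

end Transfer

/-! ### Beta moments and stick breaking -/

/-- The moment `∫ x ^ r * (1 - x) ^ s` of the distribution `Beta(A, B)`. -/
noncomputable def betaMoment (A B : ℝ) (r s : ℕ) : ℝ := beta (A + r) (B + s) / beta A B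

theorem beta_add_one_left {x y : ℝ} (hx : 0 < x) (hy : 0 < y) :
    beta (x + 1) y = beta x y * (x / (x + y)) := by
  have h : x + 1 + y = (x + y) + 1 := by ring
  have h1 := Real.Gamma_pos_of_pos (add_pos hx hy)
  rw [beta, beta, h, Real.Gamma_add_one hx.ne', Real.Gamma_add_one (add_pos hx hy).ne']
  field_simp

theorem beta_add_one_right {x y : ℝ} (hx : 0 < x) (hy : 0 < y) :
    beta x (y + 1) = beta x y * (y / (x + y)) := by
  have h : x + (y + 1) = (x + y) + 1 := by ring
  have h1 := Real.Gamma_pos_of_pos (add_pos hx hy)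
  rw [beta, beta, h, Real.Gamma_add_one hy.ne', Real.Gamma_add_one (add_pos hx hy).ne']
  field_simp

section BetaMoment

variable {A B : ℝ}

theorem betaMoment_nonneg (hA : 0 < A) (hB : 0 < B) (r s : ℕ) : 0 ≤ betaMoment A B r s :=
  (div_pos (beta_pos (by positivity) (by positivity)) (beta_pos hA hB)).le

theorem betaMoment_succ_left (hA : 0 < A) (hB : 0 < B) (r s : ℕ) :
    betaMoment A B (r + 1) s = betaMoment A B r s * ((A + r) / (A + B + r + s)) := by
  rw [betaMoment, betaMoment, Nat.cast_add_one, ← add_assoc,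
    beta_add_one_left (by positivity) (by positivity)]
  ring

theorem betaMoment_succ_right (hA : 0 < A) (hB : 0 < B) (r s : ℕ) :
    betaMoment A B r (s + 1) = betaMoment A B r s * ((B + s) / (A + B + r + s)) := by
  rw [betaMoment, betaMoment, Nat.cast_add_one, ← add_assoc,
    beta_add_one_right (by positivity) (by positivity)]
  ring

/-- The moments of the beta distribution, by a change of parameters in the density. -/
theorem lintegral_betaMeasure (hA : 0 < A) (hB : 0 < B) (r s : ℕ) :
    ∫⁻ x, ENNReal.ofReal (x ^ r * (1 - x) ^ s) ∂betaMeasure A B =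
      ENNReal.ofReal (betaMoment A B r s) := by
  have hA' : 0 < A + r := by positivity
  have hB' : 0 < B + s := by positivity
  have hb := beta_pos hA hB
  have hb' := beta_pos hA' hB'
  rw [betaMeasure, lintegral_withDensity_eq_lintegral_mul _ (by
    exact (measurable_betaPDFReal A B).ennreal_ofReal) (by fun_prop)]
  have h : ∀ x, (betaPDF A B * fun x => ENNReal.ofReal (x ^ r * (1 - x) ^ s)) x =
      ENNReal.ofReal (betaMoment A B r s) * betaPDF (A + r) (B + s) x := by
    intro x
    rw [Pi.mul_apply, betaPDF, betaPDF, ← ENNReal.ofReal_mul (betaMoment_nonneg hA hB r s),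
      betaPDFReal, betaPDFReal]
    split_ifs with hx
    · rw [← ENNReal.ofReal_mul (by
        have := sub_pos.2 hx.2
        have := hx.1
        positivity)]
      congr 1
      have h1 : x ^ (A + r - 1) = x ^ (A - 1) * x ^ r := by
        rw [← Real.rpow_natCast, ← Real.rpow_add hx.1]; ring_nf
      have h2 : (1 - x) ^ (B + s - 1) = (1 - x) ^ (B - 1) * (1 - x) ^ s := by
        rw [← Real.rpow_natCast, ← Real.rpow_add (sub_pos.2 hx.2)]; ring_nf
      rw [h1, h2, betaMoment]
      field_simp
    · simp
  simp_rw [h]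
  rw [lintegral_const_mul' _ _ ENNReal.ofReal_ne_top, lintegral_betaPDF_eq_one hA' hB', mul_one]

theorem ae_betaMeasure_mem : ∀ᵐ x ∂betaMeasure A B, 0 < x ∧ x < 1 := by
  have hm : Measurable (betaPDF A B) := (measurable_betaPDFReal A B).ennreal_ofReal
  rw [betaMeasure, ae_withDensity_iff hm]
  refine Eventually.of_forall fun x hx => ?_
  by_contra h
  exact hx (by rw [betaPDF, betaPDFReal, if_neg h, ENNReal.ofReal_zero])

end BetaMoment

theorem sum_stickBreaking (w : ℕ → ℝ) (m : ℕ) :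
    ∑ i ∈ Finset.range m, stickBreaking w i = 1 - ∏ i ∈ Finset.range m, (1 - w i) := by
  induction m with
  | zero => simp
  | succ m ih =>
    rw [Finset.sum_range_succ, ih, Finset.prod_range_succ, stickBreaking]
    ring

section StickBreaking

variable {w : ℕ → ℝ} (hw : ∀ i, 0 < w i ∧ w i < 1)
include hw

theorem prod_one_sub_pos (m : ℕ) : 0 < ∏ i ∈ Finset.range m, (1 - w i) :=
  Finset.prod_pos fun i _ => sub_pos.2 (hw i).2

theorem stickBreaking_pos (j : ℕ) : 0 < stickBreaking w j :=
  mul_pos (prod_one_sub_pos hw j) (hw j).1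

theorem sum_stickBreaking_lt (m : ℕ) : ∑ i ∈ Finset.range m, stickBreaking w i < 1 := by
  rw [sum_stickBreaking]
  linarith [prod_one_sub_pos hw m]

theorem isSubprob_stickBreaking : IsSubprob (stickBreaking w) :=
  ⟨fun j => (stickBreaking_pos hw j).le, fun m => (sum_stickBreaking_lt hw m).le⟩

theorem selectProb_stickBreaking_nonneg (m j : ℕ) : 0 ≤ selectProb (stickBreaking w) m j := by
  rw [selectProb]
  split_ifs
  · exact (stickBreaking_pos hw j).le
  · linarith [sum_stickBreaking_lt hw m]
  · exact le_rfl

end StickBreaking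

/-! ### The Chinese restaurant process as a mixture -/

/-- The number of customers among the first `n` at the tables after table `j`. -/
def countAbove (c : ℕ → ℕ) (n j : ℕ) : ℕ := ((Finset.range n).filter (fun k => j < c k)).card

theorem countAbove_succ (c : ℕ → ℕ) (n j : ℕ) :
    countAbove c (n + 1) j = countAbove c n j + if j < c n then 1 else 0 := by
  unfold countAbove
  rw [Finset.range_add_one, Finset.filter_insert]
  split_ifs with h
  · rw [Finset.card_insert_of_notMem (by simp)]
  · rfl

theorem tableSize_add_countAbove_succ (c : ℕ → ℕ) (n j : ℕ) :
    tableSize c n (j + 1) + countAbove c n (j + 1) = countAbove c n j := by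
  induction n with
  | zero => rfl
  | succ n ih =>
    rw [countAbove_succ, countAbove_succ, tableSize_succ]
    split_ifs <;> omega

theorem tableSize_add_countAbove_zero (c : ℕ → ℕ) (n : ℕ) :
    tableSize c n 0 + countAbove c n 0 = n := by
  induction n with
  | zero => rfl
  | succ n ih =>
    rw [countAbove_succ, tableSize_succ]
    split_ifs <;> omega

theorem numTables_le (c : ℕ → ℕ) (n : ℕ) : numTables c n ≤ n :=
  Finset.card_image_le.trans_eq (Finset.card_range n)

/-- The effect of one customer on a product over the tables, whose factors depend on the number of
customers at the table other than the first one, and on the number of customers at later tables. -/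
theorem prod_tables_succ {F : ℕ → ℕ → ℕ → ℝ} {v : ℕ → ℝ} {x : ℝ} {c : ℕ → ℕ} {n J : ℕ}
    (hc : IsRG c (n + 1)) (hJ : n < J)
    (hv : ∀ j < c n, F j (tableSize c n j - 1) (countAbove c n j + 1) =
      F j (tableSize c n j - 1) (countAbove c n j) * v j)
    (hx : c n < numTables c n → F (c n) (tableSize c n (c n) - 1 + 1) (countAbove c n (c n)) =
      F (c n) (tableSize c n (c n) - 1) (countAbove c n (c n)) * x) :
    ∏ j ∈ Finset.range J, F j (tableSize c (n + 1) j - 1) (countAbove c (n + 1) j) =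
      (∏ j ∈ Finset.range J, F j (tableSize c n j - 1) (countAbove c n j)) *
        ((∏ j ∈ Finset.range (c n), v j) * if c n < numTables c n then x else 1) := by
  have hcn := isRG_succ.1 hc
  have hle : c n ≤ n := hcn.2.trans (numTables_le c n)
  have h1 : ∏ j ∈ Finset.range (c n), v j =
      ∏ j ∈ Finset.range J, if j < c n then v j else 1 := by
    rw [← Finset.prod_filter]
    congr 1
    ext j
    simp only [Finset.mem_range, Finset.mem_filter]
    omega
  have h2 : (if c n < numTables c n then x else 1) =
      ∏ j ∈ Finset.range J, if j = c n then (if c n < numTables c n then x else 1) else 1 := by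
    rw [Finset.prod_ite_eq' , if_pos (Finset.mem_range.2 (by omega))]
  rw [h1, h2, ← Finset.prod_mul_distrib, ← Finset.prod_mul_distrib]
  refine Finset.prod_congr rfl fun j _ => ?_
  rw [tableSize_succ, countAbove_succ]
  rcases lt_trichotomy j (c n) with h | h | h
  · rw [if_neg h.ne', if_pos h, if_pos h, if_neg h.ne, add_zero, mul_one, hv j h]
  · subst h
    rw [if_pos rfl, if_neg (lt_irrefl _), if_neg (lt_irrefl _), if_pos rfl, add_zero, one_mul]
    split_ifs with h
    · have := hcn.1.tableSize_pos.2 h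
      rw [← hx h, Nat.sub_add_comm this]
    · rw [hcn.1.tableSize_eq_zero (by omega), mul_one]
  · rw [if_neg h.ne, if_neg h.not_gt, if_neg h.not_gt, if_neg h.ne', add_zero, add_zero, mul_one,
      mul_one]

/-- With stick-breaking frequencies, the probability of a seating is a product over the tables: the
fraction `w j` is chosen by each customer at table `j` except the first one, and rejected by each
customer at a later table. -/
theorem prod_selectProb_stickBreaking (w : ℕ → ℝ) {c : ℕ → ℕ} {n J : ℕ} (hc : IsRG c n)
    (hJ : n ≤ J) :
    ∏ k ∈ Finset.range n, selectProb (stickBreaking w) (numTables c k) (c k) =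
      ∏ j ∈ Finset.range J, w j ^ (tableSize c n j - 1) * (1 - w j) ^ countAbove c n j := by
  induction n with
  | zero => simp [countAbove]
  | succ n ih =>
    rw [Finset.prod_range_succ, ih (hc.mono n.le_succ) (by omega),
      prod_tables_succ (F := fun j r s => w j ^ r * (1 - w j) ^ s) (v := fun j => 1 - w j)
        (x := w (c n)) hc hJ (fun j _ => by ring) (fun _ => by ring)]
    congr 1
    have hcn := (isRG_succ.1 hc).2
    rw [selectProb]
    split_ifs with h1 h2
    · rfl
    · rw [sum_stickBreaking, ← h2]; ring
    · omega

section Seating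

variable {a θ : ℝ}

/-- The parameters of the beta distributions in `GEM(a, θ)` are such that the one-customer ratios of
beta moments form a telescoping product, whose value is the seating probability. -/
theorem prod_betaMoment_succ (ha : 0 ≤ a) (ha' : a < 1) (hθ : -a < θ) {c : ℕ → ℕ} {n J : ℕ}
    (hn : 1 ≤ n) (hc : IsRG c (n + 1)) (hJ : n < J) :
    ∏ j ∈ Finset.range J, betaMoment (1 - a) (θ + ((j : ℝ) + 1) * a) (tableSize c (n + 1) j - 1)
        (countAbove c (n + 1) j) =
      (∏ j ∈ Finset.range J, betaMoment (1 - a) (θ + ((j : ℝ) + 1) * a) (tableSize c n j - 1)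
        (countAbove c n j)) * crpProb a θ c n (c n) := by
  have hA : 0 < 1 - a := by linarith
  have hB : ∀ j : ℕ, 0 < θ + ((j : ℝ) + 1) * a := fun j => by
    have : 0 ≤ (j : ℝ) * a := by positivity
    linarith
  have hRG := isRG_succ.1 hc
  -- `N j` customers sit at table `j` or later; `D j` is the sum of the updated beta parameters
  set N : ℕ → ℝ := fun j => tableSize c n j + countAbove c n j with hN
  set D : ℕ → ℝ := fun j => θ + j * a + N j with hD
  have hN0 : N 0 = n := by
    simp only [hN]; exact_mod_cast tableSize_add_countAbove_zero c n
  have hNs : ∀ j, N (j + 1) = countAbove c n j := fun j => by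
    simp only [hN]; exact_mod_cast tableSize_add_countAbove_succ c n j
  have hsize : ∀ j < numTables c n, ((tableSize c n j - 1 : ℕ) : ℝ) = tableSize c n j - 1 :=
    fun j hj => by
      rw [Nat.cast_sub (hRG.1.tableSize_pos.2 hj), Nat.cast_one]
  have hsum : ∀ j < numTables c n, 1 - a + (θ + ((j : ℝ) + 1) * a) +
      (tableSize c n j - 1 : ℕ) + countAbove c n j = D j := fun j hj => by
    rw [hsize j hj]; simp only [hD, hN]; ring
  have hD0 : 0 < D 0 := by
    have : (1 : ℝ) ≤ n := by exact_mod_cast hn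
    simp only [hD]; rw [hN0]
    simp only [Nat.cast_zero, zero_mul, add_zero]; linarith
  have hDs : ∀ j, 0 < D (j + 1) := fun j => by
    have := hB j
    have h2 : (0 : ℝ) ≤ countAbove c n j := by positivity
    simp only [hD]; rw [hNs]; push_cast; linarith
  have hDpos : ∀ j, 0 < D j := fun j => by
    cases j with
    | zero => exact hD0
    | succ j => exact hDs j
  rw [prod_tables_succ
    (F := fun j r s => betaMoment (1 - a) (θ + ((j : ℝ) + 1) * a) r s)
    (v := fun j => D (j + 1) / D j) (x := (tableSize c n (c n) - a) / D (c n)) hc hJ]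
  · congr 1
    have htel : ∏ j ∈ Finset.range (c n), D (j + 1) / D j = D (c n) / D 0 := by
      generalize c n = m
      induction m with
      | zero => simp [hD0.ne']
      | succ m ih =>
        rw [Finset.prod_range_succ, ih]
        have := (hDpos m).ne'
        field_simp
    have hD0' : D 0 = n + θ := by simp only [hD]; rw [hN0]; push_cast; ring
    rw [htel, crpProb, hD0']
    rw [hD0'] at hD0
    split_ifs with h1 h2
    · have := (hDpos (c n)).ne'
      field_simp
    · have h3 : N (c n) = 0 := by
        have h4 : tableSize c n (c n) = 0 := hRG.1.tableSize_eq_zero h2.ge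
        have h5 : countAbove c n (c n) = 0 := by
          rw [countAbove, Finset.card_eq_zero, Finset.filter_eq_empty_iff]
          intro k hk
          have := hRG.1.lt_numTables (Finset.mem_range.1 hk)
          omega
        simp only [hN]; rw [h4, h5]; simp
      simp only [hD]; rw [h3, ← h2]; ring
    · omega
  · intro j hj
    rw [betaMoment_succ_right hA (hB j), hsum j (by omega)]
    congr 2
    simp only [hD]; rw [hNs]; push_cast; ring
  · intro h
    rw [betaMoment_succ_left hA (hB _), hsum _ h, hsize _ h]
    congr 2
    ring

variable {Ω : Type*} [MeasurableSpace Ω] {P : Measure Ω} [IsProbabilityMeasure P]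

/-- The law of independent stick-breaking fractions. -/
noncomputable abbrev stickLaw (a θ : ℝ) : Measure (ℕ → ℝ) :=
  Measure.infinitePi fun j : ℕ => betaMeasure (1 - a) (θ + ((j : ℝ) + 1) * a)

theorem isProbabilityMeasure_betaMeasure_stick (ha : 0 ≤ a) (ha' : a < 1) (hθ : -a < θ) (j : ℕ) :
    IsProbabilityMeasure (betaMeasure (1 - a) (θ + ((j : ℝ) + 1) * a)) :=
  isProbabilityMeasureBeta (by linarith) (by
    have : 0 ≤ (j : ℝ) * a := by positivity
    linarith)

theorem ae_stickLaw_mem (ha : 0 ≤ a) (ha' : a < 1) (hθ : -a < θ) :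
    ∀ᵐ w ∂stickLaw a θ, ∀ i, 0 < w i ∧ w i < 1 := by
  have := isProbabilityMeasure_betaMeasure_stick ha ha' hθ
  rw [ae_all_iff]
  intro i
  exact (measurePreserving_eval_infinitePi
    (fun j : ℕ => betaMeasure (1 - a) (θ + ((j : ℝ) + 1) * a)) i).quasiMeasurePreserving.ae
    ae_betaMeasure_mem

/-- Since the fractions are independent, the mean probability of a seating is a product of beta
moments. -/
theorem lintegral_prod_selectProb (ha : 0 ≤ a) (ha' : a < 1) (hθ : -a < θ) {c : ℕ → ℕ} {n J : ℕ}
    (hc : IsRG c n) (hJ : n ≤ J) :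
    ∫⁻ w, ∏ k ∈ Finset.range n,
        ENNReal.ofReal (selectProb (stickBreaking w) (numTables c k) (c k)) ∂stickLaw a θ =
      ENNReal.ofReal (∏ j ∈ Finset.range J, betaMoment (1 - a) (θ + ((j : ℝ) + 1) * a)
        (tableSize c n j - 1) (countAbove c n j)) := by
  have := isProbabilityMeasure_betaMeasure_stick ha ha' hθ
  have hA : 0 < 1 - a := by linarith
  have hB : ∀ j : ℕ, 0 < θ + ((j : ℝ) + 1) * a := fun j => by
    have : 0 ≤ (j : ℝ) * a := by positivity
    linarith
  have h1 : ∀ᵐ w ∂stickLaw a θ, ∏ k ∈ Finset.range n,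
      ENNReal.ofReal (selectProb (stickBreaking w) (numTables c k) (c k)) =
      ∏ j ∈ Finset.range J,
        ENNReal.ofReal (w j ^ (tableSize c n j - 1) * (1 - w j) ^ countAbove c n j) := by
    filter_upwards [ae_stickLaw_mem ha ha' hθ] with w hw
    rw [← ENNReal.ofReal_prod_of_nonneg fun _ _ => selectProb_stickBreaking_nonneg hw _ _,
      prod_selectProb_stickBreaking w hc hJ, ENNReal.ofReal_prod_of_nonneg]
    intro j _
    have := (hw j).1
    have := sub_pos.2 (hw j).2
    positivity
  rw [lintegral_congr_ae h1]
  have hmeas : ∀ j, Measurable fun x : ℝ =>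
      ENNReal.ofReal (x ^ (tableSize c n j - 1) * (1 - x) ^ countAbove c n j) := fun j => by
    fun_prop
  rw [lintegral_prod_eq_prod_lintegral_of_indepFun (Finset.range J)
    (fun j (w : ℕ → ℝ) =>
      ENNReal.ofReal (w j ^ (tableSize c n j - 1) * (1 - w j) ^ countAbove c n j))
    (iIndepFun_infinitePi
      (P := fun j : ℕ => betaMeasure (1 - a) (θ + ((j : ℝ) + 1) * a)) hmeas)
    fun j => (hmeas j).comp (measurable_pi_apply j),
    ENNReal.ofReal_prod_of_nonneg fun j _ => betaMoment_nonneg hA (hB j) _ _]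
  refine Finset.prod_congr rfl fun j _ => ?_
  rw [← lintegral_betaMeasure hA (hB j)]
  exact (measurePreserving_eval_infinitePi
    (fun j : ℕ => betaMeasure (1 - a) (θ + ((j : ℝ) + 1) * a)) j).lintegral_comp (hmeas j)

/-- The Chinese restaurant process is a mixture of independent choices from stick-breaking
frequencies. -/
theorem IsCRP.measure_past (ha : 0 ≤ a) (ha' : a < 1) (hθ : -a < θ) {C : ℕ → Ω → ℕ}
    (hC : IsCRP P a θ C) (c : ℕ → ℕ) (n : ℕ) :
    P {ω | ∀ k < n, C k ω = c k} = ∫⁻ w, ∏ k ∈ Finset.range n,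
      ENNReal.ofReal (selectProb (stickBreaking w) (numTables c k) (c k)) ∂stickLaw a θ := by
  have := isProbabilityMeasure_betaMeasure_stick ha ha' hθ
  have hA : 0 < 1 - a := by linarith
  have hB : ∀ j : ℕ, 0 < θ + ((j : ℝ) + 1) * a := fun j => by
    have : 0 ≤ (j : ℝ) * a := by positivity
    linarith
  -- a sequence in which tables are not opened in order has probability zero
  have hzero : ∀ n, ¬ IsRG c n → ∫⁻ w, ∏ k ∈ Finset.range n,
      ENNReal.ofReal (selectProb (stickBreaking w) (numTables c k) (c k)) ∂stickLaw a θ = 0 := by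
    intro n hn
    have h0 : ∀ w, ∏ k ∈ Finset.range n,
        ENNReal.ofReal (selectProb (stickBreaking w) (numTables c k) (c k)) = 0 := by
      intro w
      unfold IsRG at hn
      push Not at hn
      obtain ⟨k, hk, hck⟩ := hn
      refine Finset.prod_eq_zero (Finset.mem_range.2 hk) ?_
      rw [selectProb, if_neg hck.not_gt, if_neg hck.ne', ENNReal.ofReal_zero]
    simp [h0]
  induction n with
  | zero => simp
  | succ n ih =>
    rcases Nat.eq_zero_or_pos n with rfl | hn
    · have h1 : {ω | ∀ k < 0 + 1, C k ω = c k} =ᵐ[P] {ω | 0 = c 0} := by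
        filter_upwards [hC.init] with ω hω
        have : (∀ k < 0 + 1, C k ω = c k) ↔ 0 = c 0 :=
          ⟨fun h => hω.symm.trans (h 0 one_pos), fun h k hk => by
            obtain rfl : k = 0 := by omega
            exact hω.trans h⟩
        exact propext this
      rw [measure_congr h1]
      by_cases h0 : c 0 = 0
      · simp [h0, selectProb]
      · have h2 : ¬ IsRG c (0 + 1) := fun h => h0 (by
          have := h 0 one_pos
          simpa using this)
        rw [hzero _ h2]
        simp [Ne.symm h0]
    · rw [setOf_forall_lt_succ, hC.step n hn c (c n), ih]
      by_cases hc : IsRG c (n + 1)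
      · rw [lintegral_prod_selectProb ha ha' hθ (hc.mono n.le_succ) n.le_succ,
          lintegral_prod_selectProb ha ha' hθ hc le_rfl,
          prod_betaMoment_succ ha ha' hθ hn hc n.lt_succ_self, ENNReal.ofReal_mul
            (Finset.prod_nonneg fun j _ => betaMoment_nonneg hA (hB j) _ _)]
        rfl
      · rw [hzero _ hc]
        by_cases hc' : IsRG c n
        · have h3 : numTables c n < c n := by
            by_contra h
            exact hc (isRG_succ.2 ⟨hc', by omega⟩)
          rw [if_neg h3.not_gt, if_neg h3.ne', ENNReal.ofReal_zero, mul_zero]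
        · rw [hzero _ hc', zero_mul]

/-- In a Chinese restaurant process, the number of tables tends to infinity, and the frequencies of
the tables converge to a `GEM` sequence. -/
theorem IsCRP.exists_frequencies (ha : 0 ≤ a) (ha' : a < 1) (hθ : -a < θ) {C : ℕ → Ω → ℕ}
    (hC : IsCRP P a θ C) :
    (∀ᵐ ω ∂P, Tendsto (numTables fun k => C k ω) atTop atTop) ∧
    ∃ Q : Ω → ℕ → ℝ, HasLaw Q (GEM a θ) P ∧ ∀ᵐ ω ∂P, Tendsto
      (fun (n : ℕ) (j : ℕ) => (tableSize (fun k => C k ω) n j : ℝ) / n) atTop (𝓝 (Q ω)) := by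
  have := isProbabilityMeasure_betaMeasure_stick ha ha' hθ
  have hp : ∀ j, Measurable fun w => stickBreaking w j := fun j =>
    (measurable_pi_apply j).comp measurable_stickBreaking
  have hmem := ae_stickLaw_mem ha ha' hθ
  have hsub : ∀ᵐ w ∂stickLaw a θ, IsSubprob (stickBreaking w) :=
    hmem.mono fun w hw => isSubprob_stickBreaking hw
  have hCm : Measurable fun ω k => C k ω := measurable_pi_lambda _ hC.measurable
  have hYm := measurable_mixedDraw (p := stickBreaking) isAdapted_numTables hp
  have hYm' : Measurable fun x k => mixedDraw numTables stickBreaking k x :=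
    measurable_pi_lambda _ hYm
  have hXY : P.map (fun ω k => C k ω) =
      ((stickLaw a θ).prod uniforms).map fun x k => mixedDraw numTables stickBreaking k x := by
    refine map_eq_map_of_forall_past hC.measurable hYm fun n c => ?_
    rw [hC.measure_past ha ha' hθ, measure_mixedDraw isAdapted_numTables hp hsub]
  have hlim := ae_tendsto_mixedDraw_numTables hp hsub
    (hmem.mono fun w hw => sum_stickBreaking_lt hw)
  constructor
  · have hnum : ∀ n, Measurable fun c : ℕ → ℕ => numTables c n := fun n => by
      induction n with
      | zero => exact measurable_const
      | succ n ih =>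
        simp only [numTables_succ]
        refine ih.add (Measurable.ite ?_ measurable_const measurable_const)
        have : {c : ℕ → ℕ | tableSize c n (c n) = 0} =
            ⋃ j, ({c | c n = j} ∩ {c | tableSize c n j = 0}) := by
          ext c; simp
        rw [this]
        have heval : Measurable fun c : ℕ → ℕ => c n := measurable_pi_apply n
        exact MeasurableSet.iUnion fun j =>
          MeasurableSet.inter (heval (measurableSet_singleton j))
            (measurable_tableSize n j (measurableSet_singleton 0))
    have hset : MeasurableSet {c : ℕ → ℕ | Tendsto (numTables c) atTop atTop} := by
      have : {c : ℕ → ℕ | Tendsto (numTables c) atTop atTop} =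
          ⋂ m, ⋃ n, {c | m ≤ numTables c n} := by
        ext c
        simp only [Set.mem_ofPred_eq, Set.mem_iInter, Set.mem_iUnion]
        exact ⟨fun h m => (h.eventually_ge_atTop m).exists,
          fun h => tendsto_atTop_atTop_of_monotone (numTables_mono c) h⟩
      rw [this]
      exact MeasurableSet.iInter fun m => MeasurableSet.iUnion fun n =>
        hnum n measurableSet_Ici
    have h1 : ∀ᵐ c ∂((stickLaw a θ).prod uniforms).map
        (fun x k => mixedDraw numTables stickBreaking k x),
        Tendsto (numTables c) atTop atTop := by
      rw [ae_map_iff hYm'.aemeasurable hset]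
      exact hlim.mono fun x hx => hx.1
    rw [← hXY] at h1
    exact ae_of_ae_map hCm.aemeasurable h1
  · obtain ⟨Q, hQ, hQlim⟩ := exists_limit_of_map_eq (B := ℕ → ℝ) hCm hYm' hXY
      (F := fun n c j => (tableSize c n j : ℝ) / n)
      (fun n => measurable_pi_lambda _ fun j =>
        ((measurable_from_nat (f := fun i => (i : ℝ))).comp (measurable_tableSize n j)).div_const _)
      (Z := fun x => stickBreaking x.1)
      (hlim.mono fun x hx => tendsto_pi_nhds.2 hx.2)
    refine ⟨Q, ?_, hQlim⟩
    have h2 : ((stickLaw a θ).prod uniforms).map (fun x => stickBreaking x.1) = GEM a θ := by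
      rw [show (fun x : (ℕ → ℝ) × (ℕ → unitInterval) => stickBreaking x.1) =
        stickBreaking ∘ Prod.fst from rfl, ← Measure.map_map measurable_stickBreaking
        measurable_fst, Measure.map_fst_prod, measure_univ, one_smul]
      rfl
    rwa [h2] at hQ

end Seating

/-! ### Moments of the Dirichlet distribution -/

theorem ae_gammaMeasure_pos (g r : ℝ) : ∀ᵐ y ∂gammaMeasure g r, 0 < y := by
  have hm : Measurable (gammaPDF g r) := (measurable_gammaPDFReal g r).ennreal_ofReal
  rw [gammaMeasure, ae_withDensity_iff hm]
  have h0 : ∀ᵐ y : ℝ, y ≠ 0 := by simp [ae_iff]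
  filter_upwards [h0] with y hy hpdf
  by_contra h
  exact hpdf (gammaPDF_of_neg (lt_of_le_of_ne (not_lt.1 h) hy))

/-- The Laplace transform of `y ^ m` with respect to the gamma distribution. -/
theorem lintegral_gammaMeasure {g : ℝ} (hg : 0 < g) (m : ℕ) {s : ℝ} (hs : 0 ≤ s) :
    ∫⁻ y, ENNReal.ofReal (y ^ m * Real.exp (-(s * y))) ∂gammaMeasure g 1 =
      ENNReal.ofReal (Real.Gamma (g + m) / Real.Gamma g) *
        ENNReal.ofReal ((1 + s) ^ (-(g + m))) := by
  have hgm : 0 < g + m := by positivity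
  have hm : Measurable (gammaPDF g 1) := (measurable_gammaPDFReal g 1).ennreal_ofReal
  rw [gammaMeasure, lintegral_withDensity_eq_lintegral_mul _ hm (by fun_prop)]
  have h0 : ∀ᵐ y : ℝ, y ≠ 0 := by simp [ae_iff]
  have h : (gammaPDF g 1 * fun y => ENNReal.ofReal (y ^ m * Real.exp (-(s * y)))) =ᵐ[volume]
      fun y => (ENNReal.ofReal (Real.Gamma (g + m) / Real.Gamma g) *
        ENNReal.ofReal ((1 + s) ^ (-(g + m)))) * gammaPDF (g + m) (1 + s) y := by
    filter_upwards [h0] with y hy0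
    rw [Pi.mul_apply, gammaPDF, gammaPDF]
    rcases lt_or_gt_of_ne hy0 with hy | hy
    · rw [gammaPDFReal, gammaPDFReal, if_neg (not_le.2 hy), if_neg (not_le.2 hy)]
      simp
    · have h1 : 0 < 1 + s := by linarith
      rw [← ENNReal.ofReal_mul (gammaPDFReal_nonneg hg one_pos y),
        ← ENNReal.ofReal_mul (by positivity), ← ENNReal.ofReal_mul (by positivity)]
      congr 1
      rw [gammaPDFReal, gammaPDFReal, if_pos hy.le, if_pos hy.le, Real.one_rpow,
        Real.rpow_neg h1.le]
      have h2 : y ^ (g + m - 1) = y ^ (g - 1) * y ^ m := by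
        rw [← Real.rpow_natCast, ← Real.rpow_add hy]; ring_nf
      have h3 : Real.exp (-((1 + s) * y)) = Real.exp (-(1 * y)) * Real.exp (-(s * y)) := by
        rw [← Real.exp_add]; ring_nf
      have h4 := (Real.Gamma_pos_of_pos hgm).ne'
      have h5 := (Real.rpow_pos_of_pos h1 (g + m)).ne'
      rw [h2, h3]
      field_simp
  rw [lintegral_congr_ae h, lintegral_const_mul' _ _
    (ENNReal.mul_ne_top ENNReal.ofReal_ne_top ENNReal.ofReal_ne_top),
    lintegral_gammaPDF_eq_one hgm (by linarith), mul_one]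

/-- The density `s ^ (n - 1) / Γ(n)` on `[0, ∞)`, whose Laplace transform at `S` is `S ^ (-n)`. -/
noncomputable def powerDensity (n : ℕ) (s : ℝ) : ℝ :=
  if 0 ≤ s then s ^ ((n : ℝ) - 1) / Real.Gamma n else 0

theorem measurable_powerDensity (n : ℕ) : Measurable (powerDensity n) :=
  Measurable.ite measurableSet_Ici (by fun_prop) measurable_const

theorem powerDensity_nonneg (n : ℕ) (s : ℝ) : 0 ≤ powerDensity n s := by
  unfold powerDensity
  split_ifs with h
  · have := Real.Gamma_nonneg_of_nonneg (Nat.cast_nonneg (α := ℝ) n)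
    positivity
  · exact le_rfl

section Dirichlet

variable {K : ℕ} {g : Fin K → ℝ}

/-- The power of the sum in the denominator is written as a Laplace transform; this makes the
integrand a product over the coordinates. -/
theorem prod_div_sum_pow {y : Fin K → ℝ} (hy : ∀ j, 0 < y j) {m : Fin K → ℕ}
    (hm : 0 < ∑ j, m j) :
    ∏ j, ENNReal.ofReal ((y j / ∑ i, y i) ^ m j) =
      ∫⁻ s, ENNReal.ofReal (powerDensity (∑ j, m j) s) *
        ∏ j, ENNReal.ofReal (y j ^ m j * Real.exp (-(s * y j))) := by
  have hK : (Finset.univ : Finset (Fin K)).Nonempty := by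
    by_contra h
    rw [Finset.not_nonempty_iff_eq_empty] at h
    rw [h] at hm
    simp at hm
  set n := ∑ j, m j with hn
  set S := ∑ i, y i with hS
  have hS0 : 0 < S := Finset.sum_pos (fun j _ => hy j) hK
  have hn' : (0 : ℝ) < n := by exact_mod_cast hm
  have h1 : ∏ j, ENNReal.ofReal ((y j / S) ^ m j) = ENNReal.ofReal (∏ j, (y j / S) ^ m j) :=
    (ENNReal.ofReal_prod_of_nonneg fun j _ => by have := hy j; positivity).symm
  have hpos : 0 ≤ ∏ j, (y j / S) ^ m j := Finset.prod_nonneg fun j _ => by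
    have := hy j
    positivity
  have h2 : ∀ s, ENNReal.ofReal (powerDensity n s) *
      ∏ j, ENNReal.ofReal (y j ^ m j * Real.exp (-(s * y j))) =
      ENNReal.ofReal (∏ j, (y j / S) ^ m j) * gammaPDF n S s := by
    intro s
    rw [← ENNReal.ofReal_prod_of_nonneg fun j _ => by have := hy j; positivity,
      ← ENNReal.ofReal_mul (powerDensity_nonneg n s), gammaPDF, ← ENNReal.ofReal_mul hpos]
    congr 1
    rw [powerDensity, gammaPDFReal]
    split_ifs with hs
    · rw [Finset.prod_mul_distrib, ← Real.exp_sum]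
      have h3 : ∑ j, -(s * y j) = -(S * s) := by
        rw [Finset.sum_neg_distrib, ← Finset.mul_sum, mul_comm]
      have h4 : ∏ j, (y j / S) ^ m j = (∏ j, y j ^ m j) / S ^ n := by
        simp only [div_pow]
        rw [Finset.prod_div_distrib, Finset.prod_pow_eq_pow_sum]
      rw [h3, h4, Real.rpow_natCast]
      field_simp
    · simp
  simp_rw [h1, h2]
  rw [lintegral_const_mul' _ _ ENNReal.ofReal_ne_top, lintegral_gammaPDF_eq_one hn' hS0, mul_one]

/-- The factor of the moments of a Dirichlet distribution of total mass `t` that depends on the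
total order `n` of the moment only. -/
noncomputable def momentFactor (t : ℝ) (n : ℕ) : ENNReal :=
  if n = 0 then 1 else ∫⁻ s, ENNReal.ofReal (powerDensity n s) *
    ENNReal.ofReal ((1 + s) ^ (-(t + n)))

/-- The factor `∏ Γ(g_j + m_j) / Γ(g_j)` of the moments of a Dirichlet distribution. -/
noncomputable def gammaRatio (g : Fin K → ℝ) (m : Fin K → ℕ) : ENNReal :=
  ∏ j, ENNReal.ofReal (Real.Gamma (g j + m j) / Real.Gamma (g j))

theorem ae_pi_gammaMeasure_pos (hg : ∀ j, 0 < g j) :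
    ∀ᵐ y ∂Measure.pi (fun j => gammaMeasure (g j) 1), ∀ j, 0 < y j := by
  have := fun j => isProbabilityMeasure_gammaMeasure (hg j) one_pos
  rw [ae_all_iff]
  intro j
  exact (measurePreserving_eval (fun j => gammaMeasure (g j) 1) j).quasiMeasurePreserving.ae
    (ae_gammaMeasure_pos _ _)

theorem measurable_normalize : Measurable fun (y : Fin K → ℝ) (j : Fin K) => y j / ∑ i, y i := by
  fun_prop

theorem isProbabilityMeasure_dirichlet (hg : ∀ j, 0 < g j) :
    IsProbabilityMeasure (dirichlet g) := by
  have := fun j => isProbabilityMeasure_gammaMeasure (hg j) one_pos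
  exact Measure.isProbabilityMeasure_map measurable_normalize.aemeasurable

/-- The moments of the Dirichlet distribution, up to the factor `momentFactor`. -/
theorem lintegral_dirichlet (hg : ∀ j, 0 < g j) (m : Fin K → ℕ) :
    ∫⁻ q, ∏ j, ENNReal.ofReal (q j ^ m j) ∂dirichlet g =
      gammaRatio g m * momentFactor (∑ j, g j) (∑ j, m j) := by
  have := fun j => isProbabilityMeasure_gammaMeasure (hg j) one_pos
  have := isProbabilityMeasure_dirichlet hg
  rcases Nat.eq_zero_or_pos (∑ j, m j) with h0 | hpos
  · have hm : ∀ j, m j = 0 := fun j => by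
      simpa using (Finset.sum_eq_zero_iff.1 h0) j (Finset.mem_univ j)
    have h1 : gammaRatio g m = 1 := by
      refine Finset.prod_eq_one fun j _ => ?_
      rw [hm, Nat.cast_zero, add_zero, div_self (Real.Gamma_pos_of_pos (hg j)).ne',
        ENNReal.ofReal_one]
    rw [h0, h1]
    simp [hm, momentFactor]
  · rw [dirichlet, lintegral_map (by fun_prop) measurable_normalize]
    have hmeas : ∀ s j, Measurable fun x : ℝ =>
        ENNReal.ofReal (x ^ m j * Real.exp (-(s * x))) := fun s j => by fun_prop
    rw [lintegral_congr_ae ((ae_pi_gammaMeasure_pos hg).mono fun y hy =>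
      prod_div_sum_pow hy hpos), lintegral_lintegral_swap]
    · rw [momentFactor, if_neg hpos.ne', gammaRatio, ← lintegral_const_mul']
      · refine lintegral_congr fun s => ?_
        rw [lintegral_const_mul' _ _ ENNReal.ofReal_ne_top]
        by_cases hs : 0 ≤ s
        · rw [lintegral_prod_eq_prod_lintegral_of_indepFun Finset.univ
            (fun j (y : Fin K → ℝ) => ENNReal.ofReal (y j ^ m j * Real.exp (-(s * y j))))
            (iIndepFun_pi (μ := fun j => gammaMeasure (g j) 1) fun j => (hmeas s j).aemeasurable)
            fun j => (hmeas s j).comp (measurable_pi_apply j)]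
          have h1 : ∀ j, ∫⁻ y : Fin K → ℝ, ENNReal.ofReal (y j ^ m j * Real.exp (-(s * y j)))
              ∂Measure.pi (fun j => gammaMeasure (g j) 1) =
              ENNReal.ofReal (Real.Gamma (g j + m j) / Real.Gamma (g j)) *
              ENNReal.ofReal ((1 + s) ^ (-(g j + m j))) := fun j => by
            rw [← lintegral_gammaMeasure (hg j) (m j) hs]
            exact (measurePreserving_eval (fun j => gammaMeasure (g j) 1) j).lintegral_comp
              (hmeas s j)
          simp_rw [h1]
          have h2 : 0 < 1 + s := by linarith
          rw [Finset.prod_mul_distrib, ← ENNReal.ofReal_prod_of_nonneg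
            (f := fun j => (1 + s) ^ (-(g j + m j))) fun j _ => by positivity,
            ← Real.rpow_sum_of_pos h2, Finset.sum_neg_distrib, Finset.sum_add_distrib]
          push_cast
          ring
        · rw [powerDensity, if_neg hs]
          simp
      · exact ENNReal.prod_ne_top fun j _ => ENNReal.ofReal_ne_top
    · refine Measurable.aemeasurable ?_
      refine ((measurable_powerDensity _).comp measurable_snd).ennreal_ofReal.mul ?_
      refine Finset.measurable_fun_prod _ fun j _ => ?_
      fun_prop

theorem ae_dirichlet (hg : ∀ j, 0 < g j) (hK : 0 < K) :
    ∀ᵐ q ∂dirichlet g, (∀ j, 0 < q j) ∧ ∑ j, q j = 1 := by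
  have hK' : (Finset.univ : Finset (Fin K)).Nonempty := ⟨⟨0, hK⟩, Finset.mem_univ _⟩
  have hmeas : MeasurableSet {q : Fin K → ℝ | (∀ j, 0 < q j) ∧ ∑ j, q j = 1} := by
    rw [Set.ofPred_and, Set.ofPred_forall]
    exact (MeasurableSet.iInter fun j => measurableSet_lt measurable_const
      (measurable_pi_apply j)).inter (measurableSet_eq_fun (by fun_prop) measurable_const)
  rw [dirichlet, ae_map_iff measurable_normalize.aemeasurable hmeas]
  filter_upwards [ae_pi_gammaMeasure_pos hg] with y hy
  have hS : 0 < ∑ i, y i := Finset.sum_pos (fun j _ => hy j) hK'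
  exact ⟨fun j => div_pos (hy j) hS, by rw [← Finset.sum_div, div_self hS.ne']⟩

theorem gammaRatio_update (hg : ∀ j, 0 < g j) (m : Fin K → ℕ) (i : Fin K) :
    gammaRatio g (Function.update m i (m i + 1)) =
      gammaRatio g m * ENNReal.ofReal (g i + m i) := by
  have hpos : 0 < g i + m i := add_pos_of_pos_of_nonneg (hg i) (Nat.cast_nonneg _)
  rw [gammaRatio, gammaRatio, ← Finset.mul_prod_erase _ _ (Finset.mem_univ i),
    ← Finset.mul_prod_erase Finset.univ
      (fun j => ENNReal.ofReal (Real.Gamma (g j + m j) / Real.Gamma (g j))) (Finset.mem_univ i),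
    Function.update_self, Nat.cast_add_one, ← add_assoc, Real.Gamma_add_one hpos.ne',
    mul_div_assoc, ENNReal.ofReal_mul hpos.le]
  have : ∏ j ∈ Finset.univ.erase i, ENNReal.ofReal
      (Real.Gamma (g j + (Function.update m i (m i + 1) j : ℕ)) / Real.Gamma (g j)) =
      ∏ j ∈ Finset.univ.erase i, ENNReal.ofReal (Real.Gamma (g j + m j) / Real.Gamma (g j)) :=
    Finset.prod_congr rfl fun j hj => by rw [Function.update_of_ne (Finset.ne_of_mem_erase hj)]
  rw [this]
  ring

theorem sum_update_succ (m : Fin K → ℕ) (i : Fin K) :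
    ∑ j, Function.update m i (m i + 1) j = ∑ j, m j + 1 := by
  rw [Finset.sum_update_of_mem (Finset.mem_univ i), ← Finset.erase_eq,
    ← Finset.add_sum_erase _ m (Finset.mem_univ i)]
  ring

theorem prod_update_succ (q : Fin K → ENNReal) (m : Fin K → ℕ) (i : Fin K) :
    ∏ j, q j ^ Function.update m i (m i + 1) j = (∏ j, q j ^ m j) * q i := by
  rw [← Finset.mul_prod_erase _ _ (Finset.mem_univ i),
    ← Finset.mul_prod_erase Finset.univ (fun j => q j ^ m j) (Finset.mem_univ i),
    Function.update_self, pow_succ]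
  have : ∏ j ∈ Finset.univ.erase i, q j ^ Function.update m i (m i + 1) j =
      ∏ j ∈ Finset.univ.erase i, q j ^ m j :=
    Finset.prod_congr rfl fun j hj => by rw [Function.update_of_ne (Finset.ne_of_mem_erase hj)]
  rw [this]
  ring

/-- Since the coordinates sum to `1`, the moments of order `n + 1` add up to those of order `n`;
this determines `momentFactor`. -/
theorem lintegral_dirichlet_update (hg : ∀ j, 0 < g j) (hK : 0 < K) (m : Fin K → ℕ) (i : Fin K) :
    ∫⁻ q, (∏ j, ENNReal.ofReal (q j) ^ m j) * ENNReal.ofReal (q i) ∂dirichlet g =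
      (∫⁻ q, ∏ j, ENNReal.ofReal (q j) ^ m j ∂dirichlet g) *
        ENNReal.ofReal ((g i + m i) / (∑ j, g j + (∑ j, m j : ℕ))) := by
  have hK' : (Finset.univ : Finset (Fin K)).Nonempty := ⟨⟨0, hK⟩, Finset.mem_univ _⟩
  set n := ∑ j, m j with hn
  set t := ∑ j, g j with ht
  have htn : 0 < t + n := add_pos_of_pos_of_nonneg (Finset.sum_pos (fun j _ => hg j) hK')
    (Nat.cast_nonneg _)
  have hmom : ∀ m' : Fin K → ℕ, ∫⁻ q, ∏ j, ENNReal.ofReal (q j) ^ m' j ∂dirichlet g =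
      gammaRatio g m' * momentFactor t (∑ j, m' j) := fun m' => by
    rw [← lintegral_dirichlet hg]
    refine lintegral_congr_ae ?_
    filter_upwards [ae_dirichlet hg hK] with q hq
    exact Finset.prod_congr rfl fun j _ => (ENNReal.ofReal_pow (hq.1 j).le _).symm
  have hmom' : ∀ i, ∫⁻ q, (∏ j, ENNReal.ofReal (q j) ^ m j) * ENNReal.ofReal (q i) ∂dirichlet g =
      gammaRatio g m * ENNReal.ofReal (g i + m i) * momentFactor t (n + 1) := fun i => by
    rw [← gammaRatio_update hg, hn, ← sum_update_succ m i, ← hmom]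
    simp_rw [prod_update_succ]
  have hsum : ∑ i, ∫⁻ q, (∏ j, ENNReal.ofReal (q j) ^ m j) * ENNReal.ofReal (q i) ∂dirichlet g =
      ∫⁻ q, ∏ j, ENNReal.ofReal (q j) ^ m j ∂dirichlet g := by
    rw [← lintegral_finsetSum _ fun i _ => by fun_prop]
    refine lintegral_congr_ae ?_
    filter_upwards [ae_dirichlet hg hK] with q hq
    rw [← Finset.mul_sum, ← ENNReal.ofReal_sum_of_nonneg fun j _ => (hq.1 j).le, hq.2,
      ENNReal.ofReal_one, mul_one]
  -- dividing by the common factor `gammaRatio g m` gives the recursion for `momentFactor`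
  have hrec : momentFactor t n = ENNReal.ofReal (t + n) * momentFactor t (n + 1) := by
    simp_rw [hmom'] at hsum
    rw [hmom, ← Finset.sum_mul, ← Finset.mul_sum, ← ENNReal.ofReal_sum_of_nonneg fun j _ => (by
      have := hg j; positivity), Finset.sum_add_distrib, ← ht,
      ← Nat.cast_sum, ← hn, mul_assoc] at hsum
    refine ((ENNReal.mul_right_inj ?_ ?_).1 hsum).symm
    · refine Finset.prod_ne_zero_iff.2 fun j _ => ?_
      rw [Ne, ENNReal.ofReal_eq_zero, not_le]
      have := hg j
      positivity
    · exact ENNReal.prod_ne_top fun j _ => ENNReal.ofReal_ne_top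
  rw [hmom', hmom, ← hn, hrec, div_eq_mul_inv, ENNReal.ofReal_mul (by have := hg i; positivity),
    ENNReal.ofReal_inv_of_pos htn]
  have h1 : ENNReal.ofReal (t + n) * (ENNReal.ofReal (t + n))⁻¹ = 1 :=
    ENNReal.mul_inv_cancel (by rwa [Ne, ENNReal.ofReal_eq_zero, not_le]) ENNReal.ofReal_ne_top
  calc _ = gammaRatio g m * ENNReal.ofReal (g i + m i) * momentFactor t (n + 1) * 1 := by
        rw [mul_one]
    _ = _ := by rw [← h1]; ring

end Dirichlet

/-! ### Pólya urns as mixtures -/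

section Polya

variable {Ω : Type*} [MeasurableSpace Ω] {P : Measure Ω} [IsProbabilityMeasure P] {k : ℕ}
  {γ : Fin (k + 1) → ℝ} {s : ℝ} {X : ℕ → Ω → Fin (k + 1)}

/-- Extension of a vector by zeros. -/
def extendZero (q : Fin (k + 1) → ℝ) (j : ℕ) : ℝ := if h : j < k + 1 then q ⟨j, h⟩ else 0

theorem extendZero_coe (q : Fin (k + 1) → ℝ) (i : Fin (k + 1)) : extendZero q i = q i := by
  rw [extendZero, dif_pos i.2]

theorem sum_extendZero (q : Fin (k + 1) → ℝ) :
    ∑ i ∈ Finset.range (k + 1), extendZero q i = ∑ i, q i := by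
  rw [Finset.sum_range]
  exact Finset.sum_congr rfl fun i _ => extendZero_coe q i

theorem measurable_extendZero (j : ℕ) :
    Measurable fun q : Fin (k + 1) → ℝ => extendZero q j := by
  unfold extendZero
  split_ifs with h
  · exact measurable_pi_apply _
  · exact measurable_const

theorem isSubprob_extendZero {q : Fin (k + 1) → ℝ} (hq : ∀ j, 0 < q j) (hsum : ∑ j, q j = 1) :
    IsSubprob (extendZero q) := by
  have h0 : ∀ j, 0 ≤ extendZero q j := fun j => by
    unfold extendZero
    split_ifs
    · exact (hq _).le
    · exact le_rfl
  refine ⟨h0, fun j => ?_⟩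
  rw [← hsum, ← sum_extendZero]
  rcases le_total j (k + 1) with h | h
  · exact Finset.sum_le_sum_of_subset_of_nonneg (Finset.range_mono h) fun i _ _ => h0 i
  · refine (Finset.sum_subset (Finset.range_mono h) fun i _ hi => ?_).ge
    rw [Finset.mem_range] at hi
    exact dif_neg hi

theorem selectProb_extendZero {q : Fin (k + 1) → ℝ} (hsum : ∑ j, q j = 1) (i : Fin (k + 1)) :
    selectProb (extendZero q) k i = q i := by
  have hi := extendZero_coe q i
  rw [selectProb]
  split_ifs with h1 h2
  · exact hi
  · have h3 := sum_extendZero q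
    have h4 : extendZero q k = q i := (congrArg (extendZero q) h2.symm).trans hi
    rw [Finset.sum_range_succ, hsum, h4] at h3
    linarith
  · omega

/-- The draws from a Pólya urn are a mixture of independent draws with Dirichlet frequencies. -/
theorem IsPolyaUrn.measure_past (hX : IsPolyaUrn P γ s X) (hγ : ∀ j, 0 < γ j) (hs : 0 < s)
    (x : ℕ → Fin (k + 1)) (n : ℕ) :
    P {ω | ∀ i < n, X i ω = x i} =
      ∫⁻ q, ∏ i ∈ Finset.range n, ENNReal.ofReal (q (x i)) ∂dirichlet fun j => γ j / s := by
  have hg : ∀ j, 0 < γ j / s := fun j => div_pos (hγ j) hs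
  have := isProbabilityMeasure_dirichlet hg
  have hprod : ∀ (n : ℕ) (q : Fin (k + 1) → ℝ), ∏ i ∈ Finset.range n, ENNReal.ofReal (q (x i)) =
      ∏ j, ENNReal.ofReal (q j) ^ ((Finset.range n).filter fun i => x i = j).card := fun n q => by
    rw [← Finset.prod_fiberwise' (Finset.range n) x fun j => ENNReal.ofReal (q j)]
    exact Finset.prod_congr rfl fun j _ => by rw [Finset.prod_const]
  induction n with
  | zero => simp
  | succ n ih =>
    simp_rw [Finset.prod_range_succ]
    rw [setOf_forall_lt_succ, hX.step, ih]
    simp_rw [hprod n]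
    rw [lintegral_dirichlet_update hg k.succ_pos]
    congr 2
    rw [sum_urnContent, ← Finset.card_eq_sum_card_fiberwise
      (fun _ _ => Finset.mem_coe.2 (Finset.mem_univ _)), Finset.card_range, urnContent,
      ← Finset.sum_div]
    have h1 : 0 < ∑ j, γ j := Finset.sum_pos (fun j _ => hγ j) ⟨0, Finset.mem_univ _⟩
    field_simp

/-- In a Pólya urn, the fractions of the colours converge to a Dirichlet vector. -/
theorem IsPolyaUrn.exists_limit (hX : IsPolyaUrn P γ s X) (hγ : ∀ j, 0 < γ j) (hs : 0 < s) :
    ∃ Q : Ω → Fin (k + 1) → ℝ, HasLaw Q (dirichlet fun j => γ j / s) P ∧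
      (∀ᵐ ω ∂P, ∀ j, 0 < Q ω j) ∧
      ∀ᵐ ω ∂P, Tendsto (fun (n : ℕ) j =>
        urnContent γ s (fun i => X i ω) n j / (∑ i, γ i + s * n)) atTop (𝓝 (Q ω)) := by
  have hg : ∀ j, 0 < γ j / s := fun j => div_pos (hγ j) hs
  have := isProbabilityMeasure_dirichlet hg
  have hdir := ae_dirichlet hg k.succ_pos
  have hsub : ∀ᵐ q ∂dirichlet fun j => γ j / s, IsSubprob (extendZero q) :=
    hdir.mono fun q hq => isSubprob_extendZero hq.1 hq.2
  have hcap : IsAdapted fun _ _ => k := fun _ _ _ _ => rfl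
  have hYm := measurable_mixedDraw (p := extendZero (k := k)) hcap measurable_extendZero
  have hYm' : Measurable fun x i => mixedDraw (fun _ _ => k) (extendZero (k := k)) i x :=
    measurable_pi_lambda _ hYm
  have hXm : ∀ n, Measurable fun ω => (X n ω : ℕ) := fun n =>
    (measurable_of_countable (fun i : Fin (k + 1) => (i : ℕ))).comp (hX.measurable n)
  have hXm' : Measurable fun ω i => (X i ω : ℕ) := measurable_pi_lambda _ hXm
  have hXY : P.map (fun ω i => (X i ω : ℕ)) =
      ((dirichlet fun j => γ j / s).prod uniforms).map
        fun x i => mixedDraw (fun _ _ => k) extendZero i x := by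
    refine map_eq_map_of_forall_past hXm hYm fun n c => ?_
    rw [measure_mixedDraw hcap measurable_extendZero hsub]
    by_cases hc : ∀ i < n, c i < k + 1
    · set x : ℕ → Fin (k + 1) := fun i => if h : c i < k + 1 then ⟨c i, h⟩ else 0 with hx
      have hcx : ∀ i < n, c i = x i := fun i hi => by
        simp only [hx]; rw [dif_pos (hc i hi)]
      have h1 : {ω | ∀ i < n, (X i ω : ℕ) = c i} = {ω | ∀ i < n, X i ω = x i} := by
        ext ω
        exact forall₂_congr fun i hi => by rw [hcx i hi, Fin.val_inj]
      rw [h1, hX.measure_past hγ hs]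
      refine lintegral_congr_ae ?_
      filter_upwards [hdir] with q hq
      refine Finset.prod_congr rfl fun i hi => ?_
      rw [hcx i (Finset.mem_range.1 hi), selectProb_extendZero hq.2]
    · push Not at hc
      obtain ⟨i, hi, hci⟩ := hc
      have h1 : {ω | ∀ i < n, (X i ω : ℕ) = c i} = ∅ := by
        ext ω
        simp only [Set.mem_ofPred_eq, Set.mem_empty_iff_false, iff_false]
        intro h
        have := h i hi
        omega
      have h2 : ∀ q : Fin (k + 1) → ℝ,
          ∏ i ∈ Finset.range n, ENNReal.ofReal (selectProb (extendZero q) k (c i)) = 0 := by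
        intro q
        refine Finset.prod_eq_zero (Finset.mem_range.2 hi) ?_
        rw [selectProb, if_neg (by omega), if_neg (by omega), ENNReal.ofReal_zero]
      rw [h1]
      simp [h2]
  have hfst : Tendsto Prod.fst
      (ae ((dirichlet fun j => γ j / s).prod uniforms)) (ae (dirichlet fun j => γ j / s)) :=
    Measure.quasiMeasurePreserving_fst.tendsto_ae
  obtain ⟨Q, hQ, hlim⟩ := exists_limit_of_map_eq (B := Fin (k + 1) → ℝ) hXm' hYm' hXY
    (F := fun n c j => (tableSize c n j : ℝ) / n)
    (fun n => measurable_pi_lambda _ fun j =>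
      ((measurable_from_nat (f := fun i => (i : ℝ))).comp (measurable_tableSize n j)).div_const _)
    (Z := fun x => x.1) (by
      filter_upwards [ae_tendsto_mixedDraw_const measurable_extendZero hsub k,
        hfst.eventually hdir] with x hx hx1
      refine tendsto_pi_nhds.2 fun j => ?_
      have := hx j
      rwa [selectProb_extendZero hx1.2] at this)
  have hQ' : HasLaw Q (dirichlet fun j => γ j / s) P := by
    rwa [Measure.map_fst_prod, measure_univ, one_smul] at hQ
  refine ⟨Q, hQ', ?_, ?_⟩
  · have h1 := hdir.mono fun q hq => hq.1
    rw [← hQ'.map_eq] at h1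
    exact ae_of_ae_map hQ'.aemeasurable h1
  · filter_upwards [hlim] with ω hω
    refine tendsto_pi_nhds.2 fun j => ?_
    have h1 := tendsto_pi_nhds.1 hω j
    have h2 : Tendsto (fun n : ℕ =>
        (γ j / n + s * ((tableSize (fun i => (X i ω : ℕ)) n j : ℝ) / n)) /
        ((∑ i, γ i) / n + s)) atTop (𝓝 ((0 + s * Q ω j) / (0 + s))) :=
      ((tendsto_const_div_atTop_nhds_zero_nat _).add (h1.const_mul s)).div
        ((tendsto_const_div_atTop_nhds_zero_nat _).add_const s) (by simpa using hs.ne')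
    rw [zero_add, zero_add, mul_div_cancel_left₀ _ hs.ne'] at h2
    refine h2.congr' ?_
    filter_upwards [eventually_gt_atTop 0] with n hn
    have hn' : (0 : ℝ) < n := by exact_mod_cast hn
    have h3 : tableSize (fun i => (X i ω : ℕ)) n j =
        ((Finset.range n).filter (fun i => X i ω = j)).card := by
      simp only [tableSize, Fin.val_inj]
    have h4 : 0 < ∑ j, γ j := Finset.sum_pos (fun j _ => hγ j) ⟨0, Finset.mem_univ _⟩
    rw [urnContent, h3]
    field_simp

end Polya

/-! ### The subtrees in terms of the subtree indices of the leaves -/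

section Consistent

variable {Ω : Type*} {α : ℝ} {T : ℕ → Ω → DTree} {m : ℕ} {ω : Ω} (h : ConsistentAt α T m ω)
include h

theorem ConsistentAt.numExtra_add_three :
    numExtra (T m ω) + 3 = numTables (fun k => leafProcess T k ω) (m + 1) := by
  obtain ⟨ℓ, hℓ, hk⟩ := h
  rw [hℓ.numExtra_add_three]
  exact numTables_congr fun k hkm => hk k (Nat.lt_succ_iff.1 hkm)

theorem ConsistentAt.leafCount_eq {i : ℕ} (hi : i < numExtra (T m ω) + 3) :
    leafCount (T m ω) i = tableSize (fun k => leafProcess T k ω) (m + 1) i := by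
  obtain ⟨ℓ, hℓ, hk⟩ := h
  rw [hℓ.leafCount_eq hi]
  exact tableSize_congr (fun k hkm => hk k (Nat.lt_succ_iff.1 hkm)) i

theorem ConsistentAt.weight_subtree {i : ℕ} (hi : i < numExtra (T m ω) + 3) :
    weight α (T m ω) (subtree (T m ω) i) =
      α * tableSize (fun k => leafProcess T k ω) (m + 1) i - 1 := by
  rw [← h.leafCount_eq hi]
  obtain ⟨ℓ, hℓ, -⟩ := h
  rw [hℓ.weight_subtree hi, hℓ.leafCount_eq hi]

/-- The leaves of the extra subtrees are those with an index `≥ 3`. -/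
theorem ConsistentAt.extraLeafCount_eq :
    extraLeafCount (T m ω) = Nat.count (fun k => 3 ≤ leafProcess T k ω) (m + 1) := by
  have h1 := sum_tableSize_add_count (fun k => leafProcess T k ω) (m + 1)
  rw [← h.leafCount_eq (by omega), ← h.leafCount_eq (by omega), ← h.leafCount_eq (by omega)] at h1
  obtain ⟨ℓ, hℓ, -⟩ := h
  have h2 := hℓ.sum_tableSize_range
  rw [← hℓ.leafCount_eq (by omega), ← hℓ.leafCount_eq (by omega),
    ← hℓ.leafCount_eq (by omega)] at h2
  omega

theorem ConsistentAt.remainingWeight_eq :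
    remainingWeight α (T m ω) = α * extraLeafCount (T m ω) + 2 - α := by
  obtain ⟨ℓ, hℓ, -⟩ := h
  exact hℓ.remainingWeight_eq

end Consistent

theorem leafProcess_of_lt {Ω : Type*} (T : ℕ → Ω → DTree) (ω : Ω) :
    ∀ k < 3, leafProcess T k ω = k := fun _ hk => if_pos hk

section Weights

variable {Ω : Type*} {α : ℝ} {T : ℕ → Ω → DTree}

theorem ConsistentAt.fourWeights_eq {n : ℕ} {ω : Ω} (h : ConsistentAt α T (n + 2) ω) :
    fourWeights α (T (n + 2) ω) = urnContent ![α - 1, α - 1, α - 1, 2 - α] α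
      (fun k => fourColour (leafProcess T (k + 3) ω)) n := by
  funext j
  rw [urnContent_four α (leafProcess_of_lt T ω)]
  have h3 : ∀ i < 3, weight α (T (n + 2) ω) (subtree (T (n + 2) ω) i) =
      α * tableSize (fun k => leafProcess T k ω) (n + 3) i - 1 := fun i hi =>
    h.weight_subtree (by omega)
  rw [fourWeights]
  fin_cases j
  · simpa using h3 0 (by norm_num)
  · simpa using h3 1 (by norm_num)
  · simpa using h3 2 (by norm_num)
  · have h4 := h.remainingWeight_eq
    rw [h.extraLeafCount_eq] at h4
    simp only [Fin.reduceFinMk, Matrix.cons_val, lt_self_iff_false, if_false]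
    rw [h4]
    ring

theorem ConsistentAt.threeWeights_eq {n : ℕ} {ω : Ω} (h : ConsistentAt 2 T (n + 2) ω)
    (h3 : ∀ k, leafProcess T k ω < 3) :
    threeWeights 2 (T (n + 2) ω) = urnContent ![1, 1, 1] 2
      (fun k => threeColour (leafProcess T (k + 3) ω)) n := by
  funext j
  rw [urnContent_three (leafProcess_of_lt T ω) h3]
  have h3 : ∀ i < 3, weight 2 (T (n + 2) ω) (subtree (T (n + 2) ω) i) =
      2 * tableSize (fun k => leafProcess T k ω) (n + 3) i - 1 := fun i hi =>
    h.weight_subtree (by omega)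
  rw [threeWeights]
  fin_cases j
  · simpa using h3 0 (by norm_num)
  · simpa using h3 1 (by norm_num)
  · simpa using h3 2 (by norm_num)

theorem div_linear {N : ℝ} (hN : N ≠ 0) (α t : ℝ) :
    (α * (t / N) - 1 / N) / (α + (2 - α) / N) = (α * t - 1) / (α * N + 2 - α) := by
  have h : α + (2 - α) / N = (α * N + 2 - α) / N := by
    rw [add_sub_assoc, add_div, mul_div_cancel_right₀ _ hN]
  rw [h, ← mul_div_assoc, ← sub_div, div_div_div_cancel_right₀ hN]

theorem tendsto_count_atTop {p : ℕ → Prop} [DecidablePred p] (hp : (Set.ofPred p).Infinite) :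
    Tendsto (Nat.count p) atTop atTop :=
  tendsto_atTop_atTop_of_monotone (Nat.count_monotone p) fun b =>
    ⟨Nat.nth p b, (Nat.count_nth_of_infinite hp b).ge⟩

/-- The limiting fraction of the fourth colour is positive, hence that colour is drawn infinitely
often. -/
theorem infinite_of_tendsto_urnContent (hα₁ : 1 < α) {e : ℕ → ℕ} (he : ∀ k < 3, e k = k)
    {l : ℝ} (hl : 0 < l) (hlim : Tendsto (fun n : ℕ =>
      urnContent ![α - 1, α - 1, α - 1, 2 - α] α (fun k => fourColour (e (k + 3))) n 3 /
        (2 * α - 1 + α * n)) atTop (𝓝 l)) : (Set.ofPred fun k => 3 ≤ e k).Infinite := by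
  intro hfin
  have h1 : ∀ n, Nat.count (fun k => 3 ≤ e k) n ≤ hfin.toFinset.card := fun n => by
    rw [Nat.count_eq_card_filter_range]
    exact Finset.card_le_card fun k hk => by
      rw [Set.Finite.mem_toFinset]
      exact (Finset.mem_filter.1 hk).2
  have h2 : Tendsto (fun n : ℕ => 2 * α - 1 + α * n) atTop atTop :=
    tendsto_atTop_add_const_left _ _
      (tendsto_natCast_atTop_atTop.const_mul_atTop (by linarith))
  have h3 : Tendsto (fun n : ℕ => (α * hfin.toFinset.card + |2 - α|) / (2 * α - 1 + α * n)) atTop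
      (𝓝 0) := h2.const_div_atTop _
  have h4 : l ≤ 0 := by
    refine le_of_tendsto_of_tendsto' hlim h3 fun n => ?_
    rw [urnContent_four α he, if_neg (by decide)]
    have h5 : (Nat.count (fun k => 3 ≤ e k) (n + 3) : ℝ) ≤ hfin.toFinset.card := by
      exact_mod_cast h1 (n + 3)
    have h6 : 0 < 2 * α - 1 + α * n := by
      have : 0 ≤ α * n := by positivity
      linarith
    gcongr
    exact le_abs_self _
  linarith

end Weights

end MarchalTree

theorem mainTheorem5 {Ω : Type*} [MeasurableSpace Ω] (P : Measure Ω) [IsProbabilityMeasure P]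
    (α β : ℝ) (hα₁ : 1 < α) (hα₂ : α ≤ 2) (hβ : β = 1 - 1 / α)
    (T : ℕ → Ω → MarchalTree.DTree) (hT : MarchalTree.IsMarchal P α T) :
    (α = 2 →
      (∀ᵐ ω ∂P, ∀ n, MarchalTree.numExtra (T (n + 2) ω) = 0) ∧
      (∃ D : ℕ → Ω → Fin 3, MarchalTree.IsPolyaUrn P ![1, 1, 1] 2 D ∧
        ∀ᵐ ω ∂P, ∀ n, MarchalTree.threeWeights α (T (n + 2) ω) =
          MarchalTree.urnContent ![1, 1, 1] 2 (fun k => D k ω) n) ∧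
      (∃ X : Ω → Fin 3 → ℝ,
        HasLaw X (MarchalTree.dirichlet ![1 / 2, 1 / 2, 1 / 2]) P ∧
        ∀ᵐ ω ∂P, Tendsto
          (fun (n : ℕ) i => MarchalTree.threeWeights α (T (n + 2) ω) i / (2 * (n : ℝ) + 3))
          atTop (𝓝 (X ω)))) ∧
    (α < 2 →
      (∀ᵐ ω ∂P, Tendsto (fun n => MarchalTree.numExtra (T (n + 2) ω)) atTop atTop) ∧
      (∃ D : ℕ → Ω → Fin 4,
        MarchalTree.IsPolyaUrn P ![α - 1, α - 1, α - 1, 2 - α] α D ∧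
        ∀ᵐ ω ∂P, ∀ n, MarchalTree.fourWeights α (T (n + 2) ω) =
          MarchalTree.urnContent ![α - 1, α - 1, α - 1, 2 - α] α (fun k => D k ω) n) ∧
      (∃ X : Ω → Fin 4 → ℝ,
        HasLaw X (MarchalTree.dirichlet ![β, β, β, 1 - 2 * β]) P ∧
        ∀ᵐ ω ∂P, Tendsto
          (fun (n : ℕ) i =>
            MarchalTree.fourWeights α (T (n + 2) ω) i / (((n : ℝ) + 2) * α - 1))
          atTop (𝓝 (X ω))) ∧
      (∃ C : ℕ → Ω → ℕ, MarchalTree.IsCRP P (1 - β) (1 - 2 * β) C ∧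
        ∀ᵐ ω ∂P, ∀ n,
          MarchalTree.numExtra (T (n + 2) ω) =
            MarchalTree.numTables (fun k => C k ω)
              (MarchalTree.extraLeafCount (T (n + 2) ω)) ∧
          ∀ j < MarchalTree.numExtra (T (n + 2) ω),
            MarchalTree.leafCount (T (n + 2) ω) (j + 3) =
              MarchalTree.tableSize (fun k => C k ω)
                (MarchalTree.extraLeafCount (T (n + 2) ω)) j ∧
            MarchalTree.weight α (T (n + 2) ω) (MarchalTree.subtree (T (n + 2) ω) (j + 3)) =
              α * MarchalTree.tableSize (fun k => C k ω)
                (MarchalTree.extraLeafCount (T (n + 2) ω)) j - 1) ∧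
      (∃ Q : Ω → ℕ → ℝ,
        (∀ᵐ ω ∂P, Tendsto
          (fun (n : ℕ) (j : ℕ) =>
            MarchalTree.weight α (T (n + 2) ω) (MarchalTree.subtree (T (n + 2) ω) (j + 3)) /
              MarchalTree.remainingWeight α (T (n + 2) ω))
          atTop (𝓝 (Q ω))) ∧
        HasLaw Q (MarchalTree.GEM (1 - β) (1 - 2 * β)) P ∧
        HasLaw (fun ω => MarchalTree.ranked (Q ω)) (MarchalTree.PD (1 - β) (1 - 2 * β)) P)) := by
  have hα0 : (0 : ℝ) < α := by linarith
  have hcons := hT.ae_consistentAt hα₁ hα₂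
  have hE := hT.isLeafProcess hα₁ hα₂
  have hE3 := fun ω => MarchalTree.leafProcess_of_lt T ω
  refine ⟨?_, ?_⟩
  · rintro rfl
    have hlt := hE.ae_lt_three
    have hD := hE.isPolyaUrn_three
    have hW : ∀ᵐ ω ∂P, ∀ n, MarchalTree.threeWeights 2 (T (n + 2) ω) =
        MarchalTree.urnContent ![1, 1, 1] 2
          (fun k => MarchalTree.threeColour (MarchalTree.leafProcess T (k + 3) ω)) n := by
      filter_upwards [hcons, hlt] with ω hω h3 n using (hω n).threeWeights_eq h3
    refine ⟨?_, ⟨_, hD, hW⟩, ?_⟩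
    · filter_upwards [hcons, hlt] with ω hω h3 n
      have h1 := (hω n).numExtra_add_three
      have h2 : MarchalTree.numTables (fun k => MarchalTree.leafProcess T k ω) (n + 2 + 1) ≤ 3 := by
        calc _ ≤ (Finset.range 3).card := Finset.card_le_card fun i hi => by
              obtain ⟨k, -, rfl⟩ := Finset.mem_image.1 hi
              exact Finset.mem_range.2 (h3 k)
          _ = 3 := Finset.card_range 3
      omega
    · obtain ⟨X, hX, -, hlim⟩ := hD.exists_limit (by intro j; fin_cases j <;> norm_num) two_pos
      refine ⟨X, ?_, ?_⟩
      · convert! hX using 2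
        funext j
        fin_cases j <;> simp
      · filter_upwards [hlim, hW] with ω hω hWω
        refine hω.congr fun n => ?_
        funext j
        rw [hWω n]
        congr 1
        simp [Fin.sum_univ_three]
        ring
  · intro hα
    have hβ1 : 1 - β = 1 / α := by rw [hβ]; ring
    have hβ2 : 1 - 2 * β = 2 / α - 1 := by rw [hβ]; ring
    have hD := hE.isPolyaUrn_four hα₁ hα₂
    have hsum : ∑ i, (![α - 1, α - 1, α - 1, 2 - α] : Fin 4 → ℝ) i = 2 * α - 1 := by
      simp [Fin.sum_univ_four]
      ring
    have hW : ∀ᵐ ω ∂P, ∀ n, MarchalTree.fourWeights α (T (n + 2) ω) =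
        MarchalTree.urnContent ![α - 1, α - 1, α - 1, 2 - α] α
          (fun k => MarchalTree.fourColour (MarchalTree.leafProcess T (k + 3) ω)) n := by
      filter_upwards [hcons] with ω hω n using (hω n).fourWeights_eq
    obtain ⟨X, hX, hXpos, hXlim⟩ := hD.exists_limit
      (by intro j; fin_cases j <;> simp <;> linarith) hα0
    rw [hsum] at hXlim
    have hinf : ∀ᵐ ω ∂P, (Set.ofPred fun k => 3 ≤ MarchalTree.leafProcess T k ω).Infinite := by
      filter_upwards [hXpos, hXlim] with ω hpos hlim
      exact MarchalTree.infinite_of_tendsto_urnContent hα₁ (hE3 ω) (hpos 3)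
        (tendsto_pi_nhds.1 hlim 3)
    have hC := hE.isCRP hα₁ hα₂ hinf
    -- the extra leaves, renumbered from `0`, are the customers of the restaurant
    have hexp : ∀ᵐ ω ∂P, ∀ n,
        MarchalTree.numExtra (T (n + 2) ω) =
          MarchalTree.numTables (fun k => MarchalTree.extraIndex (MarchalTree.leafProcess T) k ω)
            (MarchalTree.extraLeafCount (T (n + 2) ω)) ∧
        ∀ j < MarchalTree.numExtra (T (n + 2) ω),
          MarchalTree.leafCount (T (n + 2) ω) (j + 3) =
            MarchalTree.tableSize
              (fun k => MarchalTree.extraIndex (MarchalTree.leafProcess T) k ω)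
              (MarchalTree.extraLeafCount (T (n + 2) ω)) j ∧
          MarchalTree.weight α (T (n + 2) ω) (MarchalTree.subtree (T (n + 2) ω) (j + 3)) =
            α * MarchalTree.tableSize
              (fun k => MarchalTree.extraIndex (MarchalTree.leafProcess T) k ω)
              (MarchalTree.extraLeafCount (T (n + 2) ω)) j - 1 := by
      filter_upwards [hcons] with ω hω n
      have hf := MarchalTree.followsExtra_extraIndex (MarchalTree.leafProcess T) ω (n + 2 + 1)
      have h1 := (hω n).numExtra_add_three
      rw [hf.numTables_eq (by omega) (hE3 ω), ← (hω n).extraLeafCount_eq] at h1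
      refine ⟨by omega, fun j hj => ?_⟩
      have h2 := hf.tableSize_eq j
      rw [← (hω n).extraLeafCount_eq] at h2
      exact ⟨by rw [(hω n).leafCount_eq (by omega), h2],
        by rw [(hω n).weight_subtree (by omega), h2]⟩
    have hcount : ∀ᵐ ω ∂P,
        Tendsto (fun n => MarchalTree.extraLeafCount (T (n + 2) ω)) atTop atTop := by
      filter_upwards [hinf, hcons] with ω h1 h2
      refine ((MarchalTree.tendsto_count_atTop h1).comp (tendsto_add_atTop_nat 3)).congr fun n => ?_
      exact (h2 n).extraLeafCount_eq.symm
    have ha : (0 : ℝ) ≤ 1 / α := by positivity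
    have ha' : 1 / α < 1 := by rw [div_lt_one hα0]; exact hα₁
    have hθ : -(1 / α) < 2 / α - 1 := by
      have : 1 ≤ 2 / α := by rw [le_div_iff₀ hα0]; linarith
      have : 0 < 1 / α := by positivity
      linarith
    obtain ⟨hnum, Q, hQ, hQlim⟩ := hC.exists_frequencies ha ha' hθ
    have hK : ∀ᵐ ω ∂P, Tendsto (fun n => MarchalTree.numExtra (T (n + 2) ω)) atTop atTop := by
      filter_upwards [hnum, hcount, hexp] with ω h1 h2 h3
      exact (h1.comp h2).congr fun n => (h3 n).1.symm
    rw [hβ1, hβ2]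
    refine ⟨hK, ⟨_, hD, hW⟩, ⟨X, ?_, ?_⟩, ⟨_, hC, hexp⟩, ⟨Q, ?_, hQ, ?_⟩⟩
    · convert! hX using 2
      funext j
      fin_cases j <;> simp [hβ] <;> field_simp
    · filter_upwards [hXlim, hW] with ω hω hWω
      refine hω.congr fun n => ?_
      funext j
      rw [hWω n]
      congr 1
      ring
    · filter_upwards [hQlim, hcount, hexp, hK, hcons] with ω h1 h2 h3 h4 h5
      refine tendsto_pi_nhds.2 fun j => ?_
      -- the weights are affine in the numbers of leaves, so their ratio has the same limit
      have h6 := (tendsto_pi_nhds.1 h1 j).comp h2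
      have h7 : Tendsto (fun n => (MarchalTree.extraLeafCount (T (n + 2) ω) : ℝ)) atTop atTop :=
        tendsto_natCast_atTop_atTop.comp h2
      have h8 : ∀ c : ℝ, Tendsto
          (fun n => c / (MarchalTree.extraLeafCount (T (n + 2) ω) : ℝ)) atTop (𝓝 0) :=
        fun c => h7.const_div_atTop c
      have h9 := ((h6.const_mul α).sub (h8 1)).div ((h8 (2 - α)).const_add α)
        (by rw [add_zero]; exact hα0.ne')
      rw [add_zero, sub_zero, mul_div_cancel_left₀ _ hα0.ne'] at h9
      refine h9.congr' ?_
      filter_upwards [h4.eventually_gt_atTop j, h2.eventually_gt_atTop 0] with n hn hn0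
      have hn0' : (0 : ℝ) < MarchalTree.extraLeafCount (T (n + 2) ω) := by exact_mod_cast hn0
      rw [((h3 n).2 j hn).2, (h5 n).remainingWeight_eq]
      simp only [Function.comp_apply, Pi.div_apply]
      exact MarchalTree.div_linear hn0'.ne' α _
    · refine ⟨MarchalTree.measurable_ranked.comp_aemeasurable hQ.aemeasurable, ?_⟩
      have := AEMeasurable.map_map_of_aemeasurable
        MarchalTree.measurable_ranked.aemeasurable hQ.aemeasurable
      rw [hQ.map_eq] at this
      exact this.symm
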